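/- **Theorem.** Let $0<\epsilon<1$, let $N\ge 3$ be the number of voters with $\epsilon N\ge 1$, let $c\ge 2$ be the number of candidates and let the qudit dimension $m\geq 1$ be a multiple of $c$. Then the dual-basis quantum self-tallying protocol $\Pi$ with voters $V_1,\dots,V_N$, at most $\epsilon N$ of which may be corrupted, does not satisfy $\epsilon$-quantum privacy. More precisely, there are a quantum polynomial-time adversary $\mathcal A$ and a non-negligible function $\alpha\colon\mathbb N\to[0,\infty)$ such that for every security parameter $\delta_0\in\mathbb N$: the privacy experiment with $\mathcal A$ outputs $-1$ with probability $0$; with probability at least $\alpha(\delta_0)$ the cut-and-choose test is passed and all $N$ untested ballot states are corrupted (they are computational basis product states instead of $|D_1\rangle$); and $$\Pr[\text{output}=1\mid \text{output}\ne -1]\ \ge\ \tfrac12+\alpha(\delta_0).$$ *The protocol $\Pi$.* Let $|D_1\rangle$ be the normalised uniform superposition of all $|i_1\rangle\cdots|i_N\rangle$, $0\le i_k<m$, with $\sum_k i_k\equiv 0 \pmod c$, and let $|D_2\rangle=\frac1{\sqrt{N!}}\sum|i_1\rangle\cdots|i_N\rangle$, summed over the permutations of the $N$ basis labels of an $N$-dimensional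 qudit. *Setup.* A fixed voter, the distributor, prepares $N+N2^{\delta_0}$ states $|D_1\rangle$ and $1+N2^{\delta_0}$ states $|D_2\rangle$; voter $V_k$ receives the $k$-th qudit of each. In a uniformly random order, each voter picks $2^{\delta_0}$ untested states $|D_1\rangle$ at random, and all voters measure their qudits of half of them (rounded down) in the computational basis and of the others in the Fourier basis, and simultaneously broadcast the results. The results have to add up to $0$ modulo $c$ in the computational basis and have to be all equal in the Fourier basis. The states $|D_2\rangle$ are tested likewise: the results have to be a permutation in the computational basis, and an outcome of non-zero probability for $|D_2\rangle$ in the Fourier basis. If a test fails, the protocol aborts. Otherwise all voters measure the remaining $N$ states $|D_1\rangle$ and the remaining state $|D_2\rangle$ in the computational basis; $V_k$ obtains a column $(\xi_k^1,\dots,\xi_k^N)$ and a secret row $sk_k\in\{1,\dots,N\}$. *Casting.* $V_k$ adds its vote $v_k\in\{0,\dots,c-1\}$ to $\xi_k^{sk_k}$ (modulo $m$) and broadcasts its column. *Tally.* The outcome is the list of the row sums modulo $c$ of the public table. It is $\bot$ if a column is missing or if some honest voter does not find its vote as the sum of its row $sk_k$. *The privacy experiment.* The adversary chooses the votes $v_k$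 of all voters, a permutation $F$ of the voters, and a set $\mathcal V_{\mathcal A}$ of at most $\epsilon N$ voters to corrupt. It prepares the states arbitrarily if the distributor is corrupted, and during the setup it holds the qudits of the corrupted voters, chooses the states they test and the results they announce. A uniform bit $\beta$ is drawn. In the casting phase the voters take turns in a uniformly random order. At the turn of an uncorrupted voter the adversary may corrupt it as long as $|\mathcal V_{\mathcal A}|\le\epsilon N$, and then learns its blank ballot. An honest voter $V_k$ casts the vote $v_k$ if $\beta=0$ and $v_{F(k)}$ if $\beta=1$; its column is shown to the adversary, who may suppress but not change it. The adversary chooses the columns of corrupted voters. After an aborted setup the honest ballots are $\bot$. If the multiset of the $v_{F(k)}$ over the honest voters differs from that of the $v_k$, the output is $-1$. Otherwise the adversary is told the outcome and guesses $\beta$; the output is $1$ if the guess is right and $0$ if not. *Adversaries, negligible functions, privacy.* An adversary is a finite collection of programs, independent of $\delta_0$, for a random access machine with quantum memory; its gates are unitaries with algebraic entries, each on a bounded number of qudits. It is quantum polynomial-time if its total number of steps is bounded by a polynomial in $2^{\delta_0}$, the number of states tested by each voter. The parameters $N,c,m,\epsilon$ are constants. A function $f$ of $\delta_0$ is negligible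 if $\delta_0^n f(\delta_0)\to0$ as $\delta_0\to\infty$ for each $n\in\mathbb N$. The protocol satisfies $\epsilon$-quantum privacy if for every quantum polynomial-time adversary the function $\Pr[\text{output}=1\mid\text{output}\ne-1]-\frac12$ (taken as $0$ where $\Pr[\text{output}\neq -1]=0$) is negligible. -/

import Mathlib

/-!
# The dual-basis self-tallying voting protocol and its privacy experiment

The file defines, in this order: finite-dimensional quantum registers, classical-quantum
computations, a step-counted programming language for quantum polynomial-time adversaries,
the self-tallying protocol (setup with cut-and-choose, casting, tally), the privacy
experiment, and epsilon-quantum privacy.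
-/

namespace SelfTally

noncomputable section

open scoped Classical

/-- `N` voters, `c` candidates, ballot qudits of dimension `m`. -/
structure Params where
  N : ℕ
  c : ℕ
  m : ℕ
  N_pos : 0 < N
  m_pos : 0 < m

/-- The two families of shared states: `ballot` for the states `D₁` (qudits of dimension `m`),
`index` for the states `D₂` (qudits of dimension `N`). -/
inductive Kind where
  | ballot
  | index

/-! ## Quantum registers -/

section Registers

/-- Dimension of a single qudit of the given kind. -/
def Params.dim (P : Params) : Kind → ℕ
  | .ballot => P.m
  | .index => P.N

theorem Params.dim_pos (P : Params) : ∀ κ, 0 < P.dim κ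
  | .ballot => P.m_pos
  | .index => P.N_pos

/-- Reduction of a natural number to a basis label of a qudit of kind `κ`. -/
def Params.toLabel (P : Params) (κ : Kind) (n : ℕ) : Fin (P.dim κ) :=
  ⟨n % P.dim κ, Nat.mod_lt _ (P.dim_pos κ)⟩

/-- There is an unlimited supply of qudits of each kind; a qudit is named by kind and number. -/
abbrev Cell := Kind × ℕ

/-- A computational basis vector of all the qudits together. -/
abbrev Labels (P : Params) := (q : Cell) → Fin (P.dim q.1)

/-- A (not necessarily normalised) joint pure state, written in the computational basis. -/
abbrev QState (P : Params) := Labels P →₀ ℂ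

variable {P : Params}

/-- All qudits in state `|0⟩`. -/
def zeroState (P : Params) : QState P := Finsupp.single (fun q => P.toLabel q.1 0) 1

/-- Squared Hilbert space norm. -/
def normSq (ψ : QState P) : ℝ := ψ.sum fun _ z => ‖z‖ ^ 2

/-- Replace the labels of the qudits `(κ i, a i)` by `y i`. -/
def overwrite {r : ℕ} (κ : Fin r → Kind) (a : Fin r → ℕ) (x : Labels P)
    (y : (i : Fin r) → Fin (P.dim (κ i))) : Labels P :=
  (List.finRange r).foldl (fun x i => Function.update x (κ i, a i) (y i)) x

/-- The linear operator with matrix `U` on the (distinct) qudits `(κ i, a i)`, tensored with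
the identity on all other qudits. -/
def applyOp {r : ℕ} (κ : Fin r → Kind) (a : Fin r → ℕ)
    (U : Matrix ((i : Fin r) → Fin (P.dim (κ i))) ((i : Fin r) → Fin (P.dim (κ i))) ℂ)
    (ψ : QState P) : QState P :=
  ψ.sum fun x z => ∑ y, Finsupp.single (overwrite κ a x y) (U y (fun i => x (κ i, a i)) * z)

/-- `fourier d x y` is the coefficient `⟨x | y⟩_F` of the computational basis vector `x` in
the Fourier basis vector `y` of a `d`-dimensional qudit. -/
def fourier (d : ℕ) (x y : Fin d) : ℂ :=
  Complex.exp (2 * Real.pi * Complex.I * ((x.val * y.val : ℕ) : ℂ) / d) / Real.sqrt d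

/-- The unitary that maps the Fourier basis vector `y` of one qudit to the computational basis
vector `y`. -/
def fourierToComp (q : Cell) (ψ : QState P) : QState P :=
  ψ.sum fun x z => ∑ y : Fin (P.dim q.1),
    Finsupp.single (Function.update x q y) (star (fourier (P.dim q.1) (x q) y) * z)

end Registers

/-! ## Classical-quantum computations -/

section Computations

/-- A computation acts on the joint quantum state and returns the finite family of its branches.
A branch consists of the classical result, the probability weight of the classical random
choices, and the unnormalised quantum state; it occurs with probability weight times squared
norm. -/
def QComp (P : Params) (α : Type) : Type := QState P → Multiset (α × ℝ × QState P)

instance (P : Params) : Monad (QComp P) where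
  pure a := fun ψ => {(a, 1, ψ)}
  bind f g := fun ψ => (f ψ).bind fun u =>
    (g u.1 u.2.2).map fun v => (v.1, u.2.1 * v.2.1, v.2.2)

variable {P : Params}

/-- Apply an operator to the quantum state. -/
def act (T : QState P → QState P) : QComp P Unit := fun ψ => {((), 1, T ψ)}

/-- Uniformly random choice from a finite set. -/
def uniform {α : Type} (s : Finset α) : QComp P α := fun ψ =>
  s.val.map fun a => (a, (s.card : ℝ)⁻¹, ψ)

/-- Measurement of one qudit in the computational basis. -/
def measureComp (q : Cell) : QComp P (Fin (P.dim q.1)) := fun ψ =>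
  (Finset.univ : Finset (Fin (P.dim q.1))).val.map fun v => (v, 1, ψ.filter fun x => x q = v)

/-- Measurement of one qudit in the Fourier basis. -/
def measureFourier (q : Cell) : QComp P (Fin (P.dim q.1)) := do
  act (fourierToComp q)
  measureComp q

/-- Probability that a computation, started with all qudits in `|0⟩`, ends in a branch whose
classical result and quantum state satisfy `E`. -/
def prob {α : Type} (f : QComp P α) (E : α → QState P → Prop) : ℝ :=
  ((f (zeroState P)).map fun u => if E u.1 u.2.2 then u.2.1 * normSq u.2.2 else 0).sum

end Computations

/-! ## Adversary programs

A program is a finite piece of code for a random access machine with quantum memory. It has an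
input, an output and a work array of natural numbers, and unit-cost instructions whose
arithmetic (no multiplication) keeps the bit lengths polynomial in the number of steps. Loops
are executed a number of times that is fixed when the loop is entered; this loses no
polynomial-time computation. Randomness is obtained by measuring.
-/

section Programs

/-- Arithmetic expressions; `work`, `inp` read the work and the input array. -/
inductive Expr where
  | const (n : ℕ)
  | work (e : Expr)
  | inp (e : Expr)
  | add (e f : Expr)
  | sub (e f : Expr)
  | div (e f : Expr)
  | mod (e f : Expr)

/-- Classical memory, with a step counter. -/
structure Memory where
  work : ℕ → ℕ
  inp : ℕ → ℕ
  out : ℕ → ℕ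
  time : ℕ

def Expr.eval (s : Memory) : Expr → ℕ
  | .const n => n
  | .work e => s.work (e.eval s)
  | .inp e => s.inp (e.eval s)
  | .add e f => e.eval s + f.eval s
  | .sub e f => e.eval s - f.eval s
  | .div e f => e.eval s / f.eval s
  | .mod e f => e.eval s % f.eval s

/-- A quantum gate: a unitary matrix with algebraic entries on finitely many qudits. -/
structure Gate (P : Params) where
  arity : ℕ
  kinds : Fin arity → Kind
  mat : Matrix ((i : Fin arity) → Fin (P.dim (kinds i))) ((i : Fin arity) → Fin (P.dim (kinds i))) ℂ
  unitary : mat ∈ Matrix.unitaryGroup ((i : Fin arity) → Fin (P.dim (kinds i))) ℂ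
  algebraic : ∀ x y, IsAlgebraic ℚ (mat x y)

/-- Programs. `store a e` and `emit a e` write `e` to the work and to the output array at
address `a`; `gate g a` applies `g` to the qudits with numbers `a i`; `measure κ q a` measures
qudit `q` of kind `κ` and writes the outcome to the work array at address `a`. -/
inductive Prog (P : Params) where
  | skip
  | store (a e : Expr)
  | emit (a e : Expr)
  | gate (g : Gate P) (a : Fin g.arity → Expr)
  | measure (κ : Kind) (q a : Expr)
  | seq (f g : Prog P)
  | ite (e : Expr) (f g : Prog P)
  | loop (e : Expr) (f : Prog P)

variable {P : Params}

def Memory.tick (s : Memory) : Memory := { s with time := s.time + 1 }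

def iter (f : Memory → QComp P Memory) : ℕ → Memory → QComp P Memory
  | 0 => fun s => pure s
  | n + 1 => fun s => do
      let s' ← f s
      iter f n s'

/-- Execution of a program that has access to the qudits in `acc` only. Instructions that
address other qudits, or that apply a gate to coinciding qudits, do nothing. -/
def Prog.exec (acc : Cell → Prop) : Prog P → Memory → QComp P Memory
  | .skip => fun s => pure s.tick
  | .store a e => fun s =>
      pure { s.tick with work := Function.update s.work (a.eval s) (e.eval s) }
  | .emit a e => fun s =>
      pure { s.tick with out := Function.update s.out (a.eval s) (e.eval s) }
  | .gate g a => fun s => do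
      let q : Fin g.arity → Cell := fun i => (g.kinds i, (a i).eval s)
      if Function.Injective q ∧ ∀ i, acc (q i) then
        act (applyOp g.kinds (fun i => (a i).eval s) g.mat)
      pure s.tick
  | .measure κ q a => fun s =>
      if acc (κ, q.eval s) then do
        let v ← measureComp (κ, q.eval s)
        pure { s.tick with work := Function.update s.work (a.eval s) v.val }
      else pure s.tick
  | .seq f g => fun s => do
      let s' ← f.exec acc s
      g.exec acc s'
  | .ite e f g => fun s =>
      if e.eval s ≠ 0 then f.exec acc s.tick else g.exec acc s.tick
  | .loop e f => fun s => iter (f.exec acc) (e.eval s) s.tick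

/-- An adversary: one program for each situation in which it is activated. The programs share
the work array and the qudits, and do not depend on the security parameter. -/
structure Adversary (P : Params) where
  choose : Prog P
  prepare : Prog P
  select : Prog P
  announce : Prog P
  hear : Prog P
  corrupt : Prog P
  receive : Prog P
  cast : Prog P
  guess : Prog P

/-- Activation of a program with a new input array and an empty output array. -/
def Prog.activate (acc : Cell → Prop) (f : Prog P) (inp : ℕ → ℕ) (s : Memory) :
    QComp P Memory :=
  f.exec acc { s with inp := inp, out := fun _ => 0 }

/-- An input array made of a header followed by a body. -/
def packet (header : List ℕ) (body : ℕ → ℕ) : ℕ → ℕ := fun i =>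
  if i < header.length then header.getD i 0 else body (i - header.length)

end Programs

/-! ## The states of the protocol and their tests -/

section States

variable (P : Params)

/-- Number of states of each kind that are left after the tests. -/
def kept : Kind → ℕ
  | .ballot => P.N
  | .index => 1

/-- Number of distributed states of each kind; `δ` is the security parameter. -/
def total (δ : ℕ) (κ : Kind) : ℕ := kept P κ + P.N * 2 ^ δ

/-- The qudit of voter `k` in the `j`-th state of kind `κ`. -/
def particle (κ : Kind) (j : ℕ) (k : Fin P.N) : Cell := (κ, j * P.N + k.val)

/-- Amplitudes of `D₁`, the uniform superposition of the strings whose sum is `0` modulo `c`,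
and of `D₂`, the uniform superposition of the permutations. -/
def amplitude : (κ : Kind) → (Fin P.N → Fin (P.dim κ)) → ℂ
  | .ballot, y =>
      if P.c ∣ ∑ k, (y k).val then
        (Real.sqrt (Fintype.card {z : Fin P.N → Fin (P.dim .ballot) // P.c ∣ ∑ k, (z k).val}) : ℂ)⁻¹
      else 0
  | .index, y => if Function.Injective y then (Real.sqrt (P.N.factorial) : ℂ)⁻¹ else 0

/-- Amplitudes of the same states in the Fourier basis. -/
def fourierAmplitude (κ : Kind) (y : Fin P.N → Fin (P.dim κ)) : ℂ :=
  ∑ x, star (∏ k, fourier (P.dim κ) (x k) (y k)) * amplitude P κ x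

/-- Test of the outcomes in the computational basis. -/
def passComp : (κ : Kind) → (Fin P.N → Fin (P.dim κ)) → Prop
  | .ballot, y => P.c ∣ ∑ k, (y k).val
  | .index, y => Function.Injective y

/-- Test of the outcomes in the Fourier basis. For `D₂`: the outcomes are possible for `D₂`. -/
def passFourier : (κ : Kind) → (Fin P.N → Fin (P.dim κ)) → Prop
  | .ballot, y => ∀ k l, y k = y l
  | .index, y => fourierAmplitude P .index y ≠ 0

variable {P}

/-- Preparation of the `j`-th state of kind `κ` from qudits in `|0⟩`. -/
def prepareState (κ : Kind) (j : ℕ) : QComp P Unit := act fun ψ => ψ.sum fun x z =>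
  ∑ y : Fin P.N → Fin (P.dim κ),
    Finsupp.single (overwrite (fun _ => κ) (fun k => (particle P κ j k).2) x y)
      (amplitude P κ y * z)

/-- The preparation of all states by an honest distributor. -/
def prepareAll (δ : ℕ) : QComp P Unit := do
  (List.range (total P δ .ballot)).forM (prepareState .ballot)
  (List.range (total P δ .index)).forM (prepareState .index)

end States

/-! ## Setup phase -/

section Setup

variable {P : Params}

/-- The initial choices of the adversary: votes of all voters, a permutation of the voters, and
the voters corrupted during the setup. -/
structure Choices (P : Params) where
  vote : Fin P.N → ℕ
  perm : Equiv.Perm (Fin P.N)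
  corrupted : Finset (Fin P.N)

/-- Decoding of the output array; votes are in `{0, …, c - 1}`. A choice of more than `ε N`
corrupted voters is void, and so is a map that is no permutation. -/
def decodeChoices (P : Params) (ε : ℝ) (out : ℕ → ℕ) : Choices P where
  vote k := out k % P.c
  perm :=
    let f : Fin P.N → Fin P.N := fun k => ⟨out (P.N + k) % P.N, Nat.mod_lt _ P.N_pos⟩
    if h : Function.Bijective f then Equiv.ofBijective f h else 1
  corrupted :=
    let s : Finset (Fin P.N) := Finset.univ.filter fun k => out (2 * P.N + k) ≠ 0
    if (s.card : ℝ) ≤ ε * P.N then s else ∅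

/-- Qudits that are not part of the distributed states. -/
def privateCell (P : Params) (δ : ℕ) (q : Cell) : Prop := total P δ q.1 * P.N ≤ q.2

/-- After the distribution the adversary holds its private qudits and those of the corrupted
voters. -/
def adversaryCell (P : Params) (δ : ℕ) (S : Finset (Fin P.N)) (q : Cell) : Prop :=
  privateCell P δ q ∨ ∃ k ∈ S, q.2 % P.N = k.val

/-- The voter who distributes the states. -/
def distributor (P : Params) : Fin P.N := ⟨0, P.N_pos⟩

def Kind.code : Kind → ℕ
  | .ballot => 0
  | .index => 1

/-- State of the cut-and-choose phase: memory of the adversary, states not yet tested, and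
whether the protocol has not been aborted. -/
structure SetupState where
  mem : Memory
  rest : Kind → Finset ℕ
  ok : Prop

/-- The possible choices of a tester: which states to measure in the computational basis and
which in the Fourier basis, `2 ^ δ` untested states in all, half of them in each basis. -/
def tests (δ : ℕ) (rest : Finset ℕ) : Finset (Finset ℕ × Finset ℕ) :=
  (rest.powerset ×ˢ rest.powerset).filter fun t =>
    Disjoint t.1 t.2 ∧ t.1.card = 2 ^ δ / 2 ∧ t.1.card + t.2.card = 2 ^ δ

/-- Array representation of a choice of tests: `1` computational, `2` Fourier, `0` untested. -/
def testCode (t : Finset ℕ × Finset ℕ) (j : ℕ) : ℕ :=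
  if j ∈ t.1 then 1 else if j ∈ t.2 then 2 else 0

/-- The honest voters measure their qudits of the tested states; the results are entered in the
table of announcements `o`, which already holds those of the corrupted voters. -/
def measureTests (S : Finset (Fin P.N)) (κ : Kind) (t : Finset ℕ × Finset ℕ)
    (o : ℕ → Fin P.N → Fin (P.dim κ)) : QComp P (ℕ → Fin P.N → Fin (P.dim κ)) :=
  ((t.1 ∪ t.2).sort (· ≤ ·) ×ˢ (List.finRange P.N).filter (fun k => k ∉ S)).foldlM
    (fun o jk => do
      let v ← (if jk.1 ∈ t.1 then measureComp (P := P) (κ, (particle P κ jk.1 jk.2).2)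
        else measureFourier (κ, (particle P κ jk.1 jk.2).2))
      pure (Function.update o jk.1 (Function.update (o jk.1) jk.2 v)))
    o

/-- One round of cut-and-choose for the states of kind `κ`, with tester `s`. The tester is
honest and chooses at random, or is corrupted and its choice is made by the adversary. The
corrupted voters announce results without seeing those of the honest voters. If some test
fails, or if the tester deviates from the prescribed form of the choice, the protocol aborts. -/
def testRound (A : Adversary P) (δ : ℕ) (S : Finset (Fin P.N)) (κ : Kind) (r s : Fin P.N)
    (st : SetupState) : QComp P SetupState :=
  if ¬ st.ok then pure st else do
    let header : List ℕ := [κ.code, r, s]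
    let (mem, t) ← (if s ∈ S then do
        let mem ← A.select.activate (adversaryCell P δ S) (packet header fun _ => 0) st.mem
        pure (mem, ((Finset.range (total P δ κ)).filter (fun j => mem.out j = 1),
          (Finset.range (total P δ κ)).filter (fun j => mem.out j = 2)))
      else do
        let t ← uniform (tests δ (st.rest κ))
        pure (st.mem, t))
    if t ∉ tests δ (st.rest κ) then pure { st with mem := mem, ok := False } else do
      let mem ← A.announce.activate (adversaryCell P δ S) (packet header (testCode t)) mem
      let o ← measureTests S κ t fun j k => P.toLabel κ (mem.out (j * P.N + k))
      let mem ← A.hear.activate (adversaryCell P δ S)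
        (packet header fun i => (o (i / P.N) ⟨i % P.N, Nat.mod_lt _ P.N_pos⟩).val) mem
      pure {
        mem := mem
        rest := Function.update st.rest κ (st.rest κ \ (t.1 ∪ t.2))
        ok := (∀ j ∈ t.1, passComp P κ (o j)) ∧ (∀ j ∈ t.2, passFourier P κ (o j)) }

/-- Choice of votes, permutation and corrupted voters, distribution of the states, and
cut-and-choose, in which the voters act as testers in a random order. -/
def setup (A : Adversary P) (ε : ℝ) (δ : ℕ) : QComp P (Choices P × SetupState) := do
  let mem ← A.choose.activate (privateCell P δ) (packet [δ] fun _ => 0) ⟨fun _ => 0, fun _ => 0, fun _ => 0, 0⟩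
  let ch := decodeChoices P ε mem.out
  let mem ← (if distributor P ∈ ch.corrupted then
      A.prepare.activate (fun _ => True) (fun _ => 0) mem
    else do
      prepareAll δ
      pure mem)
  let σ ← uniform (Finset.univ : Finset (Equiv.Perm (Fin P.N)))
  let st ← (List.finRange P.N).foldlM
    (fun st r => testRound A δ ch.corrupted .ballot r (σ r) st)
    { mem := mem, rest := fun κ => Finset.range (total P δ κ), ok := True }
  let st ← (List.finRange P.N).foldlM
    (fun st r => testRound A δ ch.corrupted .index r (σ r) st) st
  pure (ch, st)

/-- The `i`-th untested state. -/
def restState (st : SetupState) (κ : Kind) (i : ℕ) : ℕ := ((st.rest κ).sort (· ≤ ·)).getD i 0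

/-- The blank ballots: `ballot k i` is the entry of voter `k` in row `i`, `index k` the secret
row of voter `k`. -/
structure Blank (P : Params) where
  ballot : Fin P.N → Fin P.N → ℕ
  index : Fin P.N → Fin P.N

/-- The honest voters measure their qudits of the untested states. -/
def measureBlank (S : Finset (Fin P.N)) (st : SetupState) : QComp P (Blank P) :=
  ((List.finRange P.N).filter (fun k => k ∉ S)).foldlM
    (fun b k => do
      let col ← (List.finRange P.N).foldlM
        (fun (col : Fin P.N → ℕ) (i : Fin P.N) => do
          let v ← measureComp (particle P .ballot (restState st .ballot i) k)
          pure (Function.update col i v.val))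
        (fun _ => 0)
      let sk ← measureComp (P := P) (.index, (particle P .index (restState st .index 0) k).2)
      pure { ballot := Function.update b.ballot k col, index := Function.update b.index k sk })
    { ballot := fun _ _ => 0, index := fun _ => distributor P }

end Setup

/-! ## Casting and tally phases, and the experiment -/

section Experiment

variable {P : Params}

/-- State of the casting phase: memory and corrupted voters of the adversary, and the columns
that have been published. -/
structure CastState (P : Params) where
  mem : Memory
  corrupted : Finset (Fin P.N)
  column : Fin P.N → Option (Fin P.N → ℕ)

/-- The vote of an honest voter in the two worlds. -/
def Choices.actualVote (ch : Choices P) (β : Bool) (k : Fin P.N) : ℕ :=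
  if β then ch.vote (ch.perm k) else ch.vote k

/-- The column of voter `k` with its vote `v` added in the secret row. -/
def castBallot (b : Blank P) (k : Fin P.N) (v : ℕ) : Fin P.N → ℕ :=
  Function.update (b.ballot k) (b.index k) ((b.ballot k (b.index k) + v) % P.m)

/-- The turn of voter `k` in the casting phase. The adversary may corrupt the voter, within its
budget of `ε N` voters, and then learns its blank ballot and casts in its place. The ballot of
an honest voter is shown to the adversary, who cannot modify it but may suppress it. After an
aborted setup the ballots of honest voters are void. -/
def castTurn (A : Adversary P) (ε : ℝ) (δ : ℕ) (ch : Choices P) (ok : Prop) (b : Blank P)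
    (β : Bool) (st : CastState P) (k : Fin P.N) : QComp P (CastState P) := do
  let acc := adversaryCell P δ ch.corrupted
  let old : Prop := k ∈ st.corrupted
  let st ← (if old then pure st else do
      let mem ← A.corrupt.activate acc (packet [k] fun _ => 0) st.mem
      if mem.out 0 ≠ 0 ∧ (st.corrupted.card + 1 : ℝ) ≤ ε * P.N then
        pure { st with mem := mem, corrupted := insert k st.corrupted }
      else pure { st with mem := mem })
  if k ∈ st.corrupted then do
    let inp := if old then packet [k, 0, 0] fun _ => 0 else
      packet [k, 1, (b.index k).val] fun i => if h : i < P.N then b.ballot k ⟨i, h⟩ else 0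
    let mem ← A.cast.activate acc inp st.mem
    pure { st with
      mem := mem
      column := Function.update st.column k (some fun i => mem.out i % P.m) }
  else if ok then do
    let col := castBallot b k (ch.actualVote β k)
    let mem ← A.receive.activate acc
      (packet [k] fun i => if h : i < P.N then col ⟨i, h⟩ else 0) st.mem
    pure { st with
      mem := mem
      column := if mem.out 0 = 0 then Function.update st.column k (some col) else st.column }
  else pure st

/-- Sum of the entries of row `i` of the public table, modulo `c`. -/
def rowSum (column : Fin P.N → Option (Fin P.N → ℕ)) (i : Fin P.N) : ℕ :=
  (∑ k, (column k).elim 0 fun col => col i) % P.c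

/-- The protocol reaches an outcome if all columns are published and each honest voter finds
its vote in its secret row. -/
def tallyAccepts (ch : Choices P) (b : Blank P) (β : Bool) (st : CastState P) : Prop :=
  (∀ k, (st.column k).isSome) ∧
    ∀ k, k ∉ st.corrupted → rowSum st.column (b.index k) = ch.actualVote β k

/-- The permuted choices of the honest voters are a permutation of their initial choices. -/
def permutesHonest (ch : Choices P) (S : Finset (Fin P.N)) : Prop :=
  (Finset.univ \ S).val.map (fun k => ch.vote (ch.perm k)) = (Finset.univ \ S).val.map ch.vote

/-- The privacy experiment; it returns its output `-1`, `0` or `1` and the final memory of the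
adversary. -/
def experiment (A : Adversary P) (ε : ℝ) (δ : ℕ) : QComp P (ℤ × Memory) := do
  let (ch, st) ← setup A ε δ
  let b ← measureBlank ch.corrupted st
  let β ← uniform (Finset.univ : Finset Bool)
  let π ← uniform (Finset.univ : Finset (Equiv.Perm (Fin P.N)))
  let cs ← (List.finRange P.N).foldlM
    (fun cs i => castTurn A ε δ ch st.ok b β cs (π i))
    { mem := st.mem, corrupted := ch.corrupted, column := fun _ => none }
  if permutesHonest ch cs.corrupted then do
    let inp : ℕ → ℕ := if tallyAccepts ch b β cs then
        packet [1] fun i => if h : i < P.N then rowSum cs.column ⟨i, h⟩ else 0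
      else fun _ => 0
    let mem ← A.guess.activate (adversaryCell P δ ch.corrupted) inp cs.mem
    pure (if decide (mem.out 0 ≠ 0) = β then 1 else 0, mem)
  else pure (-1, cs.mem)

end Experiment

/-! ## Privacy -/

section Privacy

variable {P : Params}

/-- `A` runs in quantum polynomial time: in every branch of positive probability the number of
steps is polynomial in `2 ^ δ`, the number of states tested by each voter. -/
def IsQPPT (A : Adversary P) (ε : ℝ) : Prop :=
  ∃ p : Polynomial ℕ, ∀ δ : ℕ, ∀ u ∈ experiment A ε δ (zeroState P),
    u.2.1 * normSq u.2.2 ≠ 0 → u.1.2.time ≤ p.eval (2 ^ δ)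

/-- Negligible functions: smaller than every inverse polynomial. -/
def Negligible (f : ℕ → ℝ) : Prop :=
  Asymptotics.SuperpolynomialDecay Filter.atTop (fun n : ℕ => (n : ℝ)) f

/-- Probability that the experiment outputs `v`. -/
def probOutput (A : Adversary P) (ε : ℝ) (δ : ℕ) (v : ℤ) : ℝ :=
  prob (experiment A ε δ) fun u _ => u.1 = v

/-- Probability that the experiment does not output `-1`. -/
def probNoFalseAttack (A : Adversary P) (ε : ℝ) (δ : ℕ) : ℝ :=
  prob (experiment A ε δ) fun u _ => u.1 ≠ -1

/-- Probability of output `1`, conditioned on the output not being `-1`. -/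
def winProb (A : Adversary P) (ε : ℝ) (δ : ℕ) : ℝ :=
  probOutput A ε δ 1 / probNoFalseAttack A ε δ

/-- `ε`-quantum privacy: each quantum polynomial-time adversary wins with a conditional
probability negligibly close to `1/2`. Security parameters at which the conditioning event has
probability `0` impose no condition. -/
def QuantumPrivacy (P : Params) (ε : ℝ) : Prop :=
  ∀ A : Adversary P, IsQPPT A ε →
    Negligible fun δ => if probNoFalseAttack A ε δ = 0 then 0 else winProb A ε δ - 1 / 2

/-- Probability that the cut-and-choose phase is passed and that all the untested ballot states
are corrupted: computational basis vectors instead of the superposition `D₁`. -/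
def probCorruptedSurvive (A : Adversary P) (ε : ℝ) (δ : ℕ) : ℝ :=
  prob (setup A ε δ) fun u ψ => u.2.ok ∧
    ∀ j ∈ u.2.rest .ballot, ∀ k : Fin P.N, ∃ v, ∀ x ∈ ψ.support, x (particle P .ballot j k) = v

end Privacy

end

end SelfTally

/-!
# The dual-basis self-tallying protocol is not private

The attack corrupts a single voter, the distributor. It leaves the first `N` ballot states in the
product state `|0 … 0⟩` and prepares all other states honestly. When the corrupted voter is the
last tester, it tests exactly the untested states that are not to be kept, so that the corrupted
ballot states remain; when it is the tester in another round, it makes the protocol abort. Hence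
an execution that passes the tests always ends with ballot states `|0 … 0⟩`, and each blank ballot
consists of zeros (`SetupResult`, `ensures_measureBlank`). Voter `1` votes `1` in one world and `0`
in the other, and its column then betrays the world, since the entries add up to the vote
(`IsAttack.outputOf_columnGuess`). If the protocol aborts, the guess is `0`, which is right with
probability `1 / 2` (`SetupResult.afterSetup`).

The corrupted states survive with a probability that does not depend on the security parameter.
The corrupted voter is the last of the `N` testers with probability `1 / N`; the bound used below
comes from one such order of the testers, of probability `1 / N!`. Before the last round, a tester
chooses at random `2 ^ δ` states, and at least twice as many states are untested besides those to
be kept. So each of the at most `N` states to be kept is avoided with probability at least `1 / 2`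
even if the others are (`card_tests_sdiff`). This gives the constant `survivalBound`.

Honestly prepared states pass all tests although the corrupted voter measures and announces its
results before the others. The joint state of the qudits is a product of factors `D₁`, `D₂` and
`|0⟩` (`Untested`). Measuring the qudits of one factor one by one, in any order, leaves an
amplitude that is that of the outcomes in the whole state (`TestState.measure`), so that impossible
outcomes have probability `0` (`TestState.pass`).

Probabilities are computed with the predicates `Ensures` and `ProbGe`, which are compatible with
sequential composition, so that the experiment can be followed step by step. The honest states
are prepared by one reflection on `N` qudits that exchanges `|0 … 0⟩` and the state wanted, a gate
with algebraic entries (`preparationGate`). The running time is read off the syntax of the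
programs: they never overwrite the number `2 ^ δ`, which bounds their loops (`Prog.Tame`,
`Prog.stepBound`).
-/

namespace SelfTally

noncomputable section

open scoped Classical

/-! ### Expectations over the branches of a computation -/

section Calculus

variable {P : Params} {α β : Type}

/-- Expected value of `E` over the branches of `f`, counted with the weight of the classical
random choices only: the squared norm of the state has to be part of `E`. -/
def expect (f : QComp P α) (ψ : QState P) (E : α → QState P → ℝ) : ℝ :=
  ((f ψ).map fun u => u.2.1 * E u.1 u.2.2).sum

/-- The computation `f`, started in `ψ`, loses no probability, and each of its branches
satisfies `Q`. -/
structure Ensures (f : QComp P α) (ψ : QState P) (Q : α → QState P → Prop) : Prop where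
  nonneg : ∀ u ∈ f ψ, 0 ≤ u.2.1
  total : expect f ψ (fun _ φ => normSq φ) = normSq ψ
  post : ∀ u ∈ f ψ, Q u.1 u.2.2

/-- The computation `f`, started in `ψ`, reaches `Q` with probability at least `p`, relative to
the squared norm of `ψ`. -/
def ProbGe (p : ℝ) (f : QComp P α) (ψ : QState P) (Q : α → QState P → Prop) : Prop :=
  p * normSq ψ ≤ expect f ψ fun a φ => if Q a φ then normSq φ else 0

theorem normSq_nonneg (ψ : QState P) : 0 ≤ normSq ψ :=
  Finset.sum_nonneg fun _ _ => by positivity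

@[simp] theorem normSq_zero : normSq (0 : QState P) = 0 := by simp [normSq]

theorem prob_eq_expect (f : QComp P α) (E : α → QState P → Prop) :
    prob f E = expect f (zeroState P) fun a φ => if E a φ then normSq φ else 0 := by
  unfold prob expect
  congr 1
  refine Multiset.map_congr rfl fun u _ => ?_
  by_cases h : E u.1 u.2.2 <;> simp [h]

theorem expect_pure (a : α) (ψ : QState P) (E : α → QState P → ℝ) :
    expect (pure a) ψ E = E a ψ := by
  change ((({(a, 1, ψ)} : Multiset (α × ℝ × QState P))).map _).sum = _
  simp

theorem mem_bind {f : QComp P α} {g : α → QComp P β} {ψ : QState P} {w : β × ℝ × QState P} :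
    w ∈ (f >>= g) ψ ↔ ∃ u ∈ f ψ, ∃ v ∈ g u.1 u.2.2, (v.1, u.2.1 * v.2.1, v.2.2) = w := by
  change w ∈ (f ψ).bind _ ↔ _
  simp only [Multiset.mem_bind, Multiset.mem_map]

theorem expect_bind (f : QComp P α) (g : α → QComp P β) (ψ : QState P)
    (E : β → QState P → ℝ) :
    expect (f >>= g) ψ E = expect f ψ fun a φ => expect (g a) φ E := by
  change (((f ψ).bind _).map _).sum = _
  rw [Multiset.map_bind, Multiset.sum_bind]
  unfold expect
  congr 1
  refine Multiset.map_congr rfl fun u _ => ?_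
  rw [Multiset.map_map, ← Multiset.sum_map_mul_left]
  congr 1
  refine Multiset.map_congr rfl fun v _ => ?_
  simp [mul_assoc]

theorem expect_congr {f : QComp P α} {ψ : QState P} {E E' : α → QState P → ℝ}
    (h : ∀ u ∈ f ψ, E u.1 u.2.2 = E' u.1 u.2.2) : expect f ψ E = expect f ψ E' := by
  unfold expect
  congr 1
  exact Multiset.map_congr rfl fun u hu => by rw [h u hu]

theorem expect_mono {f : QComp P α} {ψ : QState P} {E E' : α → QState P → ℝ}
    (hf : ∀ u ∈ f ψ, 0 ≤ u.2.1) (h : ∀ u ∈ f ψ, E u.1 u.2.2 ≤ E' u.1 u.2.2) :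
    expect f ψ E ≤ expect f ψ E' :=
  Multiset.sum_map_le_sum_map _ _ fun u hu => mul_le_mul_of_nonneg_left (h u hu) (hf u hu)

theorem expect_const_mul (f : QComp P α) (ψ : QState P) (r : ℝ) (E : α → QState P → ℝ) :
    (expect f ψ fun a φ => r * E a φ) = r * expect f ψ E := by
  unfold expect
  rw [← Multiset.sum_map_mul_left]
  congr 1
  exact Multiset.map_congr rfl fun u _ => by ring

theorem expect_add (f : QComp P α) (ψ : QState P) (E E' : α → QState P → ℝ) :
    (expect f ψ fun a φ => E a φ + E' a φ) = expect f ψ E + expect f ψ E' := by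
  unfold expect
  rw [← Multiset.sum_map_add]
  congr 1
  exact Multiset.map_congr rfl fun u _ => by ring

theorem Ensures.mono {f : QComp P α} {ψ : QState P} {Q R : α → QState P → Prop}
    (h : Ensures f ψ Q) (hQ : ∀ a φ, Q a φ → R a φ) : Ensures f ψ R :=
  ⟨h.nonneg, h.total, fun u hu => hQ _ _ (h.post u hu)⟩

theorem Ensures.and {f : QComp P α} {ψ : QState P} {Q R : α → QState P → Prop}
    (h : Ensures f ψ Q) (h' : Ensures f ψ R) : Ensures f ψ fun a φ => Q a φ ∧ R a φ :=
  ⟨h.nonneg, h.total, fun u hu => ⟨h.post u hu, h'.post u hu⟩⟩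

theorem Ensures.pure {a : α} {ψ : QState P} {Q : α → QState P → Prop} (h : Q a ψ) :
    Ensures (Pure.pure a) ψ Q := by
  have hm : ∀ u ∈ (Pure.pure a : QComp P α) ψ, u = (a, 1, ψ) := fun u hu =>
    Multiset.mem_singleton.1 hu
  refine ⟨fun u hu => ?_, expect_pure _ _ _, fun u hu => ?_⟩
  · rw [hm u hu]; exact zero_le_one
  · rw [hm u hu]; exact h

theorem Ensures.bind {f : QComp P α} {g : α → QComp P β} {ψ : QState P}
    {Q : α → QState P → Prop} {R : β → QState P → Prop} (hf : Ensures f ψ Q)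
    (hg : ∀ a φ, Q a φ → Ensures (g a) φ R) : Ensures (f >>= g) ψ R := by
  refine ⟨fun w hw => ?_, ?_, fun w hw => ?_⟩
  · obtain ⟨u, hu, v, hv, rfl⟩ := mem_bind.1 hw
    exact mul_nonneg (hf.nonneg u hu) ((hg _ _ (hf.post u hu)).nonneg v hv)
  · rw [expect_bind, ← hf.total]
    exact expect_congr fun u hu => (hg _ _ (hf.post u hu)).total
  · obtain ⟨u, hu, v, hv, rfl⟩ := mem_bind.1 hw
    exact (hg _ _ (hf.post u hu)).post v hv

theorem Ensures.foldlM {σ : Type} {f : σ → α → QComp P σ} (I : List α → σ → QState P → Prop)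
    (l : List α)
    (h : ∀ l₁ a l₂, l = l₁ ++ a :: l₂ → ∀ s ψ, I l₁ s ψ → Ensures (f s a) ψ (I (l₁ ++ [a])))
    {s : σ} {ψ : QState P} (h0 : I [] s ψ) : Ensures (l.foldlM f s) ψ (I l) := by
  suffices H : ∀ l₂ l₁, l = l₁ ++ l₂ → ∀ s ψ, I l₁ s ψ →
      Ensures (l₂.foldlM f s) ψ (I l) from
    H l [] rfl s ψ h0
  intro l₂
  induction l₂ with
  | nil =>
    rintro l₁ rfl s ψ hI
    exact Ensures.pure (by simpa using hI)
  | cons a l₂ ih =>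
    intro l₁ hl s ψ hI
    rw [List.foldlM_cons]
    exact (h l₁ a l₂ hl s ψ hI).bind fun s' φ hI' => ih (l₁ ++ [a]) (by simp [hl]) s' φ hI'

theorem Ensures.iter {f : Memory → QComp P Memory} (I : ℕ → Memory → QState P → Prop) (n : ℕ)
    (h : ∀ i < n, ∀ s ψ, I i s ψ → Ensures (f s) ψ (I (i + 1)))
    {s : Memory} {ψ : QState P} (h0 : I 0 s ψ) : Ensures (iter f n s) ψ (I n) := by
  suffices H : ∀ k i, i + k = n → ∀ s ψ, I i s ψ → Ensures (SelfTally.iter f k s) ψ (I n) from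
    H n 0 (by simp) s ψ h0
  intro k
  induction k with
  | zero =>
    rintro i rfl s ψ hI
    exact Ensures.pure (by simpa using hI)
  | succ k ih =>
    intro i hi s ψ hI
    exact (h i (by omega) s ψ hI).bind fun s' φ hI' => ih (i + 1) (by omega) s' φ hI'

theorem Ensures.probGe {f : QComp P α} {ψ : QState P} {Q R : α → QState P → Prop}
    (h : Ensures f ψ Q) (hQ : ∀ a φ, Q a φ → φ ≠ 0 → R a φ) : ProbGe 1 f ψ R := by
  unfold ProbGe
  rw [one_mul, ← h.total]
  refine (expect_congr fun u hu => ?_).le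
  split_ifs with hR
  · rfl
  · by_cases h0 : u.2.2 = 0
    · simp [h0]
    · exact absurd (hQ _ _ (h.post u hu) h0) hR

theorem ProbGe.weaken {p p' : ℝ} {f : QComp P α} {ψ : QState P} {Q : α → QState P → Prop}
    (h : ProbGe p f ψ Q) (hp : p' ≤ p) : ProbGe p' f ψ Q :=
  (mul_le_mul_of_nonneg_right hp (normSq_nonneg ψ)).trans h

theorem ProbGe.bind {p p' : ℝ} {f : QComp P α} {g : α → QComp P β} {ψ : QState P}
    {I Q : α → QState P → Prop} {J R : β → QState P → Prop} (hp' : 0 ≤ p')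
    (hf : Ensures f ψ I) (hg : ∀ a φ, I a φ → Ensures (g a) φ J) (h : ProbGe p f ψ Q)
    (h' : ∀ a φ, I a φ → Q a φ → ProbGe p' (g a) φ R) : ProbGe (p * p') (f >>= g) ψ R := by
  unfold ProbGe
  calc p * p' * normSq ψ = p' * (p * normSq ψ) := by ring
    _ ≤ p' * expect f ψ fun a φ => if Q a φ then normSq φ else 0 :=
        mul_le_mul_of_nonneg_left h hp'
    _ = expect f ψ fun a φ => p' * if Q a φ then normSq φ else 0 :=
        (expect_const_mul _ _ _ _).symm
    _ ≤ _ := by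
        rw [expect_bind]
        refine expect_mono hf.nonneg fun u hu => ?_
        split_ifs with hQ
        · exact h' _ _ (hf.post u hu) hQ
        · rw [mul_zero]
          refine Multiset.sum_nonneg fun x hx => ?_
          obtain ⟨v, hv, rfl⟩ := Multiset.mem_map.1 hx
          refine mul_nonneg ((hg _ _ (hf.post u hu)).nonneg v hv) ?_
          beta_reduce
          split_ifs
          exacts [normSq_nonneg _, le_rfl]

theorem ProbGe.mono {p : ℝ} {f : QComp P α} {ψ : QState P} {I Q R : α → QState P → Prop}
    (hf : Ensures f ψ I) (h : ProbGe p f ψ Q) (hQ : ∀ a φ, I a φ → Q a φ → R a φ) :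
    ProbGe p f ψ R := by
  refine h.trans (expect_mono hf.nonneg fun u hu => ?_)
  split_ifs with h1 h2 h2
  · exact le_rfl
  · exact absurd (hQ _ _ (hf.post u hu) h1) h2
  · exact normSq_nonneg _
  · exact le_rfl

theorem ProbGe.pure {a : α} {ψ : QState P} {Q : α → QState P → Prop} (h : Q a ψ) :
    ProbGe 1 (Pure.pure a) ψ Q :=
  (Ensures.pure (Q := Q) h).probGe fun _ _ hQ _ => hQ

/-- If each step of a loop keeps `G` with probability at least `p`, then `G` survives `n` steps
with probability at least `p ^ n`. -/
theorem ProbGe.foldlM {σ : Type} {p : ℝ} (hp : 0 ≤ p) {f : σ → α → QComp P σ}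
    (I G : List α → σ → QState P → Prop) (l : List α)
    (h : ∀ l₁ a l₂, l = l₁ ++ a :: l₂ → ∀ s ψ, I l₁ s ψ → Ensures (f s a) ψ (I (l₁ ++ [a])))
    (hG : ∀ l₁ a l₂, l = l₁ ++ a :: l₂ → ∀ s ψ, I l₁ s ψ → G l₁ s ψ →
      ProbGe p (f s a) ψ (G (l₁ ++ [a])))
    {s : σ} {ψ : QState P} (h0 : I [] s ψ) (hG0 : G [] s ψ) :
    ProbGe (p ^ l.length) (l.foldlM f s) ψ (G l) := by
  suffices H : ∀ l₂ l₁, l = l₁ ++ l₂ → ∀ s ψ, I l₁ s ψ →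
      Ensures (l₂.foldlM f s) ψ (I l) ∧
      (G l₁ s ψ → ProbGe (p ^ l₂.length) (l₂.foldlM f s) ψ (G l)) from
    (H l [] rfl s ψ h0).2 hG0
  intro l₂
  induction l₂ with
  | nil =>
    rintro l₁ rfl s ψ hI
    exact ⟨Ensures.pure (by simpa using hI), fun hG' =>
      ProbGe.pure (by simpa using hG')⟩
  | cons a l₂ ih =>
    intro l₁ hl s ψ hI
    have ih' := fun s' φ hI' => ih (l₁ ++ [a]) (by simp [hl]) s' φ hI'
    have h1 := h l₁ a l₂ hl s ψ hI
    rw [List.foldlM_cons]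
    refine ⟨h1.bind fun s' φ hI' => (ih' s' φ hI').1, fun hG' => ?_⟩
    rw [List.length_cons, pow_succ']
    exact ProbGe.bind (by positivity) h1 (fun s' φ hI' => (ih' s' φ hI').1)
      (hG l₁ a l₂ hl s ψ hI hG') fun s' φ hI' hG'' => (ih' s' φ hI').2 hG''

theorem Ensures.act {T : QState P → QState P} {ψ : QState P} (h : normSq (T ψ) = normSq ψ) :
    Ensures (act T) ψ fun _ φ => φ = T ψ := by
  have hm : ∀ u ∈ (SelfTally.act T) ψ, u = ((), 1, T ψ) := fun u hu => Multiset.mem_singleton.1 hu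
  refine ⟨fun u hu => ?_, ?_, fun u hu => ?_⟩
  · rw [hm u hu]; exact zero_le_one
  · simpa [expect, SelfTally.act] using h
  · rw [hm u hu]

theorem Ensures.uniform {s : Finset α} (hs : s.Nonempty) (ψ : QState P) :
    Ensures (uniform s) ψ fun a φ => a ∈ s ∧ φ = ψ := by
  have hc : (s.card : ℝ) ≠ 0 := by exact_mod_cast hs.card_pos.ne'
  refine ⟨fun u hu => ?_, ?_, fun u hu => ?_⟩
  · obtain ⟨a, _, rfl⟩ := Multiset.mem_map.1 hu
    simp
  · simp [expect, SelfTally.uniform]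
    field_simp
  · obtain ⟨a, ha, rfl⟩ := Multiset.mem_map.1 hu
    exact ⟨ha, rfl⟩

theorem expect_uniform (s : Finset α) (ψ : QState P) (E : α → QState P → ℝ) :
    expect (uniform s) ψ E = (s.card : ℝ)⁻¹ * ∑ a ∈ s, E a ψ := by
  rw [Finset.mul_sum]
  change ((s.val.map _).map _).sum = _
  rw [Multiset.map_map]
  rfl

theorem ProbGe.uniform {s : Finset α} (hs : s.Nonempty) {ψ : QState P}
    {Q : α → QState P → Prop} {p : ℝ} (t : Finset α) (hts : t ⊆ s) (ht : ∀ a ∈ t, Q a ψ)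
    (hp : p * s.card ≤ t.card) : ProbGe p (uniform s) ψ Q := by
  have hc : (0 : ℝ) < s.card := by exact_mod_cast hs.card_pos
  unfold ProbGe
  rw [expect_uniform, inv_mul_eq_div, le_div_iff₀ hc]
  calc p * normSq ψ * s.card = (p * s.card) * normSq ψ := by ring
    _ ≤ t.card * normSq ψ := mul_le_mul_of_nonneg_right hp (normSq_nonneg ψ)
    _ = ∑ a ∈ t, if Q a ψ then normSq ψ else 0 := by
        rw [Finset.sum_congr rfl fun a ha => if_pos (ht a ha)]; simp
    _ ≤ _ := Finset.sum_le_sum_of_subset_of_nonneg hts fun a _ _ => by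
        split_ifs
        exacts [normSq_nonneg _, le_rfl]

end Calculus

/-! ### Local operators -/

section LocalOperators

variable {P : Params} {R : Type} [Fintype R]

theorem sum_normSq_mulVec [DecidableEq R] {U : Matrix R R ℂ} (hU : star U * U = 1) (v : R → ℂ) :
    ∑ y, ‖∑ y', U y y' * v y'‖ ^ 2 = ∑ y, ‖v y‖ ^ 2 := by
  have key : ∀ w : R → ℂ, ((∑ y, ‖w y‖ ^ 2 : ℝ) : ℂ) = star w ⬝ᵥ w := fun w => by
    simp only [dotProduct, Pi.star_apply, Complex.ofReal_sum, RCLike.star_def]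
    exact Finset.sum_congr rfl fun y _ => by rw [Complex.conj_mul']; push_cast; rfl
  have h : star (U.mulVec v) ⬝ᵥ U.mulVec v = star v ⬝ᵥ v := by
    rw [Matrix.star_mulVec, Matrix.dotProduct_mulVec, Matrix.vecMul_vecMul,
      ← Matrix.star_eq_conjTranspose, hU, Matrix.vecMul_one]
  rw [← key, ← key] at h
  exact_mod_cast h

/-- A matrix `U` acts on a part of the labels that is read by `get` and written by `put`. -/
theorem sum_single_put_apply {get : Labels P → R} {put : Labels P → R → Labels P}
    (get_put : ∀ x y, get (put x y) = y) (put_put : ∀ x y y', put (put x y) y' = put x y')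
    (put_get : ∀ x, put x (get x) = x) (U : Matrix R R ℂ) (ψ : QState P) (x₀ : Labels P) :
    (ψ.sum fun x z => ∑ y, Finsupp.single (put x y) (U y (get x) * z)) x₀ =
      ∑ y, U (get x₀) y * ψ (put x₀ y) := by
  induction ψ using Finsupp.induction_linear with
  | zero => simp
  | add f g hf hg =>
    rw [Finsupp.sum_add_index', Finsupp.add_apply, hf, hg, ← Finset.sum_add_distrib]
    · exact Finset.sum_congr rfl fun y _ => by rw [Finsupp.add_apply, mul_add]
    · simp
    · intro x z z'
      rw [← Finset.sum_add_distrib]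
      exact Finset.sum_congr rfl fun y _ => by rw [← Finsupp.single_add, mul_add]
  | single x z =>
    rw [Finsupp.sum_single_index (by simp), Finsupp.finsetSum_apply]
    have hl : ∀ y, put x y = x₀ → y = get x₀ := fun y h => by rw [← h, get_put]
    have hr : ∀ y, x = put x₀ y → y = get x := fun y h => by rw [h, get_put]
    rw [Finset.sum_eq_single (get x₀) (fun y _ hy => by
        rw [Finsupp.single_apply, if_neg fun h => hy (hl y h)]) (by simp),
      Finset.sum_eq_single (get x) (fun y _ hy => by
        rw [Finsupp.single_apply, if_neg fun h => hy (hr y h), mul_zero]) (by simp),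
      Finsupp.single_apply, Finsupp.single_apply]
    by_cases h : put x (get x₀) = x₀
    · rw [if_pos h, if_pos]
      conv_lhs => rw [← put_get x]
      rw [← h, put_put]
    · rw [if_neg h, if_neg, mul_zero]
      intro h'
      apply h
      rw [h', put_put, put_get]

theorem normSq_eq_sum {ψ : QState P} {T : Finset (Labels P)} (h : ψ.support ⊆ T) :
    normSq ψ = ∑ x ∈ T, ‖ψ x‖ ^ 2 :=
  Finsupp.sum_of_support_subset _ h _ (by simp)

theorem normSq_eq_of_put [DecidableEq R] {get : Labels P → R} {put : Labels P → R → Labels P}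
    (get_put : ∀ x y, get (put x y) = y) (put_put : ∀ x y y', put (put x y) y' = put x y')
    (put_get : ∀ x, put x (get x) = x) {U : Matrix R R ℂ} (hU : star U * U = 1)
    {ψ φ : QState P} (h : ∀ x, φ x = ∑ y, U (get x) y * ψ (put x y)) :
    normSq φ = normSq ψ := by
  -- The labels are split into classes that differ only in the part on which `U` acts; each
  -- class is represented by its member in which this part is `y₀`.
  let y₀ : R := get fun q => P.toLabel q.1 0
  let S : Finset (Labels P) := (ψ.support ∪ φ.support).image fun x => put x y₀
  have key : ∀ χ : QState P, χ.support ⊆ ψ.support ∪ φ.support →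
      normSq χ = ∑ b ∈ S, ∑ y, ‖χ (put b y)‖ ^ 2 := by
    intro χ hχ
    rw [normSq_eq_sum (T := (S ×ˢ Finset.univ).image fun u => put u.1 u.2),
      Finset.sum_image, Finset.sum_product]
    · rintro ⟨b, y⟩ hb ⟨b', y'⟩ hb' he
      simp only [S, Finset.coe_product, Finset.coe_image, Set.mem_prod, Set.mem_image] at hb hb'
      obtain ⟨⟨a, _, rfl⟩, _⟩ := hb
      obtain ⟨⟨a', _, rfl⟩, _⟩ := hb'
      simp only [put_put] at he
      have h1 : y = y' := by rw [← get_put a y, he, get_put]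
      have h2 : put a y₀ = put a' y₀ := by rw [← put_put a y, he, put_put]
      rw [h1, h2]
    · intro x hx
      refine Finset.mem_image.2 ⟨(put x y₀, get x), Finset.mem_product.2 ⟨?_, by simp⟩, ?_⟩
      · exact Finset.mem_image_of_mem _ (hχ hx)
      · simp only [put_put, put_get]
  rw [key φ Finset.subset_union_right, key ψ Finset.subset_union_left]
  refine Finset.sum_congr rfl fun b _ => ?_
  rw [← sum_normSq_mulVec hU fun y => ψ (put b y)]
  exact Finset.sum_congr rfl fun y _ => by simp only [h, get_put, put_put]

theorem overwrite_apply_of_ne {r : ℕ} {κ : Fin r → Kind} {a : Fin r → ℕ} {x : Labels P}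
    {y : (i : Fin r) → Fin (P.dim (κ i))} {q : Cell} (h : ∀ i, q ≠ (κ i, a i)) :
    overwrite κ a x y q = x q := by
  unfold overwrite
  generalize List.finRange r = l
  induction l generalizing x with
  | nil => rfl
  | cons i l ih => rw [List.foldl_cons, ih, Function.update_of_ne (h i)]

theorem overwrite_apply {r : ℕ} {κ : Fin r → Kind} {a : Fin r → ℕ}
    (hinj : Function.Injective fun i => ((κ i, a i) : Cell)) (x : Labels P)
    (y : (i : Fin r) → Fin (P.dim (κ i))) (i : Fin r) :
    overwrite κ a x y (κ i, a i) = y i := by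
  unfold overwrite
  have h : ∀ (l : List (Fin r)) (x : Labels P), l.Nodup →
      l.foldl (fun x i => Function.update x (κ i, a i) (y i)) x (κ i, a i) =
        if i ∈ l then y i else x (κ i, a i) := by
    intro l
    induction l with
    | nil => intro x _; simp
    | cons j l ih =>
      intro x hl
      rw [List.nodup_cons] at hl
      rw [List.foldl_cons, ih _ hl.2]
      by_cases hij : i = j
      · subst hij
        simp [hl.1]
      · have : ((κ i, a i) : Cell) ≠ (κ j, a j) := fun h => hij (hinj h)
        simp only [List.mem_cons, hij, false_or]
        rw [Function.update_of_ne this]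
  rw [h _ _ (List.nodup_finRange r), if_pos (List.mem_finRange i)]

theorem labels_ext_of_cells {r : ℕ} {κ : Fin r → Kind} {a : Fin r → ℕ} {x x' : Labels P}
    (h : ∀ i, x (κ i, a i) = x' (κ i, a i)) (h' : ∀ q, (∀ i, q ≠ (κ i, a i)) → x q = x' q) :
    x = x' := by
  funext q
  by_cases hq : ∃ i, q = (κ i, a i)
  · obtain ⟨i, rfl⟩ := hq
    exact h i
  · exact h' q fun i hi => hq ⟨i, hi⟩

theorem overwrite_overwrite {r : ℕ} {κ : Fin r → Kind} {a : Fin r → ℕ}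
    (hinj : Function.Injective fun i => ((κ i, a i) : Cell)) (x : Labels P)
    (y y' : (i : Fin r) → Fin (P.dim (κ i))) :
    overwrite κ a (overwrite κ a x y) y' = overwrite κ a x y' :=
  labels_ext_of_cells (κ := κ) (a := a)
    (fun i => by rw [overwrite_apply hinj, overwrite_apply hinj])
    fun q hq => by simp only [overwrite_apply_of_ne hq]

theorem overwrite_self {r : ℕ} {κ : Fin r → Kind} {a : Fin r → ℕ}
    (hinj : Function.Injective fun i => ((κ i, a i) : Cell)) (x : Labels P) :
    overwrite κ a x (fun i => x (κ i, a i)) = x :=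
  labels_ext_of_cells (κ := κ) (a := a)
    (fun i => by rw [overwrite_apply hinj]) fun q hq => overwrite_apply_of_ne hq

theorem applyOp_apply {r : ℕ} {κ : Fin r → Kind} {a : Fin r → ℕ}
    (hinj : Function.Injective fun i => ((κ i, a i) : Cell))
    (U : Matrix ((i : Fin r) → Fin (P.dim (κ i))) ((i : Fin r) → Fin (P.dim (κ i))) ℂ)
    (ψ : QState P) (x : Labels P) :
    applyOp κ a U ψ x = ∑ y, U (fun i => x (κ i, a i)) y * ψ (overwrite κ a x y) :=
  sum_single_put_apply (get := fun x i => x (κ i, a i)) (put := overwrite κ a)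
    (fun x y => funext (overwrite_apply hinj x y)) (overwrite_overwrite hinj)
    (overwrite_self hinj) U ψ x

theorem normSq_applyOp {r : ℕ} {κ : Fin r → Kind} {a : Fin r → ℕ}
    (hinj : Function.Injective fun i => ((κ i, a i) : Cell))
    {U : Matrix ((i : Fin r) → Fin (P.dim (κ i))) ((i : Fin r) → Fin (P.dim (κ i))) ℂ}
    (hU : star U * U = 1) (ψ : QState P) : normSq (applyOp κ a U ψ) = normSq ψ :=
  normSq_eq_of_put (get := fun x i => x (κ i, a i)) (put := overwrite κ a)
    (fun x y => funext (overwrite_apply hinj x y)) (overwrite_overwrite hinj)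
    (overwrite_self hinj) hU (applyOp_apply hinj U ψ)

theorem Ensures.measureComp (q : Cell) (ψ : QState P) :
    Ensures (measureComp q) ψ fun v φ => φ = ψ.filter fun x => x q = v := by
  refine ⟨fun u hu => ?_, ?_, fun u hu => ?_⟩
  · obtain ⟨a, _, rfl⟩ := Multiset.mem_map.1 hu
    exact zero_le_one
  · have h1 : expect (SelfTally.measureComp q) ψ (fun _ φ => normSq φ) =
        ∑ v, normSq (ψ.filter fun x => x q = v) := by
      change ((Finset.univ.val.map _).map _).sum = _
      rw [Multiset.map_map]
      exact Finset.sum_congr rfl fun v _ => one_mul _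
    rw [h1, normSq_eq_sum subset_rfl]
    have h2 : ∀ v, normSq (ψ.filter fun x => x q = v) =
        ∑ x ∈ ψ.support, if x q = v then ‖ψ x‖ ^ 2 else 0 := fun v => by
      rw [normSq_eq_sum (T := ψ.support) (by
        rw [Finsupp.support_filter]; exact Finset.filter_subset _ _)]
      refine Finset.sum_congr rfl fun x _ => ?_
      rw [Finsupp.filter_apply]
      split_ifs <;> simp
    simp only [h2]
    rw [Finset.sum_comm]
    simp
  · obtain ⟨a, _, rfl⟩ := Multiset.mem_map.1 hu
    rfl

end LocalOperators

/-! ### The Fourier basis -/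

section Fourier

variable {P : Params}

theorem star_fourier (d : ℕ) (x y : Fin d) : star (fourier d x y) =
    Complex.exp (2 * Real.pi * Complex.I / d) ^ (-((x.val * y.val : ℕ) : ℤ)) / Real.sqrt d := by
  unfold fourier
  rw [← Complex.exp_int_mul, RCLike.star_def, map_div₀, Complex.conj_ofReal, ← Complex.exp_conj]
  congr 2
  simp only [map_div₀, map_mul, Complex.conj_ofReal, Complex.conj_I, map_natCast, map_ofNat]
  push_cast
  ring

theorem fourier_eq (d : ℕ) (x y : Fin d) : fourier d x y =
    Complex.exp (2 * Real.pi * Complex.I / d) ^ ((x.val * y.val : ℕ) : ℤ) / Real.sqrt d := by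
  unfold fourier
  rw [← Complex.exp_int_mul]
  congr 2
  push_cast
  ring

/-- The matrix of the change from the Fourier basis to the computational basis. -/
def fourierMatrix (d : ℕ) : Matrix (Fin d) (Fin d) ℂ := fun y x => star (fourier d x y)

theorem sum_zpow_eq_zero {ζ : ℂ} {d : ℕ} (hζ : IsPrimitiveRoot ζ d) {y y' : Fin d} (h : y ≠ y') :
    ∑ x : Fin d, (ζ ^ ((y.val : ℤ) - y'.val)) ^ x.val = 0 := by
  have hne : ζ ^ ((y.val : ℤ) - y'.val) ≠ 1 := by
    rw [Ne, hζ.zpow_eq_one_iff_dvd]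
    intro hd
    apply h
    have := Int.eq_zero_of_abs_lt_dvd hd (by rw [abs_lt]; constructor <;> omega)
    ext
    omega
  have hd : (ζ ^ ((y.val : ℤ) - y'.val)) ^ d = 1 := by
    rw [← zpow_natCast, ← zpow_mul, mul_comm, zpow_mul, zpow_natCast, hζ.pow_eq_one, one_zpow]
  rw [Fin.sum_univ_eq_sum_range (fun i => (ζ ^ ((y.val : ℤ) - y'.val)) ^ i), geom_sum_eq hne, hd]
  simp

theorem fourierMatrix_mul_star {d : ℕ} (hd : 0 < d) :
    fourierMatrix d * star (fourierMatrix d) = 1 := by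
  have hζ := Complex.isPrimitiveRoot_exp d hd.ne'
  have h0 := hζ.ne_zero hd.ne'
  have hs : (Real.sqrt d : ℂ) * Real.sqrt d = d := by
    rw [← Complex.ofReal_mul, Real.mul_self_sqrt (by positivity)]; simp
  have hd' : (d : ℂ) ≠ 0 := by exact_mod_cast hd.ne'
  ext y y'
  have hterm : ∀ x : Fin d, fourierMatrix d y x * star (fourierMatrix d) x y' =
      (Complex.exp (2 * Real.pi * Complex.I / d) ^ ((y'.val : ℤ) - y.val)) ^ x.val / d := by
    intro x
    rw [Matrix.star_apply, fourierMatrix, fourierMatrix, star_star, star_fourier, fourier_eq,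
      div_mul_div_comm, hs, ← zpow_add₀ h0, ← zpow_natCast, ← zpow_mul]
    congr 2
    push_cast
    ring
  rw [Matrix.mul_apply, Finset.sum_congr rfl fun x _ => hterm x, ← Finset.sum_div]
  by_cases h : y = y'
  · subst h
    simp [hd']
  · rw [sum_zpow_eq_zero hζ (Ne.symm h), Matrix.one_apply_ne h, zero_div]

theorem star_mul_fourierMatrix {d : ℕ} (hd : 0 < d) :
    star (fourierMatrix d) * fourierMatrix d = 1 :=
  mul_eq_one_comm.1 (fourierMatrix_mul_star hd)

theorem isAlgebraic_sqrt_natCast (n : ℕ) : IsAlgebraic ℚ (Real.sqrt n : ℂ) := by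
  refine IsAlgebraic.of_pow (n := 2) two_pos ?_
  rw [← Complex.ofReal_pow, Real.sq_sqrt (by positivity), Complex.ofReal_natCast]
  exact isAlgebraic_natCast n

theorem isAlgebraic_fourierMatrix {d : ℕ} (hd : 0 < d) (x y : Fin d) :
    IsAlgebraic ℚ (fourierMatrix d x y) := by
  rw [fourierMatrix, star_fourier]
  have h1 : IsAlgebraic ℚ (Complex.exp (2 * Real.pi * Complex.I / d)) := by
    refine IsAlgebraic.of_pow hd ?_
    rw [(Complex.isPrimitiveRoot_exp d hd.ne').pow_eq_one]
    exact isAlgebraic_one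
  have h2 : IsAlgebraic ℚ (Complex.exp (2 * Real.pi * Complex.I / d) ^
      (-((y.val * x.val : ℕ) : ℤ))) := by
    rw [zpow_neg, zpow_natCast]
    exact (h1.pow _).inv
  rw [div_eq_mul_inv]
  exact h2.mul (isAlgebraic_sqrt_natCast d).inv

theorem fourierToComp_apply (q : Cell) (ψ : QState P) (x : Labels P) :
    fourierToComp q ψ x =
      ∑ y, fourierMatrix (P.dim q.1) (x q) y * ψ (Function.update x q y) :=
  sum_single_put_apply (get := fun x => x q) (put := fun x y => Function.update x q y)
    (fun x y => by simp) (fun x y y' => by simp) (fun x => by simp) (fourierMatrix _) ψ x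

theorem normSq_fourierToComp (q : Cell) (ψ : QState P) :
    normSq (fourierToComp q ψ) = normSq ψ :=
  normSq_eq_of_put (get := fun x => x q) (put := fun x y => Function.update x q y)
    (fun x y => by simp) (fun x y y' => by simp) (fun x => by simp)
    (star_mul_fourierMatrix (P.dim_pos q.1)) (fourierToComp_apply q ψ)

theorem Ensures.measureFourier (q : Cell) (ψ : QState P) :
    Ensures (measureFourier q) ψ fun v φ =>
      φ = (fourierToComp q ψ).filter fun x => x q = v :=
  (Ensures.act (normSq_fourierToComp q ψ)).bind fun _ φ hφ => by
    subst hφ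
    exact Ensures.measureComp q _

end Fourier

/-! ### Factors of a joint state -/

section Factors

variable {P : Params}

/-- The qudit of voter `k` in the `j`-th state of kind `κ`, with a kind that can be read off. -/
abbrev slot (κ : Kind) (j : ℕ) (k : Fin P.N) : Cell := (κ, (particle P κ j k).2)

theorem slot_inj {κ κ' : Kind} {j j' : ℕ} {k k' : Fin P.N} :
    slot κ j k = slot κ' j' k' ↔ κ = κ' ∧ j = j' ∧ k = k' := by
  constructor
  · intro h
    have h1 : κ = κ' := congrArg Prod.fst h
    have h2 : j * P.N + k.val = j' * P.N + k'.val := congrArg Prod.snd h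
    have h3 := k.isLt
    have h4 := k'.isLt
    have hj : j = j' := by
      have := congrArg (· / P.N) h2
      simpa [mul_comm _ P.N, Nat.mul_add_div P.N_pos, Nat.div_eq_of_lt h3,
        Nat.div_eq_of_lt h4] using this
    subst hj
    exact ⟨h1, rfl, by ext; omega⟩
  · rintro ⟨rfl, rfl, rfl⟩
    rfl

/-- The joint state `ψ` is the product of a state with amplitudes `a` of the `j`-th group of
qudits of kind `κ` and a state of all other qudits. -/
def HasFactor (κ : Kind) (j : ℕ) (a : (Fin P.N → Fin (P.dim κ)) → ℂ) (ψ : QState P) : Prop :=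
  ∃ χ : Labels P → ℂ, (∀ x, ψ x = a (fun k => x (slot κ j k)) * χ x) ∧
    ∀ x x', (∀ q, (∀ k : Fin P.N, q ≠ slot κ j k) → x q = x' q) → χ x = χ x'

/-- The qudit `q` is in state `|0⟩`. -/
def LabelZero (q : Cell) (ψ : QState P) : Prop := ∀ x, ψ x ≠ 0 → x q = P.toLabel q.1 0

theorem LabelZero.filter {q : Cell} {ψ : QState P} (h : LabelZero q ψ) (p : Labels P → Prop)
    [DecidablePred p] : LabelZero q (ψ.filter p) := fun x hx => h x fun h0 => hx (by
  rw [Finsupp.filter_apply, h0, ite_self])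

theorem LabelZero.applyOp {q : Cell} {ψ : QState P} (h : LabelZero q ψ) {r : ℕ}
    {κ : Fin r → Kind} {a : Fin r → ℕ}
    (hinj : Function.Injective fun i => ((κ i, a i) : Cell))
    (U : Matrix ((i : Fin r) → Fin (P.dim (κ i))) ((i : Fin r) → Fin (P.dim (κ i))) ℂ)
    (hq : ∀ i, q ≠ (κ i, a i)) : LabelZero q (applyOp κ a U ψ) := by
  intro x hx
  rw [applyOp_apply hinj] at hx
  obtain ⟨y, _, hy⟩ := Finset.exists_ne_zero_of_sum_ne_zero hx
  rw [← overwrite_apply_of_ne (x := x) (y := y) hq]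
  exact h _ (right_ne_zero_of_mul hy)

theorem LabelZero.fourierToComp {q q' : Cell} {ψ : QState P} (h : LabelZero q ψ) (hq : q ≠ q') :
    LabelZero q (fourierToComp q' ψ) := by
  intro x hx
  rw [fourierToComp_apply] at hx
  obtain ⟨y, _, hy⟩ := Finset.exists_ne_zero_of_sum_ne_zero hx
  rw [← Function.update_of_ne hq y x]
  exact h _ (right_ne_zero_of_mul hy)

variable {κ : Kind} {j : ℕ} {a : (Fin P.N → Fin (P.dim κ)) → ℂ} {ψ : QState P}

theorem HasFactor.filter_of_ne (h : HasFactor κ j a ψ) {q : Cell}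
    (hq : ∀ k : Fin P.N, q ≠ slot κ j k) (v : Fin (P.dim q.1)) :
    HasFactor κ j a (ψ.filter fun x => x q = v) := by
  obtain ⟨χ, h1, h2⟩ := h
  refine ⟨fun x => if x q = v then χ x else 0, fun x => ?_, fun x x' hx => ?_⟩
  · rw [Finsupp.filter_apply, h1]
    by_cases hx : x q = v <;> simp [hx]
  · beta_reduce
    rw [hx q hq, h2 x x' hx]

theorem HasFactor.applyOp_of_ne (h : HasFactor κ j a ψ) {r : ℕ} {κ' : Fin r → Kind}
    {b : Fin r → ℕ} (hinj : Function.Injective fun i => ((κ' i, b i) : Cell))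
    (U : Matrix ((i : Fin r) → Fin (P.dim (κ' i))) ((i : Fin r) → Fin (P.dim (κ' i))) ℂ)
    (hq : ∀ i (k : Fin P.N), (κ' i, b i) ≠ slot κ j k) : HasFactor κ j a (applyOp κ' b U ψ) := by
  obtain ⟨χ, h1, h2⟩ := h
  refine ⟨fun x => ∑ y, U (fun i => x (κ' i, b i)) y * χ (overwrite κ' b x y), fun x => ?_,
    fun x x' hx => ?_⟩
  · rw [applyOp_apply hinj, Finset.mul_sum]
    refine Finset.sum_congr rfl fun y _ => ?_
    rw [h1]
    have : (fun k => overwrite κ' b x y (slot κ j k)) = fun k => x (slot κ j k) :=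
      funext fun k => overwrite_apply_of_ne fun i => (hq i k).symm
    rw [this]
    ring
  · have : (fun i => x (κ' i, b i)) = fun i => x' (κ' i, b i) :=
      funext fun i => hx _ (hq i)
    simp only [this]
    refine Finset.sum_congr rfl fun y _ => ?_
    rw [h2 _ (overwrite κ' b x' y)]
    intro q hq'
    by_cases hqi : ∃ i, q = (κ' i, b i)
    · obtain ⟨i, rfl⟩ := hqi
      rw [overwrite_apply hinj, overwrite_apply hinj]
    · push Not at hqi
      rw [overwrite_apply_of_ne hqi, overwrite_apply_of_ne hqi, hx q hq']

theorem HasFactor.fourierToComp_of_ne (h : HasFactor κ j a ψ) {q : Cell}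
    (hq : ∀ k : Fin P.N, q ≠ slot κ j k) : HasFactor κ j a (fourierToComp q ψ) := by
  obtain ⟨χ, h1, h2⟩ := h
  refine ⟨fun x => ∑ y, fourierMatrix (P.dim q.1) (x q) y * χ (Function.update x q y),
    fun x => ?_, fun x x' hx => ?_⟩
  · rw [fourierToComp_apply, Finset.mul_sum]
    refine Finset.sum_congr rfl fun y _ => ?_
    rw [h1]
    have : (fun k => Function.update x q y (slot κ j k)) =
        fun k => x (slot κ j k) :=
      funext fun k => Function.update_of_ne (hq k).symm _ _
    rw [this]
    ring
  · beta_reduce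
    rw [hx q hq]
    refine Finset.sum_congr rfl fun y _ => ?_
    rw [h2 _ (Function.update x' q y)]
    intro q' hq'
    by_cases hqq : q' = q
    · subst hqq
      simp
    · rw [Function.update_of_ne hqq, Function.update_of_ne hqq, hx q' hq']

theorem HasFactor.filter_self (h : HasFactor κ j a ψ) (k : Fin P.N) (v : Fin (P.dim κ)) :
    HasFactor κ j (fun y => if y k = v then a y else 0)
      (ψ.filter fun x => x (slot κ j k) = v) := by
  obtain ⟨χ, h1, h2⟩ := h
  refine ⟨χ, fun x => ?_, h2⟩
  rw [Finsupp.filter_apply, h1]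
  by_cases hx : x (slot κ j k) = v <;> simp [hx]

theorem update_slot (x : Labels P) (k : Fin P.N) (z : Fin (P.dim κ)) :
    (fun l => Function.update x (slot κ j k) z (slot κ j l)) =
      Function.update (fun l => x (slot κ j l)) k z := by
  funext l
  by_cases h : l = k
  · subst h
    simp
  · rw [Function.update_of_ne h, Function.update_of_ne]
    exact fun h' => h (slot_inj.1 h').2.2

theorem HasFactor.fourierToComp_self (h : HasFactor κ j a ψ) (k : Fin P.N) :
    HasFactor κ j (fun y => ∑ z, fourierMatrix (P.dim κ) (y k) z * a (Function.update y k z))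
      (fourierToComp (slot κ j k) ψ) := by
  obtain ⟨χ, h1, h2⟩ := h
  refine ⟨χ, fun x => ?_, h2⟩
  rw [fourierToComp_apply, Finset.sum_mul]
  refine Finset.sum_congr rfl fun z _ => ?_
  rw [h1, update_slot, h2 _ x, mul_assoc]
  intro q hq
  rw [Function.update_of_ne (hq k)]

theorem hasFactor_congr {a' : (Fin P.N → Fin (P.dim κ)) → ℂ} (h : HasFactor κ j a ψ)
    (ha : ∀ y, a y = a' y) : HasFactor κ j a' ψ := by
  rwa [← (funext ha : a = a')]

theorem injective_slot (κ : Kind) (j : ℕ) :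
    Function.Injective fun i => ((κ, (particle P κ j i).2) : Cell) :=
  fun _ _ h => (slot_inj.1 h).2.2

/-- An operator applied to qudits in state `|0⟩` produces the state given by its first column. -/
theorem hasFactor_applyOp_of_labelZero (h : ∀ k : Fin P.N, LabelZero (slot κ j k) ψ)
    (U : Matrix (Fin P.N → Fin (P.dim κ)) (Fin P.N → Fin (P.dim κ)) ℂ) :
    HasFactor κ j (fun y => U y fun _ => P.toLabel κ 0)
      (applyOp (fun _ => κ) (fun i => (particle P κ j i).2) U ψ) := by
  refine ⟨fun x => ψ (overwrite (fun _ => κ) (fun i => (particle P κ j i).2) x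
    fun _ => P.toLabel κ 0), fun x => ?_, fun x x' hx => ?_⟩
  · rw [applyOp_apply (injective_slot κ j), Finset.sum_eq_single fun _ => P.toLabel κ 0]
    · intro y _ hy
      rw [mul_eq_zero]
      right
      by_contra h0
      apply hy
      funext k
      exact (overwrite_apply (injective_slot κ j) x y k).symm.trans (h k _ h0)
    · simp
  · beta_reduce
    congr 1
    refine labels_ext_of_cells (κ := fun _ => κ) (a := fun i => (particle P κ j i).2)
      (fun i => ?_) fun q hq => ?_
    · rw [overwrite_apply (injective_slot κ j), overwrite_apply (injective_slot κ j)]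
    · rw [overwrite_apply_of_ne hq, overwrite_apply_of_ne hq, hx q hq]

end Factors

/-! ### Amplitudes of the honest states -/

section Amplitudes

variable {P : Params}

/-- Amplitudes of the honest state of kind `κ` when the qudits of the voters in `K` are written
in the Fourier basis and the other qudits in the computational basis. -/
def partialFourier (P : Params) (κ : Kind) (K : Set (Fin P.N)) (y : Fin P.N → Fin (P.dim κ)) : ℂ :=
  ∑ x, (∏ k, if k ∈ K then fourierMatrix (P.dim κ) (y k) (x k)
    else if x k = y k then 1 else 0) * amplitude P κ x

theorem partialFourier_empty (κ : Kind) (y : Fin P.N → Fin (P.dim κ)) :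
    partialFourier P κ ∅ y = amplitude P κ y := by
  unfold partialFourier
  rw [Finset.sum_eq_single y]
  · simp
  · intro x _ hx
    obtain ⟨k, hk⟩ := Function.ne_iff.1 hx
    rw [Finset.prod_eq_zero (Finset.mem_univ k) (by simp [hk]), zero_mul]
  · simp

theorem partialFourier_univ (κ : Kind) (y : Fin P.N → Fin (P.dim κ)) :
    partialFourier P κ Set.univ y = fourierAmplitude P κ y := by
  unfold partialFourier fourierAmplitude
  refine Finset.sum_congr rfl fun x _ => ?_
  simp [fourierMatrix]

theorem partialFourier_insert {κ : Kind} {K : Set (Fin P.N)} {k : Fin P.N} (hk : k ∉ K)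
    (y : Fin P.N → Fin (P.dim κ)) :
    ∑ z, fourierMatrix (P.dim κ) (y k) z * partialFourier P κ K (Function.update y k z) =
      partialFourier P κ (insert k K) y := by
  unfold partialFourier
  simp only [Finset.mul_sum]
  rw [Finset.sum_comm]
  refine Finset.sum_congr rfl fun x _ => ?_
  rw [Finset.sum_eq_single (x k)]
  · rw [← mul_assoc]
    congr 1
    rw [← Finset.mul_prod_erase _ _ (Finset.mem_univ k)]
    refine Eq.trans ?_ (Finset.mul_prod_erase _ _ (Finset.mem_univ k))
    simp only [hk, if_false, Function.update_self, if_true, one_mul, Set.mem_insert_iff,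
      true_or]
    congr 1
    refine Finset.prod_congr rfl fun l hl => ?_
    have hlk := Finset.ne_of_mem_erase hl
    simp only [hlk, false_or, Function.update_of_ne hlk]
  · intro z _ hz
    rw [Finset.prod_eq_zero (Finset.mem_univ k), zero_mul, mul_zero]
    simp [hk, hz.symm]
  · simp

theorem passComp_of_amplitude_ne_zero {κ : Kind} {y : Fin P.N → Fin (P.dim κ)}
    (h : amplitude P κ y ≠ 0) : passComp P κ y := by
  cases κ
  · by_contra h'
    exact h (if_neg h')
  · by_contra h'
    exact h (if_neg h')

/-- The map that adds one to the label `k` and subtracts one from the label `l` permutes the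
strings of `D₁`, but multiplies the summands of the Fourier amplitude by a phase which is `1`
only for `y k = y l`. -/
theorem eq_of_fourierAmplitude_ne_zero (hcm : P.c ∣ P.m) {y : Fin P.N → Fin (P.dim .ballot)}
    (h : fourierAmplitude P .ballot y ≠ 0) (k l : Fin P.N) : y k = y l := by
  by_contra hkl
  have hne : k ≠ l := fun h' => hkl (by rw [h'])
  have hcd : P.c ∣ P.dim .ballot := hcm
  have hd := P.dim_pos .ballot
  have : NeZero (P.dim .ballot) := ⟨hd.ne'⟩
  have hζ := Complex.isPrimitiveRoot_exp (P.dim .ballot) hd.ne'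
  have hζ0 := hζ.ne_zero hd.ne'
  set ζ : ℂ := Complex.exp (2 * Real.pi * Complex.I / (P.dim .ballot))
  have hzpow : ∀ a b : ℤ, a ≡ b [ZMOD (P.dim .ballot)] → ζ ^ a = ζ ^ b := fun a b hab => by
    have h1 : ζ ^ (b - a) = 1 := (hζ.zpow_eq_one_iff_dvd _).2 (Int.modEq_iff_dvd.1 hab)
    rw [zpow_sub₀ hζ0, div_eq_one_iff_eq (zpow_ne_zero _ hζ0)] at h1
    exact h1.symm
  have hadd : ∀ u v : Fin (P.dim .ballot), ((u + v : Fin (P.dim .ballot)).val : ℤ) ≡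
      u.val + v.val [ZMOD (P.dim .ballot)] := fun u v => by
    rw [Fin.val_add]
    push_cast
    exact Int.mod_modEq _ _
  have hone : ((1 : Fin (P.dim .ballot)).val : ℤ) ≡ 1 [ZMOD (P.dim .ballot)] := by
    rw [Fin.val_one']
    push_cast
    exact Int.mod_modEq _ _
  have hneg : ((-1 : Fin (P.dim .ballot)).val : ℤ) ≡ -1 [ZMOD (P.dim .ballot)] := by
    have h1 := hadd (-1) 1
    rw [neg_add_cancel, Fin.val_zero] at h1
    have h2 := (h1.symm.sub hone)
    simpa using h2
  -- The shift of the labels, which is zero in all places other than `k` and `l`.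
  let s : Fin P.N → Fin (P.dim .ballot) := Pi.single k 1 + Pi.single l (-1)
  have hsk : s k = 1 := by simp [s, hne]
  have hsl : s l = -1 := by simp [s, hne.symm]
  have hs : ∀ i, i ≠ k → i ≠ l → s i = 0 := fun i h1 h2 => by simp [s, h1, h2]
  have hterm : ∀ x : Fin P.N → Fin (P.dim .ballot),
      star (∏ i, fourier (P.dim .ballot) ((x + s) i) (y i)) =
      ζ ^ ((y l : ℤ) - y k) * star (∏ i, fourier (P.dim .ballot) (x i) (y i)) := by
    intro x
    have h1 : ∀ i, star (fourier (P.dim .ballot) ((x + s) i) (y i)) =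
        ζ ^ (-((s i).val * (y i).val : ℤ)) * star (fourier (P.dim .ballot) (x i) (y i)) := fun i => by
      rw [star_fourier, star_fourier, ← mul_div_assoc, ← zpow_add₀ hζ0]
      congr 1
      apply hzpow
      rw [Pi.add_apply]
      push_cast
      refine (((hadd (x i) (s i)).mul_right _).neg).trans ?_
      ring_nf
      rfl
    simp only [star_prod, h1]
    rw [Finset.prod_mul_distrib, Finset.prod_eq_mul k l hne
      (fun i _ hi => by rw [hs i hi.1 hi.2]; simp) (by simp) (by simp), ← zpow_add₀ hζ0]
    congr 1
    apply hzpow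
    rw [hsk, hsl]
    have h2 := ((hone.mul_right (y k : ℤ)).neg).add ((hneg.mul_right (y l : ℤ)).neg)
    refine h2.trans ?_
    ring_nf
    rfl
  have hamp : ∀ x : Fin P.N → Fin (P.dim .ballot),
      amplitude P .ballot (x + s) = amplitude P .ballot x := by
    intro x
    let f : Fin (P.dim .ballot) → ZMod P.c := fun v => (v.val : ZMod P.c)
    have hf : ∀ u v, f (u + v) = f u + f v := fun u v => by
      have h1 := (hadd u v).of_dvd (Int.natCast_dvd_natCast.2 hcd)
      have h2 := (ZMod.intCast_eq_intCast_iff _ _ _).2 h1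
      push_cast at h2
      exact h2
    have hf0 : f 0 = 0 := by simp [f]
    have hsum : ∑ i, f (s i) = 0 := by
      rw [Fintype.sum_eq_add k l hne (fun i hi => by rw [hs i hi.1 hi.2, hf0]), hsk, hsl, ← hf,
        add_neg_cancel, hf0]
    have hiff : P.c ∣ ∑ i, ((x + s) i).val ↔ P.c ∣ ∑ i, (x i).val := by
      rw [← ZMod.natCast_eq_zero_iff, ← ZMod.natCast_eq_zero_iff]
      push_cast
      have : ∑ i, f ((x + s) i) = ∑ i, f (x i) := by
        simp only [Pi.add_apply, hf, Finset.sum_add_distrib, hsum, add_zero]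
      rw [show ∑ i, (((x + s) i).val : ZMod P.c) = ∑ i, ((x i).val : ZMod P.c) from this]
    unfold amplitude
    simp only [hiff]
  have hshift : fourierAmplitude P .ballot y =
      ζ ^ ((y l : ℤ) - y k) * fourierAmplitude P .ballot y := by
    conv_lhs => unfold fourierAmplitude
    rw [← Equiv.sum_comp (Equiv.addRight s)]
    unfold fourierAmplitude
    rw [Finset.mul_sum]
    refine Finset.sum_congr rfl fun x _ => ?_
    rw [← mul_assoc]
    exact congrArg₂ (· * ·) (hterm x) (hamp x)
  have h1 : ζ ^ ((y l : ℤ) - y k) = 1 :=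
    mul_right_cancel₀ h (hshift.symm.trans (one_mul _).symm)
  rw [hζ.zpow_eq_one_iff_dvd] at h1
  have := Int.eq_zero_of_abs_lt_dvd h1 (by
    have h3 := (y k).isLt
    have h4 := (y l).isLt
    rw [abs_lt]; constructor <;> omega)
  exact hkl (Fin.ext (by omega))

theorem passFourier_of_fourierAmplitude_ne_zero (hcm : P.c ∣ P.m) {κ : Kind}
    {y : Fin P.N → Fin (P.dim κ)} (h : fourierAmplitude P κ y ≠ 0) : passFourier P κ y := by
  cases κ
  · exact eq_of_fourierAmplitude_ne_zero hcm h
  · exact h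

end Amplitudes

/-! ### Gates -/

section Gates

section Householder

variable {ι : Type} [Fintype ι] [DecidableEq ι]

/-- The reflection that exchanges the basis vector `e` and the unit vector `d`. For `d` equal to
that basis vector the quotient is `2 / 0 = 0`, and the matrix is the identity. -/
def householder (e : ι) (d : ι → ℝ) : Matrix ι ι ℝ := fun x y =>
  (if x = y then 1 else 0) - 2 / (∑ z, ((Pi.single e 1 - d : ι → ℝ) z) ^ 2) *
    (Pi.single e 1 - d : ι → ℝ) x * (Pi.single e 1 - d : ι → ℝ) y

theorem householder_mul_self (e : ι) (d : ι → ℝ) : householder e d * householder e d = 1 := by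
  ext x y
  set w : ι → ℝ := Pi.single e 1 - d with hw
  set W := ∑ z, w z ^ 2 with hW
  have hterm : ∀ z, householder e d x z * householder e d z y =
      (if x = z then 1 else 0) * (if z = y then 1 else 0)
        - 2 / W * w x * ((if z = y then 1 else 0) * w z)
        - 2 / W * w y * ((if x = z then 1 else 0) * w z)
        + (2 / W) ^ 2 * w x * w y * w z ^ 2 := fun z => by
    unfold householder
    rw [← hw, ← hW]
    ring
  have hs : (2 / W) ^ 2 * W = 2 * (2 / W) := by
    by_cases h : W = 0
    · simp [h]
    · field_simp
  rw [Matrix.mul_apply, Finset.sum_congr rfl fun z _ => hterm z, Finset.sum_add_distrib,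
    Finset.sum_sub_distrib, Finset.sum_sub_distrib, ← Finset.mul_sum, ← Finset.mul_sum,
    ← Finset.mul_sum, ← hW]
  simp only [ite_mul, one_mul, zero_mul, Finset.sum_ite_eq, Finset.sum_ite_eq', Finset.mem_univ,
    if_true, Matrix.one_apply]
  linear_combination w x * w y * hs

theorem householder_apply_self {e : ι} {d : ι → ℝ} (hd : ∑ z, d z ^ 2 = 1) (x : ι) :
    householder e d x e = d x := by
  set w : ι → ℝ := Pi.single e 1 - d with hw
  have hwz : ∀ z, w z = (if z = e then 1 else 0) - d z := fun z => by
    simp [hw, Pi.single_apply]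
  have hW : ∑ z, w z ^ 2 = 2 * w e := by
    have h1 : ∀ z, w z ^ 2 = (if z = e then 1 - 2 * d z else 0) + d z ^ 2 := fun z => by
      rw [hwz]
      split_ifs <;> ring
    rw [Finset.sum_congr rfl fun z _ => h1 z, Finset.sum_add_distrib, hd, hwz]
    simp
    ring
  have h2 : householder e d x e =
      (if x = e then 1 else 0) - 2 / (∑ z, w z ^ 2) * w x * w e := rfl
  by_cases h0 : w e = 0
  · rw [h0, mul_zero] at hW
    have h3 := (Finset.sum_eq_zero_iff_of_nonneg fun z _ => sq_nonneg (w z)).1 hW x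
      (Finset.mem_univ x)
    have h4 : w x = 0 := by simpa using h3
    rw [h2, h4]
    rw [hwz] at h4
    linarith
  · rw [h2, hW, hwz x]
    field_simp
    ring

theorem isAlgebraic_householder {e : ι} {d : ι → ℝ} (hd : ∀ z, IsAlgebraic ℚ (d z)) (x y : ι) :
    IsAlgebraic ℚ (householder e d x y) := by
  have h01 : ∀ (p : Prop) [Decidable p], IsAlgebraic ℚ (if p then (1 : ℝ) else 0) := fun p _ => by
    split_ifs
    exacts [isAlgebraic_one, isAlgebraic_zero]
  have hw : ∀ z, IsAlgebraic ℚ ((Pi.single e 1 - d : ι → ℝ) z) := fun z => by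
    rw [Pi.sub_apply, Pi.single_apply]
    exact (h01 (z = e)).sub (hd z)
  have hW : IsAlgebraic ℚ (∑ z, ((Pi.single e 1 - d : ι → ℝ) z) ^ 2) :=
    sum_mem (S := Subalgebra.algebraicClosure ℚ ℝ) fun z _ => (hw z).pow 2
  have h1 := h01 (x = y)
  unfold householder
  rw [div_eq_mul_inv]
  have h2 : IsAlgebraic ℚ (2 : ℝ) := isAlgebraic_natCast 2
  exact h1.sub (((h2.mul hW.inv).mul (hw x)).mul (hw y))

end Householder

variable {P : Params}

theorem exists_real_amplitude (P : Params) (κ : Kind) :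
    ∃ d : (Fin P.N → Fin (P.dim κ)) → ℝ, (∀ y, (d y : ℂ) = amplitude P κ y) ∧
      ∑ y, d y ^ 2 = 1 ∧ ∀ y, IsAlgebraic ℚ (d y) := by
  -- Both states are uniform superpositions of the strings with a property `p`.
  have key : ∀ (p : (Fin P.N → Fin (P.dim κ)) → Prop) (n : ℕ),
      Nat.card {y // p y} = n → n ≠ 0 →
      (∀ y, amplitude P κ y = if p y then (Real.sqrt n : ℂ)⁻¹ else 0) →
      ∃ d : (Fin P.N → Fin (P.dim κ)) → ℝ, (∀ y, (d y : ℂ) = amplitude P κ y) ∧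
        ∑ y, d y ^ 2 = 1 ∧ ∀ y, IsAlgebraic ℚ (d y) := by
    intro p n hn hn0 hp
    refine ⟨fun y => if p y then (Real.sqrt n)⁻¹ else 0, fun y => ?_, ?_, fun y => ?_⟩
    · rw [hp]
      by_cases h : p y <;> simp [h]
    · have h1 : ∀ y, (if p y then (Real.sqrt n)⁻¹ else 0) ^ 2 =
          if p y then (n : ℝ)⁻¹ else 0 := fun y => by
        split_ifs
        · rw [inv_pow, Real.sq_sqrt (by positivity)]
        · simp
      rw [Finset.sum_congr rfl fun y _ => h1 y, ← Finset.sum_filter, Finset.sum_const,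
        ← Fintype.card_subtype, nsmul_eq_mul]
      have : (n : ℝ) ≠ 0 := by exact_mod_cast hn0
      rw [← Nat.card_eq_fintype_card, hn]
      exact mul_inv_cancel₀ this
    · beta_reduce
      split_ifs
      · refine IsAlgebraic.inv (IsAlgebraic.of_pow (n := 2) two_pos ?_)
        rw [Real.sq_sqrt (by positivity)]
        exact isAlgebraic_natCast n
      · exact isAlgebraic_zero
  cases κ
  · refine key (fun y => P.c ∣ ∑ k, (y k).val) _ Nat.card_eq_fintype_card ?_ fun y => ?_
    · have : Nonempty {y : Fin P.N → Fin (P.dim .ballot) // P.c ∣ ∑ k, (y k).val} :=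
        ⟨fun _ => P.toLabel .ballot 0, by simp [Params.toLabel]⟩
      exact Fintype.card_ne_zero
    · simp only [amplitude]
      congr
  · refine key Function.Injective P.N.factorial ?_ (Nat.factorial_ne_zero _) fun y => ?_
    · change Nat.card {y : Fin P.N → Fin P.N // Function.Injective y} = _
      rw [Nat.card_congr (Equiv.subtypeInjectiveEquivEmbedding (Fin P.N) (Fin P.N)),
        Nat.card_eq_fintype_card, Fintype.card_embedding_eq]
      simp [Nat.descFactorial_self]
    · simp only [amplitude]
      congr

theorem exists_preparation_matrix (P : Params) (κ : Kind) :
    ∃ U : Matrix (Fin P.N → Fin (P.dim κ)) (Fin P.N → Fin (P.dim κ)) ℂ,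
      U ∈ Matrix.unitaryGroup (Fin P.N → Fin (P.dim κ)) ℂ ∧ (∀ x y, IsAlgebraic ℚ (U x y)) ∧
      ∀ y, (U y fun _ => P.toLabel κ 0) = amplitude P κ y := by
  obtain ⟨d, h1, h2, h3⟩ := exists_real_amplitude P κ
  set A := householder (fun _ => P.toLabel κ 0) d with hA
  have hsymm : ∀ x y, A x y = A y x := fun x y => by
    simp only [hA, householder, eq_comm (a := x)]
    ring
  refine ⟨A.map Complex.ofRealHom, ?_, fun x y => ?_, fun y => ?_⟩
  · rw [Matrix.mem_unitaryGroup_iff']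
    have hstar : star (A.map Complex.ofRealHom) = A.map Complex.ofRealHom := by
      ext x y
      rw [Matrix.star_apply, Matrix.map_apply, Matrix.map_apply, hsymm]
      exact Complex.conj_ofReal _
    rw [hstar, ← Matrix.map_mul, hA, householder_mul_self, Matrix.map_one _ (map_zero _) (map_one _)]
  · exact (isAlgebraic_householder h3 x y).algebraMap
  · rw [Matrix.map_apply, hA, householder_apply_self h2]
    exact h1 y

/-- A gate that turns `|0⟩ ⋯ |0⟩` into the honest state of kind `κ`. -/
def preparationGate (P : Params) (κ : Kind) : Gate P where
  arity := P.N
  kinds := fun _ => κ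
  mat := (exists_preparation_matrix P κ).choose
  unitary := (exists_preparation_matrix P κ).choose_spec.1
  algebraic := (exists_preparation_matrix P κ).choose_spec.2.1

theorem fourierMatrix_mem_unitaryGroup {d : ℕ} (hd : 0 < d) :
    (Matrix.of fun y x : Fin 1 → Fin d => fourierMatrix d (y 0) (x 0)) ∈
      Matrix.unitaryGroup (Fin 1 → Fin d) ℂ := by
  rw [Matrix.mem_unitaryGroup_iff']
  ext x y
  have h := congrFun (congrFun (star_mul_fourierMatrix hd) (x 0)) (y 0)
  rw [Matrix.mul_apply] at h ⊢
  rw [← (Equiv.funUnique (Fin 1) (Fin d)).symm.sum_comp]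
  refine Eq.trans h ?_
  simp only [Matrix.one_apply]
  congr 1
  rw [eq_iff_iff]
  exact ⟨fun h => funext fun i => by rwa [Subsingleton.elim i 0], fun h => congrFun h 0⟩

/-- The change from the Fourier basis to the computational basis of one qudit. -/
def fourierGate (P : Params) (κ : Kind) : Gate P where
  arity := 1
  kinds := fun _ => κ
  mat := Matrix.of fun y x => fourierMatrix (P.dim κ) (y 0) (x 0)
  unitary := fourierMatrix_mem_unitaryGroup (P.dim_pos κ)
  algebraic := fun _ _ => isAlgebraic_fourierMatrix (P.dim_pos κ) _ _

theorem applyOp_preparationGate {κ : Kind} {j : ℕ} {ψ : QState P}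
    (h : ∀ k : Fin P.N, LabelZero (slot κ j k) ψ) :
    HasFactor κ j (amplitude P κ) (applyOp (preparationGate P κ).kinds
      (fun i => (particle P κ j i).2) (preparationGate P κ).mat ψ) :=
  hasFactor_congr (hasFactor_applyOp_of_labelZero h _)
    (exists_preparation_matrix P κ).choose_spec.2.2

theorem applyOp_fourierGate (κ : Kind) (n : ℕ) (ψ : QState P) :
    applyOp (fourierGate P κ).kinds (fun _ => n) (fourierGate P κ).mat ψ =
      fourierToComp (κ, n) ψ := by
  ext x
  have hinj : Function.Injective fun i : Fin (fourierGate P κ).arity =>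
      (((fourierGate P κ).kinds i, n) : Cell) := fun i i' _ => Subsingleton.elim (α := Fin 1) i i'
  rw [applyOp_apply hinj, fourierToComp_apply]
  refine ((Equiv.funUnique (Fin 1) (Fin (P.dim κ))).symm.sum_comp _).symm.trans ?_
  rfl

end Gates

/-! ### Execution of programs -/

section Execution

variable {P : Params}

theorem pure_bind_eq {α β : Type} (a : α) (g : α → QComp P β) : (pure a >>= g) = g a := by
  funext ψ
  change ((({(a, 1, ψ)} : Multiset (α × ℝ × QState P))).bind _) = _
  simp

theorem bind_assoc_eq {α β γ : Type} (f : QComp P α) (g : α → QComp P β) (h : β → QComp P γ) :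
    (f >>= g) >>= h = f >>= fun a => g a >>= h := by
  funext ψ
  change ((f ψ).bind _).bind _ = (f ψ).bind _
  rw [Multiset.bind_assoc]
  refine Multiset.bind_congr fun u _ => ?_
  change _ = (((g u.1 u.2.2).bind _).map _)
  rw [Multiset.bind_map, Multiset.map_bind]
  refine Multiset.bind_congr fun v _ => ?_
  rw [Multiset.map_map]
  refine Multiset.map_congr rfl fun w _ => ?_
  simp [mul_assoc]

theorem Ensures.ite {α : Type} {c : Prop} [Decidable c] {f g : QComp P α} {ψ : QState P}
    {Q : α → QState P → Prop} (hf : c → Ensures f ψ Q) (hg : ¬ c → Ensures g ψ Q) :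
    Ensures (if c then f else g) ψ Q := by
  split_ifs with h
  exacts [hf h, hg h]

theorem Ensures.gate {acc : Cell → Prop} {g : Gate P} {a : Fin g.arity → Expr} {s : Memory}
    {ψ : QState P} : Ensures ((Prog.gate g a).exec acc s) ψ fun s' φ => s' = s.tick ∧
      φ = if Function.Injective (fun i => ((g.kinds i, (a i).eval s) : Cell)) ∧
          ∀ i, acc (g.kinds i, (a i).eval s) then
        applyOp g.kinds (fun i => (a i).eval s) g.mat ψ else ψ := by
  change Ensures (if _ then _ else _) ψ _
  split_ifs with h
  · exact (Ensures.act (normSq_applyOp h.1 (Matrix.mem_unitaryGroup_iff'.1 g.unitary) ψ)).bind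
      fun _ φ hφ => Ensures.pure ⟨rfl, hφ⟩
  · exact Ensures.pure ⟨rfl, rfl⟩

/-- Programs that never overwrite the number stored at address `0`, and whose loops are bounded
by `L` as long as this number is `M`. -/
def Prog.Tame (M L : ℕ) : Prog P → Prop
  | .skip => True
  | .store a _ => ∀ s, a.eval s ≠ 0
  | .emit _ _ => True
  | .gate _ _ => True
  | .measure _ _ a => ∀ s, a.eval s ≠ 0
  | .seq f g => f.Tame M L ∧ g.Tame M L
  | .ite _ f g => f.Tame M L ∧ g.Tame M L
  | .loop e f => (∀ s, s.work 0 = M → e.eval s ≤ L) ∧ f.Tame M L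

/-- A bound for the number of steps of a program, as a polynomial in the number of repetitions
of its loops. -/
def Prog.stepBound : Prog P → Polynomial ℕ
  | .skip | .store _ _ | .emit _ _ | .gate _ _ | .measure _ _ _ => 1
  | .seq f g => f.stepBound + g.stepBound
  | .ite _ f g => 1 + f.stepBound + g.stepBound
  | .loop _ f => 1 + Polynomial.X * f.stepBound

theorem Prog.Tame.ensures {M L : ℕ} {p : Prog P} (hp : p.Tame M L) (acc : Cell → Prop)
    {s : Memory} (hs : s.work 0 = M) (ψ : QState P) :
    Ensures (p.exec acc s) ψ fun s' _ =>
      s'.work 0 = M ∧ s'.time ≤ s.time + p.stepBound.eval L := by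
  induction p generalizing s ψ with
  | skip => exact Ensures.pure ⟨hs, by simp [Memory.tick, stepBound]⟩
  | store a e =>
    exact Ensures.pure ⟨by simpa [Function.update_of_ne (hp s).symm, Memory.tick] using hs,
      by simp [Memory.tick, stepBound]⟩
  | emit a e => exact Ensures.pure ⟨hs, by simp [Memory.tick, stepBound]⟩
  | gate g a =>
    refine Ensures.gate.mono ?_
    rintro s' φ ⟨rfl, -⟩
    exact ⟨hs, by simp [Memory.tick, stepBound]⟩
  | measure κ q a =>
    refine Ensures.ite (fun _ => ?_) fun _ => ?_
    · exact (Ensures.measureComp _ _).bind fun v φ _ => Ensures.pure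
        ⟨by simpa [Function.update_of_ne (hp s).symm, Memory.tick] using hs,
          by simp [Memory.tick, stepBound]⟩
    · exact Ensures.pure ⟨hs, by simp [Memory.tick, stepBound]⟩
  | seq f g ihf ihg =>
    refine (ihf hp.1 hs ψ).bind fun s' φ h => (ihg hp.2 h.1 φ).mono fun s'' _ h' => ⟨h'.1, ?_⟩
    simp only [stepBound, Polynomial.eval_add]
    linarith [h.2, h'.2]
  | ite e f g ihf ihg =>
    refine Ensures.ite (fun _ => ?_) fun _ => ?_
    · refine (ihf hp.1 (s := s.tick) hs ψ).mono fun s' _ h => ⟨h.1, h.2.trans ?_⟩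
      simp only [stepBound, Polynomial.eval_add, Polynomial.eval_one, Memory.tick]
      omega
    · refine (ihg hp.2 (s := s.tick) hs ψ).mono fun s' _ h => ⟨h.1, h.2.trans ?_⟩
      simp only [stepBound, Polynomial.eval_add, Polynomial.eval_one, Memory.tick]
      omega
  | loop e f ih =>
    refine (Ensures.iter (fun i s' _ => s'.work 0 = M ∧
      s'.time ≤ s.tick.time + i * f.stepBound.eval L) (e.eval s) (s := s.tick) (ψ := ψ)
      (fun i _ s' φ h => ?_) ⟨hs, by simp⟩).mono fun s' _ h => ⟨h.1, h.2.trans ?_⟩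
    · refine (ih hp.2 h.1 φ).mono fun s'' _ h' => ⟨h'.1, h'.2.trans ?_⟩
      rw [add_mul, one_mul]
      linarith [h.2]
    · simp only [stepBound, Polynomial.eval_add, Polynomial.eval_one, Polynomial.eval_mul,
        Polynomial.eval_X, Memory.tick]
      have := Nat.mul_le_mul_right (f.stepBound.eval L) (hp.1 s hs)
      omega

/-- Programs without access to qudits. -/
def Prog.Classical : Prog P → Prop
  | .skip | .store _ _ | .emit _ _ => True
  | .gate _ _ | .measure _ _ _ => False
  | .seq f g | .ite _ f g => f.Classical ∧ g.Classical
  | .loop _ f => f.Classical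

/-- The effect of a classical program on the memory; gates and measurements are ignored. -/
def Prog.run : Prog P → Memory → Memory
  | .skip | .gate _ _ | .measure _ _ _ => fun s => s.tick
  | .store a e => fun s => { s.tick with work := Function.update s.work (a.eval s) (e.eval s) }
  | .emit a e => fun s => { s.tick with out := Function.update s.out (a.eval s) (e.eval s) }
  | .seq f g => fun s => g.run (f.run s)
  | .ite e f g => fun s => if e.eval s ≠ 0 then f.run s.tick else g.run s.tick
  | .loop e f => fun s => f.run^[e.eval s] s.tick

theorem Prog.Classical.exec_eq {p : Prog P} (hp : p.Classical) (acc : Cell → Prop) (s : Memory) :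
    p.exec acc s = pure (p.run s) := by
  induction p generalizing s with
  | skip | store a e | emit a e => rfl
  | gate g a | measure κ q a => exact hp.elim
  | seq f g ihf ihg =>
    change f.exec acc s >>= g.exec acc = _
    rw [ihf hp.1, pure_bind_eq, ihg hp.2]
    rfl
  | ite e f g ihf ihg =>
    simp only [exec, run, ihf hp.1, ihg hp.2]
    split_ifs <;> rfl
  | loop e f ih =>
    have h : ∀ n s, iter (f.exec acc) n s = pure (f.run^[n] s) := by
      intro n
      induction n with
      | zero => intro s; rfl
      | succ n ihn =>
        intro s
        change f.exec acc s >>= iter (f.exec acc) n = _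
        rw [ih hp, pure_bind_eq, ihn]
        rfl
    exact h _ _

theorem iterate_invariant {α : Type} {f : α → α} (I : ℕ → α → Prop) (n : ℕ)
    (h : ∀ i < n, ∀ s, I i s → I (i + 1) (f s)) {s : α} (h0 : I 0 s) : I n (f^[n] s) := by
  induction n with
  | zero => exact h0
  | succ n ih =>
    rw [Function.iterate_succ_apply']
    exact h n (by omega) _ (ih fun i hi => h i (by omega))

/-- Multiplication by a constant. -/
def Expr.mulConst : ℕ → Expr → Expr
  | 0, _ => .const 0
  | n + 1, e => .add (mulConst n e) e

@[simp] theorem Expr.eval_mulConst (s : Memory) (n : ℕ) (e : Expr) :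
    (mulConst n e).eval s = n * e.eval s := by
  induction n with
  | zero => simp [mulConst, Expr.eval]
  | succ n ih => simp only [mulConst, Expr.eval, ih]; ring

/-- The variable stored in the work array at address `i`. -/
abbrev Expr.var (i : ℕ) : Expr := .work (.const i)

theorem packet_of_lt {l : List ℕ} {b : ℕ → ℕ} {i : ℕ} (h : i < l.length) :
    packet l b i = l.getD i 0 := if_pos h

theorem packet_length_add {l : List ℕ} {b : ℕ → ℕ} (i : ℕ) :
    packet l b (l.length + i) = b i := by
  simp [packet]

end Execution

/-! ### The programs of the attack -/

section Programs

variable {P : Params}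

/-- The ballot states with numbers below `N` are the corrupted ones; all states `D₂` are
prepared honestly. -/
def firstHonest (P : Params) : Kind → ℕ
  | .ballot => P.N
  | .index => 0

/-- Address in the work array of the mark of the `j`-th state of kind `κ`, which is set when the
state is tested. The addresses below `5` hold, in this order, the number `2 ^ δ`, the loop
counter, the number of selected states, the guess, and the last measurement result. -/
def markAddr (κ : Kind) (j : ℕ) : ℕ := 5 + κ.code + j + j

theorem markAddr_inj {κ κ' : Kind} {j j' : ℕ} :
    markAddr κ j = markAddr κ' j' ↔ κ = κ' ∧ j = j' := by
  cases κ <;> cases κ' <;> simp [markAddr, Kind.code] <;> omega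

theorem five_le_markAddr (κ : Kind) (j : ℕ) : 5 ≤ markAddr κ j := by
  unfold markAddr
  omega

/-- The address of the mark of the state whose number is the loop counter; the first entry of
the input is the code of its kind. -/
def markExpr : Expr :=
  .add (.add (.add (.const 5) (.inp (.const 0))) (.var 1)) (.var 1)

def stepProg : Prog P := .store (.const 1) (.add (.var 1) (.const 1))

/-- Output of the values of `f` below `n`. -/
def emitTable (f : ℕ → ℕ) : ℕ → Prog P
  | 0 => .skip
  | n + 1 => .seq (emitTable f n) (.emit (.const n) (.const (f n)))

/-- Voter `1` votes `1` and all others vote `0`; the permutation exchanges the voters `1` and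
`2`; the distributor is corrupted. -/
def choiceTable (P : Params) (i : ℕ) : ℕ :=
  if i = 1 ∨ i = P.N + 2 ∨ i = 2 * P.N then 1
  else if i = P.N + 1 then 2
  else if P.N ≤ i ∧ i < 2 * P.N then i - P.N
  else 0

def chooseProg (P : Params) : Prog P :=
  .seq (.store (.const 0) (.const 1)) <|
  .seq (.loop (.inp (.const 0)) (.store (.const 0) (.add (.var 0) (.var 0)))) <|
  emitTable (choiceTable P) (3 * P.N)

def prepareBody (P : Params) (κ : Kind) : Prog P :=
  .seq (.gate (preparationGate P κ)
    fun i => .add (.mulConst P.N (.var 1)) (.const (show Fin P.N from i).val)) stepProg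

def prepareKind (P : Params) (κ : Kind) : Prog P :=
  .seq (.store (.const 1) (.const (firstHonest P κ))) <|
  .loop (.add (.const (kept P κ - firstHonest P κ)) (.mulConst P.N (.var 0))) (prepareBody P κ)

/-- Preparation of the honest states; the corrupted ones remain `|0⟩ ⋯ |0⟩`. -/
def prepareProg (P : Params) : Prog P :=
  .seq (prepareKind P .ballot) (prepareKind P .index)

/-- If the state whose number is the loop counter is unmarked, it is selected: for the
computational basis until `2 ^ δ / 2` states have been selected, and then for the Fourier basis. -/
def selectBody (P : Params) : Prog P :=
  .seq (.ite (.work markExpr) .skip <|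
    .seq (.ite (.sub (.div (.var 0) (.const 2)) (.var 2))
      (.emit (.var 1) (.const 1)) (.emit (.var 1) (.const 2))) <|
    .store (.const 2) (.add (.var 2) (.const 1))) stepProg

/-- In all rounds but the last one, an empty selection, which aborts the protocol. In the last
round, the selection of all untested states but the first `kept P κ` ones. -/
def selectProg (P : Params) : Prog P :=
  .ite (.sub (.const (P.N - 1)) (.inp (.const 1))) .skip <|
  .seq (.ite (.inp (.const 0)) (.store (.const 1) (.const 1)) (.store (.const 1) (.const P.N))) <|
  .seq (.store (.const 2) (.const 0)) <|
  .loop (.mulConst P.N (.var 0)) (selectBody P)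

/-- The test of one state by the distributor, whose qudit in the `j`-th state has number `j * N`.
The entry `3 + j` of the input is `1` for the computational and `2` for the Fourier basis. -/
def announceState (P : Params) (κ : Kind) : Prog P :=
  .seq (.ite (.sub (.inp (.add (.const 3) (.var 1))) (.const 1))
    (.gate (fourierGate P κ) fun _ => .mulConst P.N (.var 1)) .skip) <|
  .seq (.measure κ (.mulConst P.N (.var 1)) (.const 4)) <|
  .seq (.emit (.mulConst P.N (.var 1)) (.var 4)) <|
  .store markExpr (.const 1)

def announceBody (P : Params) (κ : Kind) : Prog P :=
  .seq (.ite (.inp (.add (.const 3) (.var 1))) (announceState P κ) .skip) stepProg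

def announceKind (P : Params) (κ : Kind) : Prog P :=
  .loop (.add (.const (kept P κ)) (.mulConst P.N (.var 0))) (announceBody P κ)

/-- The corrupted distributor measures its qudits as prescribed and announces the results. -/
def announceProg (P : Params) : Prog P :=
  .seq (.store (.const 1) (.const 0)) <|
  .ite (.inp (.const 0)) (announceKind P .index) (announceKind P .ballot)

/-- The sum of the first `n` entries of the column in the input. -/
def columnSum : ℕ → Expr
  | 0 => .const 0
  | n + 1 => .add (columnSum n) (.inp (.const (1 + n)))

/-- The program sets the guess to `1` if the column of voter `1` consists of zeros, which means,
for a blank ballot of zeros, that the voter voted `0`, as in the world `β = true`. The test for the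
number of the voter is `< 2`, since the distributor, voter `0`, is corrupted. -/
def receiveProg (P : Params) : Prog P :=
  .ite (.sub (.const 2) (.inp (.const 0)))
    (.store (.const 3) (.sub (.const 1) (columnSum P.N))) .skip

/-- The attack of a corrupted distributor who prepares computational basis vectors instead of
the first `N` states `D₁`. -/
def attacker (P : Params) : Adversary P where
  choose := chooseProg P
  prepare := prepareProg P
  select := selectProg P
  announce := announceProg P
  hear := .skip
  corrupt := .skip
  receive := receiveProg P
  cast := .skip
  guess := .emit (.const 0) (.var 3)

end Programs

/-! ### The classical part of the attack -/

section ClassicalPrograms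

variable {P : Params}

theorem classical_emitTable (f : ℕ → ℕ) : ∀ n, (emitTable f n : Prog P).Classical
  | 0 => trivial
  | n + 1 => ⟨classical_emitTable f n, trivial⟩

theorem run_emitTable (f : ℕ → ℕ) (n : ℕ) (s : Memory) :
    ((emitTable f n : Prog P).run s).work = s.work ∧
    ((emitTable f n : Prog P).run s).time = s.time + n + 1 ∧
    ∀ i, ((emitTable f n : Prog P).run s).out i = if i < n then f i else s.out i := by
  induction n with
  | zero => simp [emitTable, Prog.run, Memory.tick]
  | succ n ih =>
    obtain ⟨h1, h2, h3⟩ := ih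
    refine ⟨by simp [emitTable, Prog.run, Memory.tick, h1],
      by simp [emitTable, Prog.run, Memory.tick, h2]; omega, fun i => ?_⟩
    simp only [emitTable, Prog.run, Memory.tick, Expr.eval]
    by_cases hi : i = n
    · subst hi
      simp
    · rw [Function.update_of_ne hi, h3]
      by_cases h : i < n
      · rw [if_pos h, if_pos (by omega)]
      · rw [if_neg h, if_neg (by omega)]

theorem classical_chooseProg (P : Params) : (chooseProg P).Classical :=
  ⟨trivial, trivial, classical_emitTable _ _⟩

theorem run_chooseProg (P : Params) (δ : ℕ) {s : Memory} (hi : s.inp 0 = δ) :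
    ((chooseProg P).run s).work = Function.update s.work 0 (2 ^ δ) ∧
    ((chooseProg P).run s).time = s.time + δ + 3 * P.N + 3 ∧
    ∀ i < 3 * P.N, ((chooseProg P).run s).out i = choiceTable P i := by
  let f : Memory → Memory :=
    (Prog.store (P := P) (.const 0) (.add (.var 0) (.var 0))).run
  let s₀ : Memory := (Prog.store (P := P) (.const 0) (.const 1)).run s
  have h := iterate_invariant (f := f) (s := s₀.tick)
    (fun i s' => s'.work = Function.update s.work 0 (2 ^ i) ∧ s'.time = s.time + i + 2) δ
    (fun i _ s' hs' => by
      refine ⟨?_, by simp [f, Prog.run, Memory.tick, hs'.2]; omega⟩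
      simp only [f, Prog.run, Memory.tick, Expr.eval, hs'.1]
      funext a
      by_cases ha : a = 0
      · subst ha
        simp
        ring
      · simp [ha])
    (by simp [s₀, Prog.run, Memory.tick, Expr.eval])
  have hrun : (chooseProg P).run s = (emitTable (choiceTable P) (3 * P.N) : Prog P).run
      (f^[δ] s₀.tick) := by
    rw [← hi]
    rfl
  obtain ⟨h1, h2, h3⟩ := run_emitTable (P := P) (choiceTable P) (3 * P.N) (f^[δ] s₀.tick)
  rw [hrun]
  exact ⟨by rw [h1, h.1], by rw [h2, h.2]; omega, fun i hi' => by rw [h3, if_pos hi']⟩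

theorem classical_selectProg (P : Params) : (selectProg P).Classical := by
  simp [selectProg, selectBody, stepProg, Prog.Classical]

theorem classical_receiveProg (P : Params) : (receiveProg P).Classical := by
  simp [receiveProg, Prog.Classical]

theorem eval_columnSum (s : Memory) (n : ℕ) :
    (columnSum n).eval s = ∑ i ∈ Finset.range n, s.inp (1 + i) := by
  induction n with
  | zero => rfl
  | succ n ih => rw [Finset.sum_range_succ, ← ih]; rfl

theorem run_receiveProg (P : Params) (s : Memory) :
    ((receiveProg P).run s).out = s.out ∧ ((receiveProg P).run s).work 3 =
      if s.inp 0 < 2 then 1 - ∑ i ∈ Finset.range P.N, s.inp (1 + i) else s.work 3 := by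
  have h1 : s.tick.inp = s.inp := rfl
  by_cases h : s.inp 0 < 2
  · have h' : 2 - s.inp 0 ≠ 0 := by omega
    simp [receiveProg, Prog.run, Expr.eval, h, h', Memory.tick, eval_columnSum]
  · have h' : 2 - s.inp 0 = 0 := by omega
    simp [receiveProg, Prog.run, Expr.eval, h, h', Memory.tick]

theorem total_eq (P : Params) (δ : ℕ) (κ : Kind) : total P δ κ = kept P κ + P.N * 2 ^ δ := rfl

theorem run_selectProg_of_lt {κ : Kind} {r v : ℕ} (hr : r + 1 < P.N) {s : Memory}
    (hi : s.inp = packet [κ.code, r, v] fun _ => 0) :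
    (selectProg P).run s = s.tick.tick := by
  have h1 : s.inp 1 = r := by rw [hi]; rfl
  have h2 : P.N - 1 - r ≠ 0 := by omega
  simp [selectProg, Prog.run, Expr.eval, h1, h2]

theorem eval_markExpr {s : Memory} {κ : Kind} (h : s.inp 0 = κ.code) :
    markExpr.eval s = markAddr κ (s.work 1) := by
  simp [markExpr, Expr.eval, h, markAddr]

theorem run_selectProg {δ : ℕ} {κ : Kind} {r v : ℕ} (hr : r + 1 = P.N) {s : Memory}
    (hi : s.inp = packet [κ.code, r, v] fun _ => 0) (ho : s.out = fun _ => 0)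
    (hM : s.work 0 = 2 ^ δ) :
    (∀ a, a ≠ 1 → a ≠ 2 → ((selectProg P).run s).work a = s.work a) ∧
    (∀ j, ((selectProg P).run s).out j ≠ 0 ↔
      kept P κ ≤ j ∧ j < total P δ κ ∧ s.work (markAddr κ j) = 0) ∧
    (∀ j, ((selectProg P).run s).out j ≤ 2) ∧
    ((Finset.range (total P δ κ)).filter fun j => ((selectProg P).run s).out j = 1).card =
      min ((Finset.range (total P δ κ)).filter fun j => ((selectProg P).run s).out j ≠ 0).card
        (2 ^ δ / 2) := by
  have h0 : s.inp 0 = κ.code := by rw [hi]; rfl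
  have h1 : s.inp 1 = r := by rw [hi]; rfl
  have h2 : P.N - 1 - r = 0 := by omega
  let s₁ : Memory := ((Prog.store (.const 2) (.const 0) : Prog P).run
    ((Prog.ite (.inp (.const 0)) (.store (.const 1) (.const 1))
      (.store (.const 1) (.const P.N)) : Prog P).run s.tick)).tick
  have hrun : (selectProg P).run s = (selectBody P).run^[P.N * 2 ^ δ] s₁ := by
    have h3 : s₁.work 0 = 2 ^ δ := by
      rw [← hM]
      cases κ <;> simp [s₁, Prog.run, Memory.tick, Expr.eval, h0, Kind.code]
    rw [← h3, selectProg]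
    simp only [Prog.run, Expr.eval, Memory.tick, h1, h2, ne_eq, not_true_eq_false, if_false,
      Expr.eval_mulConst]
    rfl
  let T := total P δ κ
  have key := iterate_invariant (f := (selectBody P).run) (s := s₁)
    (fun i s' => s'.inp = s.inp ∧ s'.work 1 = kept P κ + i ∧
      (∀ a, a ≠ 1 → a ≠ 2 → s'.work a = s.work a) ∧
      (∀ j, s'.out j ≠ 0 ↔ kept P κ ≤ j ∧ j < kept P κ + i ∧ s.work (markAddr κ j) = 0) ∧
      (∀ j, s'.out j ≤ 2) ∧
      s'.work 2 = ((Finset.range T).filter fun j => s'.out j ≠ 0).card ∧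
      ((Finset.range T).filter fun j => s'.out j = 1).card = min (s'.work 2) (2 ^ δ / 2))
    (P.N * 2 ^ δ) ?_ ?_
  · rw [← hrun] at key
    obtain ⟨-, -, k3, k4, k5, k6, k7⟩ := key
    refine ⟨k3, k4, k5, ?_⟩
    rw [k7, k6]
  · rintro i hiT s' ⟨k1, k2, k3, k4, k5, k6, k7⟩
    have hmark : markExpr.eval s'.tick = markAddr κ (kept P κ + i) := by
      rw [eval_markExpr (κ := κ) (by rw [← h0, ← k1]; rfl), ← k2]
      rfl
    have h5 := five_le_markAddr κ (kept P κ + i)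
    have hval : s'.work (markAddr κ (kept P κ + i)) = s.work (markAddr κ (kept P κ + i)) :=
      k3 _ (by omega) (by omega)
    have hmark' : markExpr.eval s' = markAddr κ (kept P κ + i) := hmark
    have hjT : kept P κ + i ∈ Finset.range T := by
      simp only [T, total_eq, Finset.mem_range]
      omega
    have hout : s'.out (kept P κ + i) = 0 := by
      by_contra h
      have := ((k4 _).1 h).2.1
      omega
    by_cases hm : s.work (markAddr κ (kept P κ + i)) = 0
    · -- The state is selected with value `b`.
      obtain ⟨b, hb, hb1, hs'⟩ : ∃ b, (b = 1 ∨ b = 2) ∧ (b = 1 ↔ s'.work 2 < 2 ^ δ / 2) ∧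
          (((selectBody P).run s').inp = s'.inp ∧
          ((selectBody P).run s').out = Function.update s'.out (kept P κ + i) b ∧
          ((selectBody P).run s').work = Function.update (Function.update s'.work 2
            (s'.work 2 + 1)) 1 (kept P κ + i + 1)) := by
        have hM' : s'.work 0 = 2 ^ δ := by rw [k3 0 (by omega) (by omega), hM]
        by_cases hlt : s'.work 2 < 2 ^ δ / 2
        · have hlt' : 2 ^ δ / 2 - s'.work 2 ≠ 0 := by omega
          refine ⟨1, Or.inl rfl, by simp [hlt], ?_⟩
          simp [selectBody, stepProg, Prog.run, Expr.eval, Memory.tick, hmark', hval, hm, hM',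
            hlt', k2]
        · have hlt' : 2 ^ δ / 2 - s'.work 2 = 0 := by omega
          refine ⟨2, Or.inr rfl, by simp [hlt], ?_⟩
          simp [selectBody, stepProg, Prog.run, Expr.eval, Memory.tick, hmark', hval, hm, hM',
            hlt', k2]
      obtain ⟨e1, e2, e3⟩ := hs'
      have hb0 : b ≠ 0 := by omega
      have hne : (Finset.range T).filter
          (fun j => Function.update s'.out (kept P κ + i) b j ≠ 0) =
          insert (kept P κ + i) ((Finset.range T).filter fun j => s'.out j ≠ 0) := by
        ext j
        by_cases hj : j = kept P κ + i
        · subst hj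
          simp [hb0, Finset.mem_range.1 hjT]
        · simp [hj]
      refine ⟨by rw [e1, k1], by simp [e3]; omega, fun a ha1 ha2 => ?_, fun j => ?_, fun j => ?_,
        ?_, ?_⟩
      · rw [e3, Function.update_of_ne ha1, Function.update_of_ne ha2, k3 a ha1 ha2]
      · rw [e2]
        by_cases hj : j = kept P κ + i
        · subst hj
          simp [hb0, hm]
        · rw [Function.update_of_ne hj, k4]
          have : j < kept P κ + i ↔ j < kept P κ + (i + 1) := by omega
          rw [this]
      · rw [e2]
        by_cases hj : j = kept P κ + i
        · subst hj
          rw [Function.update_self]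
          omega
        · rw [Function.update_of_ne hj]
          exact k5 j
      · rw [e2, e3, hne, Finset.card_insert_of_notMem (by simp [hout]), ← k6]
        simp
      · rw [e2, e3]
        have hw : Function.update (Function.update s'.work 2 (s'.work 2 + 1)) 1
            (kept P κ + i + 1) 2 = s'.work 2 + 1 := by simp
        rw [hw]
        rcases hb with rfl | rfl
        · have heq : (Finset.range T).filter
              (fun j => Function.update s'.out (kept P κ + i) 1 j = 1) =
              insert (kept P κ + i) ((Finset.range T).filter fun j => s'.out j = 1) := by
            ext j
            by_cases hj : j = kept P κ + i
            · subst hj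
              simp [Finset.mem_range.1 hjT]
            · simp [hj]
          rw [heq, Finset.card_insert_of_notMem (by simp [hout]), k7]
          have := hb1.1 rfl
          omega
        · have heq : (Finset.range T).filter
              (fun j => Function.update s'.out (kept P κ + i) 2 j = 1) =
              (Finset.range T).filter fun j => s'.out j = 1 := by
            ext j
            by_cases hj : j = kept P κ + i
            · subst hj
              simp [hout]
            · simp [hj]
          rw [heq, k7]
          have : ¬ s'.work 2 < 2 ^ δ / 2 := fun h => by simpa using hb1.2 h
          omega
    · have hs' : ((selectBody P).run s').inp = s'.inp ∧ ((selectBody P).run s').out = s'.out ∧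
          ((selectBody P).run s').work = Function.update s'.work 1 (kept P κ + i + 1) := by
        simp [selectBody, stepProg, Prog.run, Expr.eval, Memory.tick, hmark', hval, hm, k2]
      obtain ⟨e1, e2, e3⟩ := hs'
      have hw : Function.update s'.work 1 (kept P κ + i + 1) 2 = s'.work 2 := by simp
      rw [e1, e2, e3, hw]
      refine ⟨k1, by simp; omega, fun a ha1 ha2 => ?_, fun j => ?_, k5, k6, k7⟩
      · rw [Function.update_of_ne ha1, k3 a ha1 ha2]
      · rw [k4]
        by_cases hj : j = kept P κ + i
        · subst hj
          simp [hm]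
        · have : j < kept P κ + i ↔ j < kept P κ + (i + 1) := by omega
          rw [this]
  · have e1 : s₁.inp = s.inp := by
      cases κ <;> simp [s₁, Prog.run, Memory.tick, Expr.eval, h0, Kind.code]
    have e2 : s₁.out = fun _ => 0 := by
      cases κ <;> simp [s₁, Prog.run, Memory.tick, Expr.eval, h0, Kind.code, ho]
    have e3 : s₁.work = Function.update (Function.update s.work 1 (kept P κ)) 2 0 := by
      cases κ <;> simp [s₁, Prog.run, Memory.tick, Expr.eval, h0, Kind.code, kept]
    rw [e1, e2, e3]
    refine ⟨rfl, by simp, fun a ha1 ha2 => by simp [ha1, ha2], fun j => ?_, by simp, by simp,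
      by simp⟩
    simp only [ne_eq, not_true_eq_false, false_iff]
    omega

end ClassicalPrograms

/-! ### The quantum part of the attack -/

section Tame

variable {P : Params}

/-- A bound for the number of repetitions of the loops of the attack. -/
def loopBound (P : Params) (δ : ℕ) : ℕ := P.N + 1 + P.N * 2 ^ δ

theorem total_le_loopBound (P : Params) (δ : ℕ) (κ : Kind) : total P δ κ ≤ loopBound P δ := by
  have := P.N_pos
  cases κ <;> simp only [total, kept, loopBound] <;> omega

theorem tame_stepProg (M L : ℕ) : (stepProg : Prog P).Tame M L := fun _ => one_ne_zero

theorem eval_markExpr_ne_zero (s : Memory) : markExpr.eval s ≠ 0 := by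
  simp only [markExpr, Expr.eval]
  omega

theorem tame_prepareProg (P : Params) (δ : ℕ) :
    (prepareProg P).Tame (2 ^ δ) (loopBound P δ) := by
  have h : ∀ κ, (prepareKind P κ).Tame (2 ^ δ) (loopBound P δ) := fun κ => by
    refine ⟨fun _ => one_ne_zero, fun s hs => ?_, trivial, tame_stepProg _ _⟩
    have := total_le_loopBound P δ κ
    simp only [Expr.eval, Expr.eval_mulConst, hs, total_eq] at this ⊢
    omega
  exact ⟨h _, h _⟩

theorem tame_selectProg (P : Params) (δ : ℕ) :
    (selectProg P).Tame (2 ^ δ) (loopBound P δ) := by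
  refine ⟨trivial, ⟨fun _ => one_ne_zero, fun _ => one_ne_zero⟩, fun _ => two_ne_zero,
    fun s hs => ?_, ⟨trivial, ⟨trivial, trivial⟩, fun _ => two_ne_zero⟩, tame_stepProg _ _⟩
  simp only [Expr.eval, Expr.eval_mulConst, hs, loopBound]
  omega

theorem tame_announceProg (P : Params) (δ : ℕ) :
    (announceProg P).Tame (2 ^ δ) (loopBound P δ) := by
  have h : ∀ κ, (announceKind P κ).Tame (2 ^ δ) (loopBound P δ) := fun κ => by
    refine ⟨fun s hs => ?_, ⟨⟨⟨trivial, trivial⟩, fun _ => four_ne_zero, trivial,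
      eval_markExpr_ne_zero⟩, trivial⟩, tame_stepProg _ _⟩
    have := total_le_loopBound P δ κ
    simp only [Expr.eval, Expr.eval_mulConst, hs, total_eq] at this ⊢
    omega
  exact ⟨fun _ => one_ne_zero, h _, h _⟩

theorem tame_receiveProg (P : Params) (δ : ℕ) :
    (receiveProg P).Tame (2 ^ δ) (loopBound P δ) := ⟨fun _ => three_ne_zero, trivial⟩

end Tame

section Execution

variable {P : Params} {acc : Cell → Prop} {s : Memory} {ψ : QState P}

theorem Ensures.seq {f g : Prog P} {Q R : Memory → QState P → Prop}
    (hf : Ensures (f.exec acc s) ψ Q) (hg : ∀ s' φ, Q s' φ → Ensures (g.exec acc s') φ R) :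
    Ensures ((Prog.seq f g).exec acc s) ψ R := hf.bind hg

theorem Ensures.store {a e : Expr} : Ensures ((Prog.store a e : Prog P).exec acc s) ψ
    fun s' φ => s' = { s.tick with work := Function.update s.work (a.eval s) (e.eval s) } ∧
      φ = ψ := Ensures.pure ⟨rfl, rfl⟩

theorem Ensures.emit {a e : Expr} : Ensures ((Prog.emit a e : Prog P).exec acc s) ψ
    fun s' φ => s' = { s.tick with out := Function.update s.out (a.eval s) (e.eval s) } ∧
      φ = ψ := Ensures.pure ⟨rfl, rfl⟩

theorem Ensures.skip : Ensures ((Prog.skip : Prog P).exec acc s) ψ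
    fun s' φ => s' = s.tick ∧ φ = ψ := Ensures.pure ⟨rfl, rfl⟩

theorem Ensures.progIte {e : Expr} {f g : Prog P} {Q : Memory → QState P → Prop}
    (hf : e.eval s ≠ 0 → Ensures (f.exec acc s.tick) ψ Q)
    (hg : e.eval s = 0 → Ensures (g.exec acc s.tick) ψ Q) :
    Ensures ((Prog.ite e f g).exec acc s) ψ Q :=
  Ensures.ite hf fun h => hg (not_not.1 h)

theorem Ensures.loop {e : Expr} {f : Prog P} (I : ℕ → Memory → QState P → Prop) {n : ℕ}
    (hn : e.eval s = n) (h : ∀ i < n, ∀ s' φ, I i s' φ → Ensures (f.exec acc s') φ (I (i + 1)))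
    (h0 : I 0 s.tick ψ) : Ensures ((Prog.loop e f).exec acc s) ψ (I n) := by
  subst hn
  exact Ensures.iter I _ h h0

theorem Ensures.measure {κ : Kind} {q a : Expr} (h : acc (κ, q.eval s)) :
    Ensures ((Prog.measure κ q a : Prog P).exec acc s) ψ fun s' φ =>
      ∃ v : Fin (P.dim κ),
        s' = { s.tick with work := Function.update s.work (a.eval s) v.val } ∧
        φ = ψ.filter fun x => x (κ, q.eval s) = v :=
  Ensures.ite (fun _ => (Ensures.measureComp (κ, q.eval s) ψ).bind fun v _ hφ =>
    Ensures.pure ⟨v, rfl, hφ⟩) fun h' => absurd h h'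

end Execution

section Preparation

variable {P : Params}

/-- The states of kind `κ` with numbers from `firstHonest P κ` to `n κ` have been prepared, and
all other qudits of the protocol are in state `|0⟩`. -/
def Prepared (n : Kind → ℕ) (ψ : QState P) : Prop :=
  (∀ κ j, firstHonest P κ ≤ j → j < n κ → HasFactor κ j (amplitude P κ) ψ) ∧
  ∀ κ j (k : Fin P.N), j < firstHonest P κ ∨ n κ ≤ j → LabelZero (slot κ j k) ψ

theorem prepared_zeroState : Prepared (firstHonest P) (zeroState P) := by
  refine ⟨fun κ j h h' => by omega, fun κ j k _ x hx => ?_⟩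
  rw [zeroState, Finsupp.single_apply] at hx
  have : (fun q : Cell => P.toLabel q.1 0) = x := by
    by_contra h
    exact hx (if_neg h)
  rw [← this]

theorem Prepared.step {n : Kind → ℕ} {ψ : QState P} (h : Prepared n ψ) {κ : Kind}
    (hn : firstHonest P κ ≤ n κ) : Prepared (Function.update n κ (n κ + 1))
      (applyOp (preparationGate P κ).kinds (fun i => (particle P κ (n κ) i).2)
        (preparationGate P κ).mat ψ) := by
  have hinj : Function.Injective fun i => (((preparationGate P κ).kinds i,
      (particle P κ (n κ) i).2) : Cell) := injective_slot κ (n κ)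
  have hne : ∀ κ' j (k : Fin P.N), ¬ (κ' = κ ∧ j = n κ) → ∀ i,
      slot κ' j k ≠ ((preparationGate P κ).kinds i, (particle P κ (n κ) i).2) :=
    fun κ' j k h' i he => h' <|
      ((slot_inj (κ' := κ) (j' := n κ) (k' := i)).1 he).imp_right And.left
  refine ⟨fun κ' j hj hj' => ?_, fun κ' j k hj => ?_⟩
  · by_cases he : κ' = κ ∧ j = n κ
    · obtain ⟨rfl, rfl⟩ := he
      exact applyOp_preparationGate fun k => h.2 κ' _ k (Or.inr le_rfl)
    · refine (h.1 κ' j hj ?_).applyOp_of_ne hinj _ fun i k => (hne κ' j k he i).symm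
      by_cases hκ : κ' = κ
      · subst hκ
        rw [Function.update_self] at hj'
        have : j ≠ n κ' := fun h' => he ⟨rfl, h'⟩
        omega
      · rwa [Function.update_of_ne hκ] at hj'
  · have he : ¬ (κ' = κ ∧ j = n κ) := by
      rintro ⟨rfl, rfl⟩
      rw [Function.update_self] at hj
      omega
    refine (h.2 κ' j k (hj.imp_right fun h' => ?_)).applyOp hinj _ (hne κ' j k he)
    by_cases hκ : κ' = κ
    · subst hκ
      rw [Function.update_self] at h'
      omega
    · rwa [Function.update_of_ne hκ] at h'

theorem ensures_prepareKind {δ : ℕ} {n : Kind → ℕ} {κ : Kind} {s : Memory} {ψ : QState P}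
    (hs : s.work 0 = 2 ^ δ) (hn : n κ = firstHonest P κ) (h : Prepared n ψ) :
    Ensures ((prepareKind P κ).exec (fun _ => True) s) ψ fun s' φ =>
      Prepared (Function.update n κ (total P δ κ)) φ ∧ ∀ a, a ≠ 1 → s'.work a = s.work a := by
  refine Ensures.store.seq ?_
  rintro s₁ _ ⟨rfl, rfl⟩
  have hlast : firstHonest P κ + (total P δ κ - firstHonest P κ) = total P δ κ := by
    have := P.N_pos
    cases κ <;> simp only [firstHonest, total, kept] <;> omega
  refine (Ensures.loop (fun i s' φ => s'.work 1 = firstHonest P κ + i ∧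
      Prepared (Function.update n κ (firstHonest P κ + i)) φ ∧
      ∀ a, a ≠ 1 → s'.work a = s.work a) (n := total P δ κ - firstHonest P κ) ?_ ?_ ?_).mono ?_
  · simp only [Expr.eval, Expr.eval_mulConst, Memory.tick]
    rw [Function.update_of_ne (by omega), hs]
    cases κ <;> simp [firstHonest, total, kept]
  · rintro i - s' φ ⟨h1, h2, h3⟩
    refine Ensures.gate.seq ?_
    rintro _ _ ⟨rfl, rfl⟩
    refine Ensures.store.mono ?_
    rintro _ _ ⟨rfl, rfl⟩
    have haddr : (fun k : Fin P.N => (Expr.add (.mulConst P.N (.var 1)) (.const k.val)).eval s') =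
        fun k => (particle P κ (firstHonest P κ + i) k).2 := by
      funext k
      simp only [Expr.eval, Expr.eval_mulConst, h1, particle]
      ring
    have haddr' := fun k => congrFun haddr k
    refine ⟨by simp [Expr.eval, Memory.tick, h1]; omega, ?_, fun a ha => ?_⟩
    · rw [if_pos]
      · have := h2.step (κ := κ) (by simp)
        rw [Function.update_self, Function.update_idem] at this
        exact haddr ▸ this
      · refine ⟨?_, fun _ => trivial⟩
        have : (fun k : Fin P.N =>
            ((κ, (Expr.add (.mulConst P.N (.var 1)) (.const k.val)).eval s') : Cell)) =
            fun k => slot κ (firstHonest P κ + i) k := funext fun k => by rw [haddr' k]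
        exact this ▸ injective_slot κ _
    · simp [Expr.eval, Memory.tick, ha, h3]
  · refine ⟨by simp [Memory.tick, Expr.eval], ?_, fun a ha => by
      simp [Memory.tick, Expr.eval, ha]⟩
    rwa [add_zero, ← hn, Function.update_eq_self]
  · rintro s' φ ⟨-, h2, h3⟩
    rw [hlast] at h2
    exact ⟨h2, h3⟩

end Preparation

/-! ### The measurements of the tests -/

section Tests

variable {P : Params}

/-- The states in `rest` are as they were prepared: honest states, or corrupted ballot states
`|0⟩ ⋯ |0⟩`. -/
def Untested (rest : Kind → Finset ℕ) (ψ : QState P) : Prop :=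
  (∀ κ, ∀ j ∈ rest κ, firstHonest P κ ≤ j → HasFactor κ j (amplitude P κ) ψ) ∧
  ∀ j ∈ rest .ballot, j < P.N → ∀ k : Fin P.N, LabelZero (slot .ballot j k) ψ

/-- The set `rest` after the tests `t` of states of kind `κ`. -/
def afterTests (rest : Kind → Finset ℕ) (κ : Kind) (t : Finset ℕ × Finset ℕ) :
    Kind → Finset ℕ := Function.update rest κ (rest κ \ (t.1 ∪ t.2))

/-- The joint state during the tests `t` of states of kind `κ`. The pairs of a state and a voter
in `D` have been measured, with the results `o`: the amplitudes of a tested honest state, written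
in the bases of the measurements made so far, are restricted to the strings that agree with
these results. -/
structure TestState (rest : Kind → Finset ℕ) (κ : Kind) (t : Finset ℕ × Finset ℕ)
    (D : Set (ℕ × Fin P.N)) (o : ℕ → Fin P.N → Fin (P.dim κ)) (ψ : QState P) : Prop where
  untested : Untested (afterTests rest κ t) ψ
  tested : ∀ j ∈ t.1 ∪ t.2, firstHonest P κ ≤ j → HasFactor κ j
    (fun y => if ∀ k, (j, k) ∈ D → y k = o j k then
      partialFourier P κ {k | j ∉ t.1 ∧ (j, k) ∈ D} y else 0) ψ

theorem mem_afterTests {rest : Kind → Finset ℕ} {κ κ' : Kind} {t : Finset ℕ × Finset ℕ} {j : ℕ} :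
    j ∈ afterTests rest κ t κ' ↔ j ∈ rest κ' ∧ ¬ (κ' = κ ∧ j ∈ t.1 ∪ t.2) := by
  unfold afterTests
  by_cases h : κ' = κ
  · subst h
    simp
  · simp [h]

theorem Untested.testState {rest : Kind → Finset ℕ} {κ : Kind} {t : Finset ℕ × Finset ℕ}
    {ψ : QState P} (h : Untested rest ψ) (ht : t.1 ∪ t.2 ⊆ rest κ)
    (o : ℕ → Fin P.N → Fin (P.dim κ)) : TestState rest κ t ∅ o ψ := by
  refine ⟨⟨fun κ' j hj => h.1 κ' j (mem_afterTests.1 hj).1,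
    fun j hj => h.2 j (mem_afterTests.1 hj).1⟩, fun j hj hj' => ?_⟩
  refine hasFactor_congr (h.1 κ j (ht hj) hj') fun y => ?_
  simp [partialFourier_empty]

variable {rest : Kind → Finset ℕ} {κ : Kind} {t : Finset ℕ × Finset ℕ} {D : Set (ℕ × Fin P.N)}
  {o : ℕ → Fin P.N → Fin (P.dim κ)} {ψ : QState P}

/-- The measurement of one more qudit. In the Fourier basis, it is a change of basis of this
qudit, which turns `partialFourier` for a set of voters into that for a set with one more voter,
followed by a measurement in the computational basis. -/
theorem TestState.measure (h : TestState rest κ t D o ψ) {j : ℕ} {k : Fin P.N}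
    (hj : j ∈ t.1 ∪ t.2) (hD : (j, k) ∉ D) (v : Fin (P.dim κ)) :
    TestState rest κ t (insert (j, k) D) (Function.update o j (Function.update (o j) k v))
      ((if j ∈ t.1 then ψ else fourierToComp (slot κ j k) ψ).filter
        fun x => x (slot κ j k) = v) := by
  have hk : ∀ l, (j, l) ∈ D → l ≠ k := fun l hl he => hD (he ▸ hl)
  have hother : ∀ (κ' : Kind) (j' : ℕ) (a : (Fin P.N → Fin (P.dim κ')) → ℂ),
      ¬ (κ' = κ ∧ j' = j) →
      HasFactor κ' j' a ψ → HasFactor κ' j' a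
        ((if j ∈ t.1 then ψ else fourierToComp (slot κ j k) ψ).filter
          fun x => x (slot κ j k) = v) := by
    intro κ' j' a hne ha
    have hq : ∀ l, slot κ j k ≠ slot κ' j' l := fun l he => by
      have := slot_inj.1 he
      exact hne ⟨this.1.symm, this.2.1.symm⟩
    refine HasFactor.filter_of_ne ?_ hq v
    split_ifs
    exacts [ha, ha.fourierToComp_of_ne hq]
  refine ⟨⟨fun κ' j' hj' hj'' => ?_, fun j' hj' hN l => ?_⟩, fun j' hj' hj'' => ?_⟩
  · exact hother _ _ _ (fun he => (mem_afterTests.1 hj').2 ⟨he.1, he.2 ▸ hj⟩)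
      (h.untested.1 κ' j' hj' hj'')
  · have hne : slot .ballot j' l ≠ slot κ j k := fun he => by
      have := slot_inj.1 he
      exact (mem_afterTests.1 hj').2 ⟨this.1, this.2.1 ▸ hj⟩
    have h0 := h.untested.2 j' hj' hN l
    refine LabelZero.filter ?_ _
    split_ifs
    exacts [h0, h0.fourierToComp hne]
  · by_cases hjj : j' = j
    · subst hjj
      have hf := h.tested j' hj' hj''
      by_cases ht1 : j' ∈ t.1
      · rw [if_pos ht1]
        refine hasFactor_congr (hf.filter_self k v) fun y => ?_
        simp only [ht1, not_true_eq_false, false_and, Set.ofPred_false, Function.update_self,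
          Set.mem_insert_iff, Prod.mk.injEq, true_and]
        rw [← ite_and]
        congr 1
        rw [eq_iff_iff]
        constructor
        · rintro ⟨h1, h2⟩ l (rfl | hl)
          · rw [Function.update_self, h1]
          · rw [Function.update_of_ne (hk l hl), h2 l hl]
        · intro h1
          refine ⟨by simpa using h1 k (Or.inl rfl), fun l hl => ?_⟩
          rw [h1 l (Or.inr hl), Function.update_of_ne (hk l hl)]
      · rw [if_neg ht1]
        refine hasFactor_congr ((hf.fourierToComp_self k).filter_self k v) fun y => ?_
        have hcond : ∀ z, (∀ l, (j', l) ∈ D → Function.update y k z l = o j' l) ↔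
            ∀ l, (j', l) ∈ D → y l = o j' l := fun z =>
          forall₂_congr fun l hl => by
            rw [Function.update_of_ne (hk l hl)]
        have hset : {l | j' ∉ t.1 ∧ (j', l) ∈ insert (j', k) D} =
            insert k {l | j' ∉ t.1 ∧ (j', l) ∈ D} := by
          ext l
          simp [ht1]
        rw [hset]
        have hcond' : (∀ l, (j', l) ∈ insert (j', k) D → y l =
            Function.update o j' (Function.update (o j') k v) j' l) ↔
            y k = v ∧ ∀ l, (j', l) ∈ D → y l = o j' l := by
          rw [Function.update_self]
          constructor
          · intro h1
            refine ⟨by simpa using h1 k (Set.mem_insert _ _), fun l hl => ?_⟩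
            rw [h1 l (Set.mem_insert_of_mem _ hl),
              Function.update_of_ne (hk l hl)]
          · rintro ⟨h1, h2⟩ l hl
            by_cases hlk : l = k
            · subst hlk
              rw [Function.update_self, h1]
            · rw [Function.update_of_ne hlk, h2 l (by simpa [hlk] using hl)]
        simp only [hcond, hcond']
        rw [← partialFourier_insert (fun hk => hD hk.2)]
        by_cases h1 : y k = v <;> by_cases h2 : ∀ l, (j', l) ∈ D → y l = o j' l <;>
          simp [h1, h2]
    · refine hasFactor_congr (hother κ j' _ (fun he => hjj he.2) (h.tested j' hj' hj''))
        fun y => ?_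
      simp [hjj]

/-- After all measurements of the tests, an honest state has passed its test. -/
theorem TestState.pass (hcm : P.c ∣ P.m) (h : TestState rest κ t D o ψ)
    (hD : ∀ j ∈ t.1 ∪ t.2, ∀ k, (j, k) ∈ D) (ht : Disjoint t.1 t.2)
    (hh : ∀ j ∈ t.1 ∪ t.2, firstHonest P κ ≤ j) (hψ : ψ ≠ 0) :
    (∀ j ∈ t.1, passComp P κ (o j)) ∧ ∀ j ∈ t.2, passFourier P κ (o j) := by
  obtain ⟨x, hx⟩ := Finsupp.ne_iff.1 hψ
  have key : ∀ j ∈ t.1 ∪ t.2, partialFourier P κ {k | j ∉ t.1 ∧ (j, k) ∈ D} (o j) ≠ 0 := by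
    intro j hj
    obtain ⟨χ, h1, -⟩ := h.tested j hj (hh j hj)
    have h2 : (fun y => if ∀ k, (j, k) ∈ D → y k = o j k then
        partialFourier P κ {k | j ∉ t.1 ∧ (j, k) ∈ D} y else 0)
        (fun k => x (slot κ j k)) ≠ 0 := fun h0 => hx (by rw [h1, h0, zero_mul]; rfl)
    beta_reduce at h2
    split_ifs at h2 with h3
    · have : (fun k => x (slot κ j k)) = o j := funext fun k => h3 k (hD j hj k)
      rwa [this] at h2
    · exact absurd rfl h2
  refine ⟨fun j hj => ?_, fun j hj => ?_⟩
  · have hj' := key j (Finset.mem_union_left _ hj)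
    have hset : {k | j ∉ t.1 ∧ (j, k) ∈ D} = ∅ := by simp [hj]
    rw [hset, partialFourier_empty] at hj'
    exact passComp_of_amplitude_ne_zero hj'
  · have hj' := key j (Finset.mem_union_right _ hj)
    have hset : {k | j ∉ t.1 ∧ (j, k) ∈ D} = Set.univ := by
      ext k
      simp [Finset.disjoint_right.1 ht hj, hD j (Finset.mem_union_right _ hj) k]
    rw [hset, partialFourier_univ] at hj'
    exact passFourier_of_fourierAmplitude_ne_zero hcm hj'

theorem TestState.ensures_measureTests {S : Finset (Fin P.N)} (h : TestState rest κ t D o ψ)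
    (hD : ∀ p ∈ D, p.2 ∈ S) :
    Ensures (measureTests S κ t o) ψ fun o' φ => TestState rest κ t
      (D ∪ {p | p.1 ∈ t.1 ∪ t.2 ∧ p.2 ∉ S}) o' φ := by
  unfold measureTests
  set l := (t.1 ∪ t.2).sort (· ≤ ·) ×ˢ (List.finRange P.N).filter (fun k => k ∉ S) with hl
  have hmem : ∀ p, p ∈ l ↔ p.1 ∈ t.1 ∪ t.2 ∧ p.2 ∉ S := fun p => by
    rw [hl, List.mem_product]
    simp
  have hnd : l.Nodup := List.Nodup.product (Finset.sort_nodup _ _)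
    ((List.nodup_finRange _).filter _)
  refine (Ensures.foldlM (fun l₁ o' φ => TestState rest κ t (D ∪ {p | p ∈ l₁}) o' φ) l ?_
    (by simpa using h)).mono fun o' φ h' => ?_
  · intro l₁ p l₂ hsplit o' φ h'
    have hp : p ∈ l := by rw [hsplit]; simp
    have hpl : p ∉ D ∪ {p | p ∈ l₁} := by
      rintro (h1 | h1)
      · exact ((hmem p).1 hp).2 (hD p h1)
      · rw [hsplit] at hnd
        exact (List.nodup_append.1 hnd).2.2 p h1 p (by simp) rfl
    have hstep := h'.measure (j := p.1) (k := p.2) ((hmem p).1 hp).1 hpl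
    have hins : insert p (D ∪ {p | p ∈ l₁}) = D ∪ {p' | p' ∈ l₁ ++ [p]} := by
      ext p'
      simp only [Set.mem_insert_iff, Set.mem_union, Set.mem_ofPred_eq, List.mem_append,
        List.mem_singleton]
      tauto
    rw [← hins]
    by_cases hp1 : p.1 ∈ t.1
    · simp only [hp1, if_true] at hstep ⊢
      exact (Ensures.measureComp (slot κ p.1 p.2) φ).bind fun v φ' hφ' => Ensures.pure (by
        rw [hφ']
        exact hstep v)
    · simp only [hp1, if_false] at hstep ⊢
      exact (Ensures.measureFourier (slot κ p.1 p.2) φ).bind fun v φ' hφ' => Ensures.pure (by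
        rw [hφ']
        exact hstep v)
  · have : {p | p ∈ l} = {p | p.1 ∈ t.1 ∪ t.2 ∧ p.2 ∉ S} := Set.ext hmem
    rwa [← this]

end Tests

section Announcement

variable {P : Params}

/-- Announcements of the corrupted distributor, as they are read off its output array. -/
def announced (P : Params) (κ : Kind) (out : ℕ → ℕ) (j : ℕ) (k : Fin P.N) : Fin (P.dim κ) :=
  P.toLabel κ (out (j * P.N + k))

theorem announced_update (κ : Kind) (out : ℕ → ℕ) (j : ℕ) (v : Fin (P.dim κ)) :
    announced P κ (Function.update out (j * P.N) v.val) =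
      Function.update (announced P κ out) j
        (Function.update (announced P κ out j) (distributor P) v) := by
  funext j' k
  by_cases h : j' = j ∧ k = distributor P
  · obtain ⟨rfl, rfl⟩ := h
    simp only [Function.update_self, announced, distributor, add_zero]
    exact Fin.ext (Nat.mod_eq_of_lt v.isLt)
  · have hne : j' * P.N + k.val ≠ j * P.N := fun he => h (by
      have := (slot_inj (P := P) (κ := .ballot) (κ' := .ballot) (j := j') (j' := j) (k := k)
        (k' := distributor P)).1 (Prod.ext rfl he)
      exact this.2)
    rw [announced, Function.update_of_ne hne]
    by_cases hj : j' = j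
    · subst hj
      rw [Function.update_self, Function.update_of_ne fun hk => h ⟨rfl, hk⟩]
      rfl
    · rw [Function.update_of_ne hj]
      rfl

theorem adversaryCell_distributor (δ : ℕ) (κ : Kind) (n : ℕ) :
    adversaryCell P δ {distributor P} (κ, P.N * n) :=
  Or.inr ⟨distributor P, by simp, by simp [distributor]⟩

theorem slot_distributor (κ : Kind) (j : ℕ) :
    slot κ j (distributor P) = (κ, P.N * j) := by
  simp [slot, particle, distributor, mul_comm]

variable {rest : Kind → Finset ℕ} {κ : Kind} {t : Finset ℕ × Finset ℕ} {D : Set (ℕ × Fin P.N)}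
  {ψ : QState P}

theorem TestState.ensures_announceState {δ : ℕ} {s : Memory} {l : List ℕ} (hl : l.length = 3)
    (hl0 : l.getD 0 0 = κ.code) (hi : s.inp = packet l (testCode t))
    (h : TestState rest κ t D (announced P κ s.out) ψ)
    (hj : s.work 1 ∈ t.1 ∪ t.2) (hD : (s.work 1, distributor P) ∉ D) :
    Ensures ((announceState P κ).exec (adversaryCell P δ {distributor P}) s) ψ fun s' φ =>
      TestState rest κ t (insert (s.work 1, distributor P) D) (announced P κ s'.out) φ ∧
      s'.inp = s.inp ∧ ∃ v, s'.work =
        Function.update (Function.update s.work 4 v) (markAddr κ (s.work 1)) 1 := by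
  set j := s.work 1 with hjdef
  have hinp : ∀ i, s.inp (3 + i) = testCode t i := fun i => by
    rw [hi, ← hl, packet_length_add]
  have hinp0 : s.inp 0 = κ.code := by rw [hi, packet_of_lt (by omega), hl0]
  have hcode : s.inp (3 + j) - 1 = 0 ↔ j ∈ t.1 := by
    rw [hinp, testCode]
    rcases Finset.mem_union.1 hj with h1 | h2
    · simp [h1]
    · by_cases h1 : j ∈ t.1 <;> simp [h1, h2]
  have heval : (Expr.sub (.inp (.add (.const 3) (.var 1))) (.const 1)).eval s =
      s.inp (3 + j) - 1 := rfl
  have h1 : Ensures ((Prog.ite (.sub (.inp (.add (.const 3) (.var 1))) (.const 1))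
      (.gate (fourierGate P κ) fun _ => .mulConst P.N (.var 1)) .skip : Prog P).exec
        (adversaryCell P δ {distributor P}) s) ψ fun s' φ =>
      (s'.inp = s.inp ∧ s'.work = s.work ∧ s'.out = s.out) ∧
      φ = if j ∈ t.1 then ψ else fourierToComp (slot κ j (distributor P)) ψ := by
    refine Ensures.progIte (fun h1 => ?_) fun h1 => ?_
    · rw [heval, Ne, hcode] at h1
      refine Ensures.gate.mono ?_
      rintro s' φ ⟨rfl, rfl⟩
      refine ⟨⟨rfl, rfl, rfl⟩, ?_⟩
      simp only [Expr.eval_mulConst]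
      rw [if_neg h1, if_pos, slot_distributor]
      · exact applyOp_fourierGate κ _ ψ
      · exact ⟨fun i i' _ => Subsingleton.elim (α := Fin 1) i i',
          fun _ => adversaryCell_distributor δ κ _⟩
    · rw [heval, hcode] at h1
      refine Ensures.skip.mono ?_
      rintro s' φ ⟨rfl, rfl⟩
      exact ⟨⟨rfl, rfl, rfl⟩, by rw [if_pos h1]⟩
  refine h1.seq ?_
  rintro s₁ φ₁ ⟨⟨e1, e2, e3⟩, rfl⟩
  have haddr : (Expr.mulConst P.N (.var 1)).eval s₁ = P.N * j := by
    rw [Expr.eval_mulConst, hjdef, ← e2]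
    rfl
  refine (Ensures.measure (by rw [haddr]; exact adversaryCell_distributor δ κ j)).seq ?_
  rintro s₂ φ₂ ⟨v, rfl, rfl⟩
  refine Ensures.emit.seq ?_
  rintro s₃ φ₃ ⟨rfl, rfl⟩
  refine Ensures.store.mono ?_
  rintro s₄ φ₄ ⟨rfl, rfl⟩
  refine ⟨?_, e1, v.val, ?_⟩
  · have := h.measure hj hD v
    rw [← announced_update] at this
    have hfilter : ∀ n, n = (particle P κ j (distributor P)).2 →
        TestState rest κ t (insert (j, distributor P) D)
          (announced P κ (Function.update s.out (j * P.N) v.val))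
          ((if j ∈ t.1 then ψ else fourierToComp (slot κ j (distributor P)) ψ).filter
            fun x => x (κ, n) = v) := by
      rintro _ rfl
      exact this
    have := hfilter _ (haddr.trans (congrArg Prod.snd (slot_distributor κ j)).symm)
    have hout : Function.update s.out (j * P.N) v.val = Function.update s₁.out
        ((Expr.mulConst P.N (.var 1)).eval { s₁.tick with
          work := Function.update s₁.work ((Expr.const 4).eval s₁) v.val })
        ((Expr.var 4).eval { s₁.tick with
          work := Function.update s₁.work ((Expr.const 4).eval s₁) v.val }) := by
      simp [Expr.eval, e3, e2, hjdef, mul_comm]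
    rw [hout] at this
    exact this
  · rw [eval_markExpr (κ := κ) (by rw [← hinp0, ← e1]; rfl)]
    simp [Expr.eval, Memory.tick, e2, hjdef]

theorem Untested.ensures_announceProg {δ : ℕ} {s : Memory} {l : List ℕ} (hl : l.length = 3)
    (hl0 : l.getD 0 0 = κ.code) (hi : s.inp = packet l (testCode t)) (hs : s.work 0 = 2 ^ δ)
    (h : Untested rest ψ) (ht : t.1 ∪ t.2 ⊆ rest κ) (hr : rest κ ⊆ Finset.range (total P δ κ)) :
    Ensures ((announceProg P).exec (adversaryCell P δ {distributor P}) s) ψ fun s' φ =>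
      TestState rest κ t {p | p.1 ∈ t.1 ∪ t.2 ∧ p.2 = distributor P} (announced P κ s'.out) φ ∧
      s'.work 3 = s.work 3 ∧ ∀ κ' j, s'.work (markAddr κ' j) =
        if κ' = κ ∧ j ∈ t.1 ∪ t.2 then 1 else s.work (markAddr κ' j) := by
  have hinp : ∀ i, s.inp (3 + i) = testCode t i := fun i => by
    rw [hi, ← hl, packet_length_add]
  have hinp0 : s.inp 0 = κ.code := by rw [hi, packet_of_lt (by omega), hl0]
  refine Ensures.store.seq ?_
  rintro s₁ φ ⟨rfl, hφ⟩
  rw [hφ]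
  suffices H : ∀ s₁ : Memory, s₁.inp = s.inp → s₁.work = Function.update s.work 1 0 →
      Ensures ((announceKind P κ).exec (adversaryCell P δ {distributor P}) s₁) ψ fun s' φ =>
      TestState rest κ t {p | p.1 ∈ t.1 ∪ t.2 ∧ p.2 = distributor P} (announced P κ s'.out) φ ∧
      s'.work 3 = s.work 3 ∧ ∀ κ' j, s'.work (markAddr κ' j) =
        if κ' = κ ∧ j ∈ t.1 ∪ t.2 then 1 else s.work (markAddr κ' j) by
    refine Ensures.progIte (fun h0 => ?_) fun h0 => ?_
    · have hκ : κ = .index := by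
        cases κ
        · exact absurd hinp0 h0
        · rfl
      subst hκ
      refine H _ ?_ ?_ <;> rfl
    · have hκ : κ = .ballot := by
        cases κ
        · rfl
        · exact absurd (hinp0.symm.trans h0) one_ne_zero
      subst hκ
      refine H _ ?_ ?_ <;> rfl
  intro s₁ hs1 hs2
  refine (Ensures.loop (fun i s' φ => s'.inp = s.inp ∧ s'.work 1 = i ∧ s'.work 3 = s.work 3 ∧
    TestState rest κ t {p | (p.1 ∈ t.1 ∪ t.2 ∧ p.1 < i) ∧ p.2 = distributor P}
      (announced P κ s'.out) φ ∧
    ∀ κ' j, s'.work (markAddr κ' j) =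
      if κ' = κ ∧ j ∈ t.1 ∪ t.2 ∧ j < i then 1 else s.work (markAddr κ' j))
    (n := total P δ κ) ?_ ?_ ?_).mono ?_
  · have : s₁.work 0 = 2 ^ δ := by rw [hs2, ← hs]; rfl
    simp [Expr.eval, this, total]
  · rintro i hin s' φ ⟨k1, k2, k3, k4, k5⟩
    have heval : (Expr.inp (.add (.const 3) (.var 1))).eval s' = testCode t i := by
      rw [← hinp, ← k1, ← k2]
      rfl
    by_cases hit : i ∈ t.1 ∪ t.2
    · have hc : testCode t i ≠ 0 := by
        unfold testCode
        rcases Finset.mem_union.1 hit with h1 | h2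
        · simp [h1]
        · by_cases h1 : i ∈ t.1 <;> simp [h1, h2]
      refine Ensures.seq (Ensures.progIte (fun _ => TestState.ensures_announceState (δ := δ)
        (s := s'.tick) hl hl0 (k1.trans hi) k4 (show s'.work 1 ∈ t.1 ∪ t.2 by rwa [k2]) ?_)
        fun h0 => absurd (heval ▸ h0) hc) ?_
      · rintro ⟨⟨-, hlt⟩, -⟩
        exact absurd hlt (by simp [Memory.tick, k2])
      · rintro s'' φ' ⟨h1, h2, v, h3⟩
        refine Ensures.store.mono ?_
        rintro s₃ φ₃ ⟨rfl, rfl⟩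
        have hw1 : s'.tick.work 1 = i := k2
        rw [hw1] at h1 h3
        have h5 := five_le_markAddr κ i
        refine ⟨h2.trans k1, ?_, ?_, ?_, fun κ' j => ?_⟩
        · have hne : (1 : ℕ) ≠ markAddr κ i := by omega
          simp [Expr.eval, Memory.tick, h3, hne, k2]
        · have hne : (3 : ℕ) ≠ markAddr κ i := by omega
          simp [Expr.eval, Memory.tick, h3, hne, k3]
        · have hset : insert (i, distributor P)
              {p : ℕ × Fin P.N | (p.1 ∈ t.1 ∪ t.2 ∧ p.1 < i) ∧ p.2 = distributor P} =
              {p | (p.1 ∈ t.1 ∪ t.2 ∧ p.1 < i + 1) ∧ p.2 = distributor P} := by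
            ext ⟨j, k⟩
            simp only [Set.mem_insert_iff, Prod.mk.injEq, Set.mem_ofPred_eq]
            constructor
            · rintro (⟨rfl, rfl⟩ | ⟨⟨h1, h2⟩, rfl⟩)
              · exact ⟨⟨hit, by omega⟩, rfl⟩
              · exact ⟨⟨h1, by omega⟩, rfl⟩
            · rintro ⟨⟨h1, h2⟩, rfl⟩
              by_cases hji : j = i
              · exact Or.inl ⟨hji, rfl⟩
              · exact Or.inr ⟨⟨h1, by omega⟩, rfl⟩
          rw [← hset]
          exact h1
        · have h5' := five_le_markAddr κ' j
          change Function.update s''.work 1 _ (markAddr κ' j) = _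
          rw [Function.update_of_ne (by omega), h3]
          by_cases he : κ' = κ ∧ j = i
          · obtain ⟨rfl, rfl⟩ := he
            rw [Function.update_self, if_pos ⟨rfl, hit, by omega⟩]
          · rw [Function.update_of_ne fun h' => he (markAddr_inj.1 h'),
              Function.update_of_ne (by omega)]
            change s'.work _ = _
            rw [k5]
            congr 1
            rw [eq_iff_iff]
            refine and_congr_right fun hκ => and_congr_right fun _ => ?_
            have : j ≠ i := fun hji => he ⟨hκ, hji⟩
            omega
    · have hc : testCode t i = 0 := by
        rw [Finset.mem_union, not_or] at hit
        simp [testCode, hit.1, hit.2]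
      refine Ensures.seq (Ensures.progIte (fun h0 => absurd (heval.trans hc) h0)
        fun _ => Ensures.skip) ?_
      rintro s'' φ' ⟨rfl, rfl⟩
      refine Ensures.store.mono ?_
      rintro s₃ φ₃ ⟨rfl, rfl⟩
      have hlt : ∀ j, (j ∈ t.1 ∪ t.2 ∧ j < i + 1) ↔ (j ∈ t.1 ∪ t.2 ∧ j < i) := fun j =>
        and_congr_right fun hj => by
          have : j ≠ i := fun hji => hit (hji ▸ hj)
          omega
      simp only [hlt]
      refine ⟨k1, ?_, ?_, k4, fun κ' j => ?_⟩
      · simp [Expr.eval, Memory.tick, k2]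
      · simp [Expr.eval, Memory.tick, k3]
      · have h5' := five_le_markAddr κ' j
        rw [← k5]
        change Function.update s'.work 1 _ (markAddr κ' j) = _
        rw [Function.update_of_ne (by omega)]
  · refine ⟨hs1, ?_, ?_, ?_, fun κ' j => ?_⟩
    · simp [Memory.tick, hs2]
    · simp [Memory.tick, hs2]
    · simp only [Nat.not_lt_zero, and_false, false_and, Set.ofPred_false]
      exact h.testState ht _
    · have h5' := five_le_markAddr κ' j
      have : s₁.tick.work = Function.update s.work 1 0 := hs2
      rw [this, Function.update_of_ne (by omega)]
      simp
  · rintro s' φ ⟨-, -, k3, k4, k5⟩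
    have hlt : ∀ j, (j ∈ t.1 ∪ t.2 ∧ j < total P δ κ) ↔ j ∈ t.1 ∪ t.2 := fun j =>
      and_iff_left_of_imp fun hj => Finset.mem_range.1 (hr (ht hj))
    simp only [hlt] at k4 k5
    exact ⟨k4, k3, k5⟩

end Announcement

/-! ### Choices of tests -/

section Counting

theorem mem_tests {δ : ℕ} {rest : Finset ℕ} {t : Finset ℕ × Finset ℕ} :
    t ∈ tests δ rest ↔ t.1 ∪ t.2 ⊆ rest ∧ Disjoint t.1 t.2 ∧ t.1.card = 2 ^ δ / 2 ∧
      (t.1 ∪ t.2).card = 2 ^ δ := by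
  simp only [tests, Finset.mem_filter, Finset.mem_product, Finset.mem_powerset,
    Finset.union_subset_iff, and_congr_right_iff]
  intro _ hd
  rw [Finset.card_union_of_disjoint hd]
  exact fun _ => Iff.rfl

theorem card_tests (δ : ℕ) (rest : Finset ℕ) :
    (tests δ rest).card = rest.card.choose (2 ^ δ) * (2 ^ δ).choose (2 ^ δ / 2) := by
  have h : (tests δ rest).card = ((rest.powersetCard (2 ^ δ)).sigma
      fun u => u.powersetCard (2 ^ δ / 2)).card := by
    refine Finset.card_nbij' (fun t => ⟨t.1 ∪ t.2, t.1⟩) (fun u => (u.2, u.1 \ u.2)) ?_ ?_ ?_ ?_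
    · intro t ht
      have := mem_tests.1 (Finset.mem_coe.1 ht)
      simp only [Finset.coe_sigma, Set.mem_sigma_iff, Finset.mem_coe, Finset.mem_powersetCard]
      exact ⟨⟨this.1, this.2.2.2⟩, Finset.subset_union_left, this.2.2.1⟩
    · rintro ⟨u, v⟩ hu
      simp only [Finset.coe_sigma, Set.mem_sigma_iff, Finset.mem_coe,
        Finset.mem_powersetCard] at hu
      refine Finset.mem_coe.2 (mem_tests.2 ?_)
      rw [Finset.union_sdiff_of_subset hu.2.1]
      exact ⟨hu.1.1, Finset.disjoint_sdiff, hu.2.2, hu.1.2⟩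
    · intro t ht
      have := mem_tests.1 (Finset.mem_coe.1 ht)
      refine Prod.ext rfl ?_
      simp only [Finset.union_sdiff_left]
      exact Finset.sdiff_eq_self_of_disjoint this.2.1.symm
    · rintro ⟨u, v⟩ hu
      simp only [Finset.coe_sigma, Set.mem_sigma_iff, Finset.mem_coe,
        Finset.mem_powersetCard] at hu
      simp only [Finset.union_sdiff_of_subset hu.2.1]
  rw [h, Finset.card_sigma, Finset.sum_congr rfl fun u hu => by
    rw [Finset.card_powersetCard, (Finset.mem_powersetCard.1 hu).2]]
  simp

theorem tests_nonempty {δ : ℕ} {rest : Finset ℕ} (h : 2 ^ δ ≤ rest.card) :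
    (tests δ rest).Nonempty := by
  rw [← Finset.card_pos, card_tests]
  exact Nat.mul_pos (Nat.choose_pos h) (Nat.choose_pos (Nat.div_le_self _ _))

/-- Each of `k` additional elements at most doubles the number of `M`-element subsets, as long as
these contain at most half of the elements. -/
theorem choose_add_le {n k M : ℕ} (h : 2 * M ≤ n) :
    (n + k).choose M ≤ 2 ^ k * n.choose M := by
  induction k with
  | zero => simp
  | succ k ih =>
    have h1 := Nat.choose_mul_succ_eq (n + k) M
    have h2 : (n + k + 1).choose M ≤ 2 * (n + k).choose M := by
      refine Nat.le_of_mul_le_mul_right (c := n + k + 1) ?_ (by omega)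
      rw [mul_assoc, h1, mul_left_comm]
      exact Nat.mul_le_mul_left _ (by omega)
    calc (n + (k + 1)).choose M ≤ 2 * (n + k).choose M := h2
      _ ≤ 2 * (2 ^ k * n.choose M) := Nat.mul_le_mul_left _ ih
      _ = 2 ^ (k + 1) * n.choose M := by ring

/-- A set `K` of states survives a random choice of tests with probability at least
`2 ^ (-|K|)`, if not more than half of the states outside of `K` are tested. -/
theorem card_tests_sdiff {δ : ℕ} {rest K : Finset ℕ} (hK : K ⊆ rest)
    (h : 2 * 2 ^ δ + K.card ≤ rest.card) :
    ((2 : ℝ) ^ K.card)⁻¹ * (tests δ rest).card ≤ (tests δ (rest \ K)).card := by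
  rw [inv_mul_le_iff₀ (by positivity), card_tests, card_tests, Finset.card_sdiff_of_subset hK]
  have h1 := choose_add_le (n := rest.card - K.card) (k := K.card) (M := 2 ^ δ) (by omega)
  rw [Nat.sub_add_cancel (by omega)] at h1
  have h2 := Nat.mul_le_mul_right ((2 ^ δ).choose (2 ^ δ / 2)) h1
  rw [mul_assoc] at h2
  exact_mod_cast h2

end Counting

/-! ### The setup phase of the attack -/

section Setup

variable {P : Params}

theorem Ensures.of_pure {α : Type} {a : α} {ψ : QState P} {Q : α → QState P → Prop}
    (h : Ensures (Pure.pure a) ψ Q) : Q a ψ := h.post (a, 1, ψ) (Multiset.mem_singleton_self _)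

theorem Prog.Tame.run {M L : ℕ} {p : Prog P} (hp : p.Tame M L) (hc : p.Classical) {s : Memory}
    (hs : s.work 0 = M) :
    (p.run s).work 0 = M ∧ (p.run s).time ≤ s.time + p.stepBound.eval L := by
  have h := hp.ensures (fun _ => True) hs (zeroState P)
  rw [hc.exec_eq] at h
  exact h.of_pure

/-- A bound for the number of steps of the adversary in one round of tests. -/
def roundBound (P : Params) (δ : ℕ) : ℕ :=
  (selectProg P).stepBound.eval (loopBound P δ) +
    (announceProg P).stepBound.eval (loopBound P δ) + 1

/-- The choice of the tests in a round of cut-and-choose. -/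
def selection (A : Adversary P) (δ : ℕ) (S : Finset (Fin P.N)) (κ : Kind) (r s : Fin P.N)
    (st : SetupState) : QComp P (Memory × (Finset ℕ × Finset ℕ)) :=
  if s ∈ S then do
    let mem ← A.select.activate (adversaryCell P δ S)
      (packet [κ.code, r, s] fun _ => 0) st.mem
    pure (mem, ((Finset.range (total P δ κ)).filter (fun j => mem.out j = 1),
      (Finset.range (total P δ κ)).filter (fun j => mem.out j = 2)))
  else do
    let t ← uniform (tests δ (st.rest κ))
    pure (st.mem, t)

/-- The tests in a round of cut-and-choose. -/
def testing (A : Adversary P) (δ : ℕ) (S : Finset (Fin P.N)) (κ : Kind) (r s : Fin P.N)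
    (st : SetupState) (mt : Memory × (Finset ℕ × Finset ℕ)) : QComp P SetupState :=
  if mt.2 ∉ tests δ (st.rest κ) then pure { st with mem := mt.1, ok := False } else do
    let mem ← A.announce.activate (adversaryCell P δ S)
      (packet [κ.code, r, s] (testCode mt.2)) mt.1
    let o ← measureTests S κ mt.2 fun j k => P.toLabel κ (mem.out (j * P.N + k))
    let mem ← A.hear.activate (adversaryCell P δ S)
      (packet [κ.code, r, s] fun i =>
        (o (i / P.N) ⟨i % P.N, Nat.mod_lt _ P.N_pos⟩).val) mem
    pure {
      mem := mem
      rest := Function.update st.rest κ (st.rest κ \ (mt.2.1 ∪ mt.2.2))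
      ok := (∀ j ∈ mt.2.1, passComp P κ (o j)) ∧ (∀ j ∈ mt.2.2, passFourier P κ (o j)) }

theorem testRound_eq (A : Adversary P) (δ : ℕ) (S : Finset (Fin P.N)) (κ : Kind)
    (r s : Fin P.N) (st : SetupState) : testRound A δ S κ r s st =
      if ¬ st.ok then pure st else selection A δ S κ r s st >>= testing A δ S κ r s st := rfl

/-- The state of the protocol after `n κ` rounds of tests of each kind `κ`, with the testers
given by `σ`. If the protocol has not been aborted after the turn of the distributor, then this
was the last turn, and exactly the corrupted ballot states are left. -/
structure SetupInv (δ T : ℕ) (σ : Equiv.Perm (Fin P.N)) (n : Kind → ℕ) (st : SetupState)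
    (ψ : QState P) : Prop where
  work_zero : st.mem.work 0 = 2 ^ δ
  guess : st.mem.work 3 = 0
  subset : ∀ κ, st.rest κ ⊆ Finset.range (total P δ κ)
  marks : ∀ κ, ∀ j < total P δ κ, st.mem.work (markAddr κ j) = 0 ↔ j ∈ st.rest κ
  untested : Untested st.rest ψ
  card : st.ok → ∀ κ, (st.rest κ).card = kept P κ + (P.N - n κ) * 2 ^ δ
  last : st.ok → ∀ κ (r : Fin P.N), r.val < n κ → σ r = distributor P →
    r.val + 1 = P.N ∧ st.rest κ = Finset.range (kept P κ)
  time : st.mem.time ≤ T + (n .ballot + n .index) * roundBound P δ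

/-- The protocol has not been aborted, and the states that the adversary wants to keep have not
been tested. -/
def Surviving (st : SetupState) : Prop :=
  st.ok ∧ ∀ κ, Finset.range (kept P κ) ⊆ st.rest κ

/-- The memory and the tests after the selection in round `r`. -/
structure Selected (δ : ℕ) (κ : Kind) (r s : Fin P.N) (st : SetupState) (mem : Memory)
    (t : Finset ℕ × Finset ℕ) : Prop where
  work_zero : mem.work 0 = 2 ^ δ
  work : ∀ a, 3 ≤ a → mem.work a = st.mem.work a
  time : mem.time ≤ st.mem.time + (selectProg P).stepBound.eval (loopBound P δ)
  last : s = distributor P → t ∈ tests δ (st.rest κ) →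
    r.val + 1 = P.N ∧ t.1 ∪ t.2 = st.rest κ \ Finset.range (kept P κ)

variable {δ T : ℕ} {σ : Equiv.Perm (Fin P.N)} {n : Kind → ℕ} {st : SetupState} {ψ : QState P}

theorem SetupInv.ensures_selection (h : SetupInv δ T σ n st ψ) (hok : st.ok) {κ : Kind}
    {r : Fin P.N} (hr : n κ = r.val) (s : Fin P.N) :
    Ensures (selection (attacker P) δ {distributor P} κ r s st) ψ (fun mt φ =>
      φ = ψ ∧ Selected δ κ r s st mt.1 mt.2) ∧
    (Surviving (P := P) st → (s = distributor P ↔ r.val + 1 = P.N) →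
      ProbGe ((2 : ℝ) ^ kept P κ)⁻¹ (selection (attacker P) δ {distributor P} κ r s st) ψ
        fun mt _ => mt.2 ∈ tests δ (st.rest κ) ∧
          Disjoint (mt.2.1 ∪ mt.2.2) (Finset.range (kept P κ))) := by
  have hM : 0 < 2 ^ δ := by positivity
  have hrN := r.isLt
  have hcard := h.card hok κ
  rw [hr] at hcard
  have hp1 : ((2 : ℝ) ^ kept P κ)⁻¹ ≤ 1 := inv_le_one_of_one_le₀ (one_le_pow₀ one_le_two)
  by_cases hs : s = distributor P
  · subst hs
    set s₀ : Memory := { st.mem with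
      inp := packet [κ.code, r.val, (distributor P).val] fun _ => 0, out := fun _ => 0 } with hs₀
    set mem := (selectProg P).run s₀ with hmem
    set t : Finset ℕ × Finset ℕ :=
      ((Finset.range (total P δ κ)).filter (fun j => mem.out j = 1),
        (Finset.range (total P δ κ)).filter (fun j => mem.out j = 2)) with ht
    have heq : selection (attacker P) δ {distributor P} κ r (distributor P) st =
        pure (mem, t) := by
      have : (selectProg P).exec (adversaryCell P δ {distributor P}) s₀ = pure mem :=
        (classical_selectProg P).exec_eq _ _
      unfold selection
      rw [if_pos (by simp)]
      change (selectProg P).exec _ s₀ >>= _ = _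
      rw [this, pure_bind_eq]
    have hw0 : s₀.work 0 = 2 ^ δ := h.work_zero
    obtain ⟨h1, h2⟩ := (tame_selectProg P δ).run (classical_selectProg P) hw0
    rw [heq]
    by_cases hlast : r.val + 1 = P.N
    · obtain ⟨k1, k2, k3, k4⟩ := run_selectProg hlast (s := s₀) rfl rfl hw0
      have hU : t.1 ∪ t.2 = st.rest κ \ Finset.range (kept P κ) := by
        ext j
        have hj2 := k3 j
        have hj := k2 j
        have hmk := h.marks κ j
        have hsub : j ∈ st.rest κ → j < total P δ κ := fun hj =>
          Finset.mem_range.1 (h.subset κ hj)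
        rw [← hmem] at hj2 hj
        have hw : s₀.work = st.mem.work := rfl
        rw [hw] at hj
        simp only [ht, Finset.mem_union, Finset.mem_filter, Finset.mem_range, Finset.mem_sdiff,
          not_lt]
        constructor
        · intro h'
          have h'' := hj.1 (by omega)
          exact ⟨(hmk h''.2.1).1 h''.2.2, h''.1⟩
        · rintro ⟨hj1, hj3⟩
          have hj4 := hsub hj1
          have := hj.2 ⟨hj3, hj4, (hmk hj4).2 hj1⟩
          omega
      refine ⟨Ensures.pure ⟨rfl, h1, fun a ha => k1 a (by omega) (by omega), h2,
        fun _ _ => ⟨hlast, hU⟩⟩, fun hG _ => (ProbGe.pure ⟨mem_tests.2 ?_, ?_⟩).weaken hp1⟩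
      · have hcU : (t.1 ∪ t.2).card = 2 ^ δ := by
          rw [hU, Finset.card_sdiff_of_subset (hG.2 κ), Finset.card_range, hcard,
            show P.N - r.val = 1 by omega]
          omega
        have hne : (Finset.range (total P δ κ)).filter (fun j => mem.out j ≠ 0) =
            t.1 ∪ t.2 := by
          rw [ht, ← Finset.filter_or]
          refine Finset.filter_congr fun j _ => ?_
          have := k3 j
          rw [← hmem] at this
          omega
        refine ⟨hU ▸ Finset.sdiff_subset, ?_, ?_, hcU⟩
        · rw [Finset.disjoint_filter]
          intro j _ h1 h2
          omega
        · rw [← hmem, hne, hcU] at k4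
          exact k4.trans (min_eq_right (Nat.div_le_self _ _))
      · simp only [hU]
        exact Finset.sdiff_disjoint
    · have hrun := run_selectProg_of_lt (P := P) (κ := κ) (r := r.val) (v := (distributor P).val)
        (by omega) (s := s₀) rfl
      have hout : mem.out = fun _ => 0 := by rw [hmem, hrun]; rfl
      refine ⟨Ensures.pure ⟨rfl, h1, fun a _ => by rw [hmem, hrun]; rfl, h2, fun _ ht' => ?_⟩,
        fun _ h' => absurd (h'.1 rfl) hlast⟩
      have := (mem_tests.1 ht').2.2.2
      simp [ht, hout] at this
      omega
  · have heq : selection (attacker P) δ {distributor P} κ r s st =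
        uniform (tests δ (st.rest κ)) >>= fun t => pure (st.mem, t) := if_neg (by simpa using hs)
    have hle : 1 * 2 ^ δ ≤ (P.N - r.val) * 2 ^ δ := Nat.mul_le_mul_right _ (by omega)
    have hne : (tests δ (st.rest κ)).Nonempty := tests_nonempty (by rw [hcard]; omega)
    rw [heq]
    refine ⟨(Ensures.uniform hne ψ).bind fun t φ ht => Ensures.pure ⟨ht.2, h.work_zero,
      fun _ _ => rfl, Nat.le_add_right _ _, fun h' => absurd h' hs⟩, fun hG hlast => ?_⟩
    have hN : r.val + 1 ≠ P.N := fun h' => hs (hlast.2 h')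
    have hle2 : 2 * 2 ^ δ ≤ (P.N - r.val) * 2 ^ δ := Nat.mul_le_mul_right _ (by omega)
    have hc := card_tests_sdiff (δ := δ) (hG.2 κ) (by
      rw [Finset.card_range, hcard]
      omega)
    rw [Finset.card_range] at hc
    have hu := ProbGe.uniform (ψ := ψ) hne (Q := fun t _ => t ∈ tests δ (st.rest κ) ∧
      Disjoint (t.1 ∪ t.2) (Finset.range (kept P κ))) _ (fun t ht => ?_) (fun t ht => ?_) hc
    · rw [← mul_one ((2 : ℝ) ^ kept P κ)⁻¹]
      exact ProbGe.bind zero_le_one (Ensures.uniform hne ψ)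
        (fun t φ _ => Ensures.pure (Q := fun _ _ => True) trivial) hu
        fun t φ _ ht => ProbGe.pure ht
    · have := mem_tests.1 ht
      exact mem_tests.2 ⟨this.1.trans Finset.sdiff_subset, this.2⟩
    · have := mem_tests.1 ht
      exact ⟨mem_tests.2 ⟨this.1.trans Finset.sdiff_subset, this.2⟩,
        Finset.disjoint_of_subset_left this.1 Finset.sdiff_disjoint⟩

theorem firstHonest_le_kept (P : Params) (κ : Kind) : firstHonest P κ ≤ kept P κ := by
  cases κ
  exacts [le_rfl, Nat.zero_le _]

theorem sum_update_succ (n : Kind → ℕ) (κ : Kind) :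
    Function.update n κ (n κ + 1) .ballot + Function.update n κ (n κ + 1) .index =
      n .ballot + n .index + 1 := by
  cases κ <;> simp <;> omega

/-- The invariant is kept by the tests of a round. The protocol survives it if the states to be kept
are not tested, since the tests of honest states are passed in all branches of positive
probability. -/
theorem SetupInv.ensures_testing (hcm : P.c ∣ P.m) (h : SetupInv δ T σ n st ψ) (hok : st.ok)
    {κ : Kind} {r : Fin P.N} (hr : n κ = r.val) {mem : Memory} {t : Finset ℕ × Finset ℕ}
    (hsel : Selected δ κ r (σ r) st mem t) :
    Ensures (testing (attacker P) δ {distributor P} κ r (σ r) st (mem, t)) ψ fun st' φ =>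
      SetupInv δ T σ (Function.update n κ (n κ + 1)) st' φ ∧
      (Surviving (P := P) st → t ∈ tests δ (st.rest κ) →
        Disjoint (t.1 ∪ t.2) (Finset.range (kept P κ)) → φ ≠ 0 → Surviving (P := P) st') := by
  have hrN := r.isLt
  have hcard := h.card hok κ
  have htime : ∀ m : Memory, m.time ≤ st.mem.time + roundBound P δ → m.time ≤ T +
      (Function.update n κ (n κ + 1) .ballot + Function.update n κ (n κ + 1) .index) *
        roundBound P δ := fun m hm => by
    rw [sum_update_succ, add_mul, one_mul]
    have := h.time
    omega
  unfold testing
  refine Ensures.ite (fun ht => Ensures.pure ⟨⟨hsel.work_zero, ?_, h.subset, ?_, h.untested,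
    fun hf => hf.elim, fun hf => hf.elim, ?_⟩, fun _ ht' => absurd ht' ht⟩) fun ht => ?_
  · exact (hsel.work 3 le_rfl).trans h.guess
  · intro κ' j hj
    have := five_le_markAddr κ' j
    rw [← h.marks κ' j hj]
    exact Eq.congr_left (hsel.work _ (by omega))
  · apply htime
    refine hsel.time.trans ?_
    unfold roundBound
    omega
  rw [not_not] at ht
  obtain ⟨ht1, ht2, ht3, ht4⟩ := mem_tests.1 ht
  dsimp only at ht1 ht2 ht3 ht4
  let s₀ : Memory :=
    { mem with inp := packet [κ.code, r.val, (σ r).val] (testCode t), out := fun _ => 0 }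
  have hann := (h.untested.ensures_announceProg (δ := δ) (s := s₀)
    rfl rfl rfl hsel.work_zero ht1 (h.subset κ)).and ((tame_announceProg P δ).ensures (s := s₀)
      (adversaryCell P δ {distributor P}) hsel.work_zero ψ)
  refine Ensures.bind hann ?_
  rintro m φ ⟨⟨k1, k2, k3⟩, k4, k5⟩
  refine (k1.ensures_measureTests (S := {distributor P}) fun p hp => by simp [hp.2]).bind ?_
  intro o φ' ho
  refine Ensures.skip.bind ?_
  rintro m' φ'' ⟨rfl, rfl⟩
  have hD : ∀ j ∈ t.1 ∪ t.2, ∀ k : Fin P.N,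
      (j, k) ∈ {p : ℕ × Fin P.N | p.1 ∈ t.1 ∪ t.2 ∧ p.2 = distributor P} ∪
        {p | p.1 ∈ t.1 ∪ t.2 ∧ p.2 ∉ ({distributor P} : Finset (Fin P.N))} := by
    intro j hj k
    by_cases hk : k = distributor P
    · exact Or.inl ⟨hj, hk⟩
    · exact Or.inr ⟨hj, by simpa using hk⟩
  have hcard' : (st.rest κ \ (t.1 ∪ t.2)).card = kept P κ + (P.N - (r.val + 1)) * 2 ^ δ := by
    rw [Finset.card_sdiff_of_subset ht1, hcard, ht4, hr,
      show P.N - r.val = (P.N - (r.val + 1)) + 1 by omega, add_mul, one_mul]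
    omega
  refine Ensures.pure ⟨⟨k4, ?_, fun κ' j hj => ?_, fun κ' j hj => ?_, ho.untested,
    fun _ κ' => ?_, fun _ κ' r' hr' hσ => ?_, ?_⟩, fun hG _ hdisj hφ => ⟨?_, fun κ' j hj => ?_⟩⟩
  · exact k2.trans ((hsel.work 3 le_rfl).trans h.guess)
  · exact h.subset κ' (mem_afterTests.1 (show j ∈ afterTests st.rest κ t κ' from hj)).1
  · change m.work (markAddr κ' j) = 0 ↔ j ∈ afterTests st.rest κ t κ'
    have := five_le_markAddr κ' j
    rw [k3, mem_afterTests, ← h.marks κ' j hj]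
    split_ifs with hif
    · simp [hif]
    · simp only [hif, not_false_eq_true, and_true]
      exact Eq.congr_left (hsel.work _ (by omega))
  · by_cases hκ : κ' = κ
    · subst hκ
      simp only [Function.update_self]
      rw [hcard', hr]
    · simp only [Function.update_of_ne hκ]
      exact h.card hok κ'
  · by_cases hκ : κ' = κ
    · subst hκ
      simp only [Function.update_self] at hr' ⊢
      by_cases hrr : r' = r
      · subst hrr
        obtain ⟨hl1, hl2⟩ := hsel.last hσ ht
        refine ⟨hl1, ?_⟩
        rw [hl2, sdiff_sdiff_right_self, Finset.inf_eq_inter] at hcard' ⊢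
        refine Finset.eq_of_subset_of_card_le Finset.inter_subset_right ?_
        rw [Finset.card_range]
        omega
      · -- An earlier turn of the distributor would have been the last one.
        have hlt : r'.val < n κ' := by
          have : r'.val ≠ r.val := fun he => hrr (Fin.ext he)
          omega
        have := (h.last hok κ' r' hlt hσ).1
        omega
    · simp only [Function.update_of_ne hκ] at hr' ⊢
      exact h.last hok κ' r' hr' hσ
  · apply htime
    have h1 := hsel.time
    change m.time + 1 ≤ _
    have h2 : m.time ≤ mem.time + (announceProg P).stepBound.eval (loopBound P δ) := k5
    unfold roundBound
    omega
  · refine ho.pass hcm hD ht2 (fun j hj => ?_) hφ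
    have := Finset.disjoint_left.1 hdisj hj
    have h2 := firstHonest_le_kept P κ
    rw [Finset.mem_range] at this
    omega
  · change j ∈ afterTests st.rest κ t κ'
    refine mem_afterTests.2 ⟨hG.2 κ' hj, ?_⟩
    rintro ⟨rfl, hjt⟩
    exact Finset.disjoint_left.1 hdisj hjt hj

theorem SetupInv.ensures_testRound (hcm : P.c ∣ P.m) (h : SetupInv δ T σ n st ψ) {κ : Kind}
    {r : Fin P.N} (hr : n κ = r.val) :
    Ensures (testRound (attacker P) δ {distributor P} κ r (σ r) st) ψ
      (SetupInv δ T σ (Function.update n κ (n κ + 1))) := by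
  rw [testRound_eq]
  refine Ensures.ite (fun hok => Ensures.pure ⟨h.work_zero, h.guess, h.subset, h.marks,
    h.untested, fun hf => absurd hf hok, fun hf => absurd hf hok, ?_⟩) fun hok => ?_
  · rw [sum_update_succ, add_mul]
    have := h.time
    omega
  · rw [not_not] at hok
    refine (h.ensures_selection hok hr (σ r)).1.bind ?_
    rintro ⟨mem, t⟩ φ ⟨rfl, hsel⟩
    exact (h.ensures_testing hcm hok hr hsel).mono fun st' φ' h' => h'.1

theorem SetupInv.probGe_testRound (hcm : P.c ∣ P.m) (h : SetupInv δ T σ n st ψ) {κ : Kind}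
    {r : Fin P.N} (hr : n κ = r.val) (hG : Surviving (P := P) st)
    (hlast : σ r = distributor P ↔ r.val + 1 = P.N) :
    ProbGe ((2 : ℝ) ^ P.N)⁻¹ (testRound (attacker P) δ {distributor P} κ r (σ r) st) ψ
      fun st' _ => Surviving (P := P) st' := by
  have hkept : kept P κ ≤ P.N := by
    have := P.N_pos
    cases κ <;> simp only [kept] <;> omega
  have hle : ((2 : ℝ) ^ P.N)⁻¹ ≤ ((2 : ℝ) ^ kept P κ)⁻¹ * 1 := by
    rw [mul_one]
    exact inv_anti₀ (by positivity) (pow_le_pow_right₀ one_le_two hkept)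
  obtain ⟨h1, h2⟩ := h.ensures_selection hG.1 hr (σ r)
  rw [testRound_eq, if_neg (not_not.2 hG.1)]
  refine (ProbGe.bind zero_le_one h1 (J := fun _ _ => True) ?_ (h2 hG hlast) ?_).weaken hle
  · rintro ⟨mem, t⟩ φ ⟨rfl, hsel⟩
    exact (h.ensures_testing hcm hG.1 hr hsel).mono fun _ _ _ => trivial
  · rintro ⟨mem, t⟩ φ ⟨rfl, hsel⟩ ⟨ht, hd⟩
    exact (h.ensures_testing hcm hG.1 hr hsel).probGe fun st' φ' h' hφ => h'.2 hG ht hd hφ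

theorem length_of_finRange_eq {N : ℕ} {l₁ l₂ : List (Fin N)} {r : Fin N}
    (h : List.finRange N = l₁ ++ r :: l₂) : l₁.length = r.val := by
  have h1 : l₁.length < (List.finRange N).length := by rw [h]; simp
  have h2 : (List.finRange N)[l₁.length] = r := by
    simp [h]
  rw [List.getElem_finRange] at h2
  rw [← h2]
  rfl

/-- All rounds of tests for one kind of states. -/
theorem SetupInv.ensures_rounds (hcm : P.c ∣ P.m) (h : SetupInv δ T σ n st ψ) {κ : Kind}
    (hn : n κ = 0) :
    Ensures ((List.finRange P.N).foldlM
      (fun st r => testRound (attacker P) δ {distributor P} κ r (σ r) st) st) ψ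
      (SetupInv δ T σ (Function.update n κ P.N)) ∧
    (Surviving (P := P) st → (∀ r, σ r = distributor P ↔ r.val + 1 = P.N) →
      ProbGe (((2 : ℝ) ^ P.N)⁻¹ ^ P.N) ((List.finRange P.N).foldlM
        (fun st r => testRound (attacker P) δ {distributor P} κ r (σ r) st) st) ψ
        fun st' _ => Surviving (P := P) st') := by
  have hstep : ∀ l₁ r l₂, List.finRange P.N = l₁ ++ r :: l₂ → ∀ st ψ,
      SetupInv δ T σ (Function.update n κ l₁.length) st ψ →
      Ensures (testRound (attacker P) δ {distributor P} κ r (σ r) st) ψ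
        (SetupInv δ T σ (Function.update n κ (l₁ ++ [r]).length)) := by
    intro l₁ r l₂ hl st ψ h'
    have := h'.ensures_testRound hcm (κ := κ) (r := r) (by simp [length_of_finRange_eq hl])
    simpa using this
  have h0 : SetupInv δ T σ (Function.update n κ ([] : List (Fin P.N)).length) st ψ := by
    simpa [← hn] using h
  refine ⟨?_, fun hG hσ => ?_⟩
  · have := Ensures.foldlM (fun l => SetupInv δ T σ (Function.update n κ l.length)) _ hstep h0
    simpa using this
  · have := ProbGe.foldlM (p := ((2 : ℝ) ^ P.N)⁻¹) (by positivity)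
      (fun l => SetupInv δ T σ (Function.update n κ l.length))
      (fun _ st _ => Surviving (P := P) st) _ hstep (fun l₁ r l₂ hl st ψ h' hG' =>
        h'.probGe_testRound hcm (κ := κ) (r := r) (by simp [length_of_finRange_eq hl]) hG' (hσ r))
      h0 hG
    simpa using this

/-- The initial choices of the attacker. -/
structure IsAttack (ch : Choices P) : Prop where
  corrupted : ch.corrupted = {distributor P}
  vote : ∀ k, ch.vote k = if k.val = 1 then 1 else 0
  perm : ∀ k, (ch.perm k).val = if k.val = 1 then 2 else if k.val = 2 then 1 else k.val

theorem isAttack_decodeChoices (hN : 3 ≤ P.N) (hc : 2 ≤ P.c) {ε : ℝ} (hε : 1 ≤ ε * P.N)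
    {out : ℕ → ℕ} (h : ∀ i < 3 * P.N, out i = choiceTable P i) :
    IsAttack (decodeChoices P ε out) := by
  have hperm : ∀ k : Fin P.N, out (P.N + k) % P.N =
      if k.val = 1 then 2 else if k.val = 2 then 1 else k.val := by
    intro k
    have hk := k.isLt
    rw [h _ (by omega), choiceTable]
    by_cases h1 : k.val = 1
    · rw [if_neg (by omega), if_pos (by omega), if_pos h1]
      exact Nat.mod_eq_of_lt (by omega)
    · by_cases h2 : k.val = 2
      · rw [if_pos (by omega), if_neg h1, if_pos h2]
        exact Nat.mod_eq_of_lt (by omega)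
      · rw [if_neg (by omega), if_neg (by omega), if_pos (by omega), if_neg h1, if_neg h2,
          Nat.add_sub_cancel_left]
        exact Nat.mod_eq_of_lt hk
  refine ⟨?_, fun k => ?_, fun k => ?_⟩
  · have hs : (Finset.univ.filter fun k : Fin P.N => out (2 * P.N + k) ≠ 0) = {distributor P} := by
      ext k
      have hk := k.isLt
      rw [Finset.mem_filter, Finset.mem_singleton, h _ (by omega), choiceTable, Fin.ext_iff]
      simp only [Finset.mem_univ, true_and, distributor]
      split_ifs <;> omega
    simp only [decodeChoices]
    rw [hs, if_pos]
    simpa using hε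
  · have hk := k.isLt
    simp only [decodeChoices]
    rw [h _ (by omega), choiceTable]
    by_cases h1 : k.val = 1
    · rw [if_pos (by omega), if_pos h1]
      exact Nat.mod_eq_of_lt (by omega)
    · rw [if_neg (by omega), if_neg (by omega), if_neg (by omega), if_neg h1, Nat.zero_mod]
  · have hbij : Function.Bijective fun k : Fin P.N =>
        (⟨out (P.N + k) % P.N, Nat.mod_lt _ P.N_pos⟩ : Fin P.N) := by
      refine Function.Involutive.bijective fun k => Fin.ext ?_
      have h1 := hperm k
      have h2 : ∀ a : ℕ, a = (if k.val = 1 then 2 else if k.val = 2 then 1 else k.val) →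
          (if a = 1 then 2 else if a = 2 then 1 else a) = k.val := by
        intro a ha
        split_ifs at * <;> omega
      exact (hperm ⟨out (P.N + k) % P.N, Nat.mod_lt _ P.N_pos⟩).trans (h2 _ h1)
    simp only [decodeChoices]
    rw [dif_pos hbij]
    exact hperm k

/-- A bound for the number of steps of the adversary before the tests. -/
def startBound (P : Params) (δ : ℕ) : ℕ :=
  δ + 3 * P.N + 3 + (prepareProg P).stepBound.eval (loopBound P δ)

/-- The result of the setup phase of the attack: if the tests are passed, exactly the corrupted
ballot states are left, and all their qudits are in state `|0⟩`. -/
structure SetupResult (δ : ℕ) (ch : Choices P) (st : SetupState) (ψ : QState P) : Prop where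
  choices : IsAttack ch
  work_zero : st.mem.work 0 = 2 ^ δ
  guess : st.mem.work 3 = 0
  rest : st.ok → st.rest .ballot = Finset.range P.N
  zero : st.ok → ∀ j < P.N, ∀ k : Fin P.N, LabelZero (slot .ballot j k) ψ
  time : st.mem.time ≤ startBound P δ + 2 * P.N * roundBound P δ

theorem untested_of_prepared {ψ : QState P} (h : Prepared (total P δ) ψ) :
    Untested (fun κ => Finset.range (total P δ κ)) ψ :=
  ⟨fun κ j hj hj' => h.1 κ j hj' (Finset.mem_range.1 hj),
    fun j _ hN k => h.2 .ballot j k (Or.inl hN)⟩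

/-- A lower bound for the probability with which the corrupted states survive. The first factor
is the probability of one order of the testers with the distributor at the end; each of the `2 N`
rounds of tests contributes a factor `2 ^ (-N)`, since at most `N` states have to be avoided. -/
def survivalBound (P : Params) : ℝ :=
  (P.N.factorial : ℝ)⁻¹ * (((2 : ℝ) ^ P.N)⁻¹ ^ P.N * ((2 : ℝ) ^ P.N)⁻¹ ^ P.N)

theorem exists_distributor_last (P : Params) : ∃ σ : Equiv.Perm (Fin P.N),
    ∀ r, σ r = distributor P ↔ r.val + 1 = P.N := by
  have hN := P.N_pos
  let l : Fin P.N := ⟨P.N - 1, by omega⟩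
  refine ⟨Equiv.swap l (distributor P), fun r => ?_⟩
  rw [← Equiv.eq_symm_apply, Equiv.symm_swap, Equiv.swap_apply_right, Fin.ext_iff]
  simp only [l]
  omega

/-- The memory and the joint state before the tests. -/
structure Started (δ : ℕ) (m : Memory) (φ : QState P) : Prop where
  prepared : Prepared (total P δ) φ
  work_zero : m.work 0 = 2 ^ δ
  work : ∀ a, 3 ≤ a → m.work a = 0
  time : m.time ≤ startBound P δ

/-- The state of the protocol before the tests. -/
def initialState (P : Params) (δ : ℕ) (m : Memory) : SetupState :=
  { mem := m, rest := fun κ => Finset.range (total P δ κ), ok := True }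

theorem Started.setupInv {m : Memory} (h : Started δ m ψ) (σ : Equiv.Perm (Fin P.N)) :
    SetupInv δ (startBound P δ) σ (fun _ => 0) (initialState P δ m) ψ := by
  refine ⟨h.work_zero, h.work 3 le_rfl, fun _ => subset_rfl, fun κ j hj => ?_,
    untested_of_prepared h.prepared, fun _ κ => ?_, fun _ κ r hr => ?_, ?_⟩
  · have := five_le_markAddr κ j
    exact iff_of_true (h.work _ (by omega)) (Finset.mem_range.2 hj)
  · simp [initialState, total]
  · exact absurd hr (Nat.not_lt_zero _)
  · have := h.time
    simpa [initialState] using this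

/-- All rounds of tests. -/
def allRounds (P : Params) (δ : ℕ) (σ : Equiv.Perm (Fin P.N)) (st : SetupState) :
    QComp P SetupState :=
  (List.finRange P.N).foldlM
    (fun st r => testRound (attacker P) δ {distributor P} .ballot r (σ r) st) st >>= fun st =>
  (List.finRange P.N).foldlM
    (fun st r => testRound (attacker P) δ {distributor P} .index r (σ r) st) st

theorem Started.allRounds (hcm : P.c ∣ P.m) {m : Memory} (h : Started δ m ψ)
    (σ : Equiv.Perm (Fin P.N)) :
    Ensures (allRounds P δ σ (initialState P δ m)) ψ
      (SetupInv δ (startBound P δ) σ fun _ => P.N) ∧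
    ((∀ r, σ r = distributor P ↔ r.val + 1 = P.N) →
      ProbGe (((2 : ℝ) ^ P.N)⁻¹ ^ P.N * ((2 : ℝ) ^ P.N)⁻¹ ^ P.N)
        (SelfTally.allRounds P δ σ (initialState P δ m)) ψ fun st _ => st.ok) := by
  have hupd : Function.update (Function.update (fun _ : Kind => 0) .ballot P.N) .index P.N =
      fun _ => P.N := funext fun κ => by cases κ <;> simp
  have h1 := (h.setupInv σ).ensures_rounds hcm (κ := .ballot) rfl
  have h2 : ∀ st φ, SetupInv δ (startBound P δ) σ (Function.update (fun _ => 0) .ballot P.N) st φ →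
      _ := fun st φ h' => h'.ensures_rounds hcm (κ := .index) (by simp)
  rw [hupd] at h2
  refine ⟨h1.1.bind fun st φ h' => (h2 st φ h').1, fun hσ => ?_⟩
  refine ProbGe.bind (by positivity) h1.1 (fun st φ h' => (h2 st φ h').1)
    (h1.2 ⟨trivial, fun κ => Finset.range_mono (Nat.le_add_right _ _)⟩ hσ) fun st φ h' hG => ?_
  exact ProbGe.mono (h2 st φ h').1 ((h2 st φ h').2 hG hσ) fun _ _ _ hG' => hG'.1

theorem SetupInv.setupResult {ch : Choices P} (hch : IsAttack ch)
    (h : SetupInv δ (startBound P δ) σ (fun _ => P.N) st ψ) : SetupResult δ ch st ψ := by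
  have hlast : st.ok → st.rest .ballot = Finset.range P.N := fun hok =>
    (h.last hok .ballot (σ.symm (distributor P)) (Fin.isLt _) (by simp)).2
  refine ⟨hch, h.work_zero, h.guess, hlast, fun hok j hj k => ?_, ?_⟩
  · exact h.untested.2 j (by rw [hlast hok]; simpa using hj) hj k
  · have := h.time
    rwa [← two_mul] at this

/-- The setup phase of the attack always has a result as described by `SetupResult`, and the tests
are passed with probability at least `survivalBound P`. -/
theorem setup_attacker (hN : 3 ≤ P.N) (hc : 2 ≤ P.c) (hcm : P.c ∣ P.m) {ε : ℝ}
    (hε : 1 ≤ ε * P.N) (δ : ℕ) :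
    Ensures (setup (attacker P) ε δ) (zeroState P) (fun u φ => SetupResult δ u.1 u.2 φ) ∧
    ProbGe (survivalBound P) (setup (attacker P) ε δ) (zeroState P) fun u _ => u.2.ok := by
  set s₀ : Memory := ⟨fun _ => 0, packet [δ] fun _ => 0, fun _ => 0, 0⟩ with hs₀
  set mem := (chooseProg P).run s₀ with hmem
  obtain ⟨c1, c2, c3⟩ := run_chooseProg P δ (s := s₀) rfl
  rw [← hmem] at c1 c2 c3
  set ch := decodeChoices P ε mem.out with hch
  have hatt : IsAttack ch := isAttack_decodeChoices hN hc hε c3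
  let cont : Memory → Equiv.Perm (Fin P.N) → QComp P (Choices P × SetupState) := fun m σ =>
    allRounds P δ σ (initialState P δ m) >>= fun st => pure (ch, st)
  let cont' : Memory → QComp P (Choices P × SetupState) := fun m =>
    uniform (Finset.univ : Finset (Equiv.Perm (Fin P.N))) >>= cont m
  set s₁ : Memory := { mem with inp := fun _ => 0, out := fun _ => 0 } with hs₁
  have hw : s₁.work 0 = 2 ^ δ := by simp [hs₁, c1]
  have heq : setup (attacker P) ε δ =
      (prepareProg P).exec (fun _ => True) s₁ >>= cont' := by
    have h1 : (chooseProg P).exec (privateCell P δ) s₀ = pure mem :=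
      (classical_chooseProg P).exec_eq _ _
    unfold setup
    change (chooseProg P).exec (privateCell P δ) s₀ >>= _ = _
    rw [h1, pure_bind_eq]
    simp only [← hch, hatt.corrupted, Finset.mem_singleton, if_true, cont', cont,
      allRounds, bind_assoc_eq]
    rfl
  have hprep : Ensures ((prepareProg P).exec (fun _ => True) s₁) (zeroState P) (Started δ) := by
    have h1 : Ensures ((prepareProg P).exec (fun _ => True) s₁) (zeroState P) fun m φ =>
        Prepared (total P δ) φ ∧ ∀ a, a ≠ 1 → m.work a = s₁.work a := by
      refine (ensures_prepareKind hw rfl prepared_zeroState).seq ?_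
      rintro m φ ⟨h1, h2⟩
      refine (ensures_prepareKind (κ := .index) (by rw [h2 0 (by omega), hw]) (by simp) h1).mono ?_
      rintro m' φ' ⟨h3, h4⟩
      refine ⟨?_, fun a ha => (h4 a ha).trans (h2 a ha)⟩
      convert h3 using 1
      funext κ
      cases κ <;> simp
    refine (h1.and ((tame_prepareProg P δ).ensures _ hw _)).mono ?_
    rintro m φ ⟨⟨h2, h3⟩, h4, h5⟩
    refine ⟨h2, h4, fun a ha => ?_, ?_⟩
    · have : a ≠ 0 := by omega
      rw [h3 a (by omega)]
      simp [hs₁, c1, hs₀, this]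
    · have : s₁.time = mem.time := rfl
      rw [this, c2] at h5
      simp only [hs₀] at h5
      unfold startBound
      omega
  have hcont : ∀ m φ, Started δ m φ → ∀ σ, Ensures (cont m σ) φ
      fun u φ' => SetupResult δ u.1 u.2 φ' := fun m φ hm σ =>
    (hm.allRounds hcm σ).1.bind fun st φ' h => Ensures.pure (h.setupResult hatt)
  have huniv : (Finset.univ : Finset (Equiv.Perm (Fin P.N))).Nonempty := Finset.univ_nonempty
  have hcont' : ∀ m φ, Started δ m φ → Ensures (cont' m) φ
      fun u φ' => SetupResult δ u.1 u.2 φ' := fun m φ hm =>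
    (Ensures.uniform huniv φ).bind fun σ φ' hφ => by
      rw [hφ.2]
      exact hcont m φ hm σ
  rw [heq]
  refine ⟨hprep.bind hcont', ?_⟩
  rw [← one_mul (survivalBound P)]
  refine ProbGe.bind (by unfold survivalBound; positivity) hprep hcont'
    (hprep.probGe (R := fun _ _ => True) fun _ _ _ _ => trivial) fun m φ hm _ => ?_
  obtain ⟨σ, hσ⟩ := exists_distributor_last P
  have hu : ProbGe (P.N.factorial : ℝ)⁻¹ (uniform (Finset.univ : Finset (Equiv.Perm (Fin P.N)))) φ
      fun τ _ => τ = σ := by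
    refine ProbGe.uniform huniv {σ} (Finset.subset_univ _) (by simp) ?_
    have : (P.N.factorial : ℝ) ≠ 0 := by exact_mod_cast P.N.factorial_ne_zero
    simp [Fintype.card_perm, this]
  refine ProbGe.bind (by positivity) (Ensures.uniform huniv φ)
    (J := fun u φ' => SetupResult δ u.1 u.2 φ') (fun τ φ' hφ => by
      rw [hφ.2]
      exact hcont m φ hm τ) hu ?_
  rintro τ φ' ⟨-, rfl⟩ rfl
  have h1 := hm.allRounds hcm τ
  rw [← mul_one (_ * _)]
  exact ProbGe.bind (J := fun _ _ => True) zero_le_one h1.1 (fun _ _ _ => Ensures.pure trivial)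
    (h1.2 hσ) fun _ _ _ hok => ProbGe.pure hok

end Setup

/-! ### The casting phase and the outcome of the attack -/

section Casting

variable {P : Params} {δ : ℕ}

theorem restState_eq {st : SetupState} {κ : Kind} {n i : ℕ} (h : st.rest κ = Finset.range n)
    (hi : i < n) : restState st κ i = i := by
  unfold restState
  rw [h, Finset.sort_range]
  simp [hi]

theorem LabelZero.of_filter_ne_zero {q : Cell} {ψ : QState P} (h : LabelZero q ψ)
    {v : Fin (P.dim q.1)} (h0 : (ψ.filter fun x => x q = v) ≠ 0) : ψ ≠ 0 ∧ v.val = 0 := by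
  obtain ⟨x, hx⟩ := Finsupp.ne_iff.1 h0
  rw [Finsupp.filter_apply, Finsupp.zero_apply] at hx
  split_ifs at hx with hv
  · refine ⟨fun he => hx (by simp [he]), ?_⟩
    rw [← hv, h x hx]
    exact Nat.zero_mod _
  · exact absurd rfl hx

/-- All entries of the blank ballots are `0` if all untested ballot states are `|0 … 0⟩`. -/
theorem ensures_measureBlank {S : Finset (Fin P.N)} {st : SetupState} {ψ : QState P} {C : Prop}
    (h : C → ∀ i < P.N, ∀ k : Fin P.N, LabelZero (slot .ballot (restState st .ballot i) k) ψ) :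
    Ensures (measureBlank S st) ψ fun b φ => C → φ ≠ 0 → ∀ k i, b.ballot k i = 0 := by
  let Z : QState P → Prop := fun φ => C → ∀ i < P.N, ∀ k : Fin P.N,
    LabelZero (slot .ballot (restState st .ballot i) k) φ
  unfold measureBlank
  refine (Ensures.foldlM (fun _ (b : Blank P) φ => Z φ ∧
    (C → φ ≠ 0 → ∀ k i, b.ballot k i = 0)) _ ?_ ⟨h, fun _ _ _ _ => rfl⟩).mono
    fun b φ hb => hb.2
  rintro - k - - b φ ⟨hZ, hb⟩
  refine Ensures.bind (Q := fun col φ' => Z φ' ∧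
    (C → φ' ≠ 0 → (∀ i, col i = 0) ∧ ∀ k i, b.ballot k i = 0)) ?_ ?_
  · refine Ensures.foldlM (fun _ (col : Fin P.N → ℕ) φ' => Z φ' ∧
      (C → φ' ≠ 0 → (∀ i, col i = 0) ∧ ∀ k i, b.ballot k i = 0)) _ ?_
      ⟨hZ, fun hC h0 => ⟨fun _ => rfl, hb hC h0⟩⟩
    rintro - i - - col φ ⟨hZ, hc⟩
    refine (Ensures.measureComp _ _).bind ?_
    rintro v φ' rfl
    refine Ensures.pure ⟨fun hC i' hi' k' => (hZ hC i' hi' k').filter _, fun hC h0 => ?_⟩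
    obtain ⟨h1, h2⟩ := (hZ hC i i.isLt k).of_filter_ne_zero h0
    obtain ⟨h3, h4⟩ := hc hC h1
    refine ⟨fun i' => ?_, h4⟩
    by_cases hi : i' = i
    · subst hi; simpa using h2
    · rw [Function.update_of_ne hi, h3]
  · rintro col φ' ⟨hZ', hc⟩
    refine (Ensures.measureComp _ _).bind ?_
    rintro v φ'' rfl
    refine Ensures.pure ⟨fun hC i' hi' k' => (hZ' hC i' hi' k').filter _, fun hC h0 k' i' => ?_⟩
    have h1 : φ' ≠ 0 := fun he => h0 (by rw [he]; exact Finsupp.filter_zero _)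
    obtain ⟨h3, h4⟩ := hc hC h1
    by_cases hk : k' = k
    · subst hk; simpa using h3 i'
    · simpa [Function.update_of_ne hk] using h4 k' i'

/-- A bound for the number of steps of the adversary during the turn of one voter. -/
def turnBound (P : Params) (δ : ℕ) : ℕ := (receiveProg P).stepBound.eval (loopBound P δ) + 2

/-- What the attacker stores when voter `k` has published its column: `1` if all entries of the
column are `0`, and otherwise `0`, by truncated subtraction. -/
def columnGuess (ch : Choices P) (b : Blank P) (β : Bool) (k : Fin P.N) : ℕ :=
  1 - ∑ i, castBallot b k (ch.actualVote β k) i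

/-- Invariant of the casting phase after `n` turns: only the distributor is corrupted, and the
guess is `g` if voter `1` has published its column, as expressed by `D`, and otherwise `0`. -/
structure CastInv (δ T : ℕ) (g : ℕ) (D : Prop) (n : ℕ) (cs : CastState P) : Prop where
  corrupted : cs.corrupted = {distributor P}
  work_zero : cs.mem.work 0 = 2 ^ δ
  guess : cs.mem.work 3 = if D then g else 0
  time : cs.mem.time ≤ T + n * turnBound P δ

/-- Each turn keeps the invariant. The program for received columns ignores all voters with
numbers from `2`; it is never activated for voter `0`, which is corrupted. -/
theorem CastInv.ensures_castTurn {T n : ℕ} {D : Prop} {cs : CastState P} {ε : ℝ}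
    {ch : Choices P} {ok : Prop} {b : Blank P} {β : Bool} {k₁ : Fin P.N} (hk₁ : k₁.val = 1)
    (h : CastInv δ T (columnGuess ch b β k₁) D n cs) (k : Fin P.N) (ψ : QState P) :
    Ensures (castTurn (attacker P) ε δ ch ok b β cs k) ψ fun cs' _ =>
      CastInv δ T (columnGuess ch b β k₁) (D ∨ ok ∧ k = k₁) (n + 1) cs' := by
  unfold castTurn
  refine Ensures.bind (Q := fun cs' _ => cs'.corrupted = {distributor P} ∧
    cs'.mem.work = cs.mem.work ∧ cs'.mem.time ≤ cs.mem.time + 1) ?_ ?_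
  · refine Ensures.ite (fun _ => Ensures.pure ⟨h.corrupted, rfl, Nat.le_succ _⟩) fun _ => ?_
    refine Ensures.skip.bind ?_
    rintro m φ ⟨rfl, rfl⟩
    refine Ensures.ite (fun hne => absurd rfl hne.1) fun _ => ?_
    exact Ensures.pure ⟨h.corrupted, rfl, le_rfl⟩
  rintro cs' φ ⟨h1, h2, h3⟩
  have h4 := h.time
  have h5 : 2 ≤ turnBound P δ := Nat.le_add_left _ _
  refine Ensures.ite (fun hk => ?_) fun hk => ?_
  · rw [h1, Finset.mem_singleton] at hk
    refine Ensures.skip.bind ?_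
    rintro m φ' ⟨rfl, rfl⟩
    have hne : k ≠ k₁ := fun he => by
      rw [← he, hk] at hk₁
      exact zero_ne_one hk₁
    refine Ensures.pure ⟨h1, (congrFun h2 0).trans h.work_zero, ?_, ?_⟩
    · simp only [hne, and_false, or_false]
      exact (congrFun h2 3).trans h.guess
    · change cs'.mem.time + 1 ≤ _
      rw [add_mul, one_mul]
      omega
  rw [h1, Finset.mem_singleton] at hk
  refine Ensures.ite (fun hok => ?_) fun hok => ?_
  · set col : ℕ → ℕ := fun i => if h : i < P.N then
      castBallot b k (ch.actualVote β k) ⟨i, h⟩ else 0 with hcol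
    set s : Memory := { cs'.mem with
      inp := packet [k.val] col
      out := fun _ => 0 } with hs
    have hw : s.work 0 = 2 ^ δ := (congrFun h2 0).trans h.work_zero
    obtain ⟨r1, r2⟩ := (tame_receiveProg P δ).run (classical_receiveProg P) hw
    obtain ⟨r3, r4⟩ := run_receiveProg P s
    have h6 : (attacker P).receive.activate (adversaryCell P δ ch.corrupted) s.inp cs'.mem =
        pure ((receiveProg P).run s) := (classical_receiveProg P).exec_eq _ s
    change Ensures ((attacker P).receive.activate _ s.inp cs'.mem >>= _) φ _
    rw [h6, pure_bind_eq]
    refine Ensures.pure ⟨h1, r1, ?_, ?_⟩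
    · change ((receiveProg P).run s).work 3 = _
      rw [r4]
      have h7 : s.inp 0 = k.val := rfl
      have h8 : k.val ≠ 0 := fun h0 => hk (Fin.ext h0)
      by_cases hkk : k = k₁
      · subst hkk
        rw [if_pos (by omega), if_pos (Or.inr ⟨hok, rfl⟩), columnGuess,
          Finset.sum_fin_eq_sum_range]
        congr 1
        exact Finset.sum_congr rfl fun i _ => packet_length_add (l := [k.val]) (b := col) i
      · have h9 : k.val ≠ 1 := fun h0 => hkk (Fin.ext (h0.trans hk₁.symm))
        rw [if_neg (by omega)]
        simp only [hkk, and_false, or_false]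
        exact (congrFun h2 3).trans h.guess
    · change ((receiveProg P).run s).time ≤ _
      have : s.time = cs'.mem.time := rfl
      rw [add_mul, one_mul]
      unfold turnBound at *
      omega
  · refine Ensures.pure ⟨h1, (congrFun h2 0).trans h.work_zero, ?_, ?_⟩
    · simp only [hok, false_and, or_false]
      exact (congrFun h2 3).trans h.guess
    · rw [add_mul, one_mul]
      omega

theorem IsAttack.permutesHonest {ch : Choices P} (h : IsAttack ch) :
    permutesHonest ch {distributor P} := by
  have h1 : (Finset.univ \ {distributor P}).map ch.perm.toEmbedding =
      Finset.univ \ {distributor P} := by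
    refine Finset.eq_of_subset_of_card_le (fun k hk => ?_) (by rw [Finset.card_map])
    obtain ⟨l, hl, rfl⟩ := Finset.mem_map.1 hk
    have h2 := h.perm l
    simp only [Finset.mem_sdiff, Finset.mem_univ, true_and, Finset.mem_singleton, Fin.ext_iff,
      Equiv.coe_toEmbedding, distributor] at hl ⊢
    split_ifs at h2 <;> omega
  unfold SelfTally.permutesHonest
  conv_rhs => rw [← h1, Finset.map_val, Multiset.map_map]
  rfl

/-- The casting phase, the tally and the guess. -/
def castAndGuess (A : Adversary P) (ε : ℝ) (δ : ℕ) (ch : Choices P) (st : SetupState)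
    (b : Blank P) (β : Bool) (π : Equiv.Perm (Fin P.N)) : QComp P (ℤ × Memory) := do
  let cs ← (List.finRange P.N).foldlM
    (fun cs i => castTurn A ε δ ch st.ok b β cs (π i))
    { mem := st.mem, corrupted := ch.corrupted, column := fun _ => none }
  if permutesHonest ch cs.corrupted then do
    let inp : ℕ → ℕ := if tallyAccepts ch b β cs then
        packet [1] fun i => if h : i < P.N then rowSum cs.column ⟨i, h⟩ else 0
      else fun _ => 0
    let mem ← A.guess.activate (adversaryCell P δ ch.corrupted) inp cs.mem
    pure (if decide (mem.out 0 ≠ 0) = β then 1 else 0, mem)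
  else pure (-1, cs.mem)

/-- The experiment after the setup phase. -/
def afterSetup (A : Adversary P) (ε : ℝ) (δ : ℕ) (ch : Choices P) (st : SetupState) :
    QComp P (ℤ × Memory) := do
  let b ← measureBlank ch.corrupted st
  let β ← uniform (Finset.univ : Finset Bool)
  let π ← uniform (Finset.univ : Finset (Equiv.Perm (Fin P.N)))
  castAndGuess A ε δ ch st b β π

theorem experiment_eq (A : Adversary P) (ε : ℝ) (δ : ℕ) :
    experiment A ε δ = setup A ε δ >>= fun u => afterSetup A ε δ u.1 u.2 := rfl

/-- A bound for the number of steps of the adversary in the whole experiment. -/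
def timeBound (P : Params) (δ : ℕ) : ℕ :=
  startBound P δ + 2 * P.N * roundBound P δ + P.N * turnBound P δ + 1

/-- The output of the experiment when the adversary emits the number `g` as its guess of `β`. -/
def outputOf (g : ℕ) (β : Bool) : ℤ := if decide (g ≠ 0) = β then 1 else 0

theorem SetupResult.ensures_castAndGuess {ch : Choices P} {st : SetupState} {ψ : QState P}
    (h : SetupResult δ ch st ψ) (ε : ℝ) (b : Blank P) (β : Bool) {k₁ : Fin P.N}
    (hk₁ : k₁.val = 1) (π : Equiv.Perm (Fin P.N)) (φ : QState P) :
    Ensures (castAndGuess (attacker P) ε δ ch st b β π) φ fun u _ =>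
      u.1 = outputOf (if st.ok then columnGuess ch b β k₁ else 0) β ∧
      u.2.time ≤ timeBound P δ := by
  set T := startBound P δ + 2 * P.N * roundBound P δ with hT
  have hfold := Ensures.foldlM (ψ := φ)
    (f := fun cs i => castTurn (attacker P) ε δ ch st.ok b β cs (π i))
    (s := { mem := st.mem, corrupted := ch.corrupted, column := fun _ => none })
    (fun l cs _ => CastInv δ T (columnGuess ch b β k₁) (st.ok ∧ π.symm k₁ ∈ l) l.length cs)
    (List.finRange P.N) (fun l₁ i l₂ _ cs φ' h' => ?_) ⟨h.choices.corrupted, h.work_zero, ?_, ?_⟩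
  · refine hfold.bind fun cs φ' hcs => ?_
    refine Ensures.ite (fun _ => ?_) fun hp => absurd ?_ hp
    · refine Ensures.emit.bind ?_
      rintro m φ'' ⟨rfl, rfl⟩
      refine Ensures.pure ⟨?_, ?_⟩
      · have hg := hcs.guess
        simp only [List.mem_finRange, and_true] at hg
        rw [← hg]
        simp [outputOf, Expr.eval]
      · have := hcs.time
        rw [List.length_finRange] at this
        exact Nat.succ_le_succ this
    · rw [hcs.corrupted]
      exact h.choices.permutesHonest
  · convert h'.ensures_castTurn hk₁ (π i) φ' (ε := ε) (ok := st.ok) using 4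
    · rw [List.mem_append, List.mem_singleton, Equiv.symm_apply_eq, eq_comm (a := k₁)]
      tauto
    · simp
  · simpa using h.guess
  · simpa using h.time

/-- With blank ballots that consist of zeros, the guess is right: the column of voter `1` adds up
to `1` for `β = false`, and to `0`, the vote of voter `2`, for `β = true`. -/
theorem IsAttack.outputOf_columnGuess (hc : 2 ≤ P.c) (hcm : P.c ∣ P.m)
    {ch : Choices P} (h : IsAttack ch) {b : Blank P} (hb : ∀ k i, b.ballot k i = 0) (β : Bool)
    {k₁ : Fin P.N} (hk₁ : k₁.val = 1) : outputOf (columnGuess ch b β k₁) β = 1 := by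
  have hm : 2 ≤ P.m := hc.trans (Nat.le_of_dvd P.m_pos hcm)
  have hsum : ∀ v, ∑ i, castBallot b k₁ v i = v % P.m := fun v => by
    rw [Finset.sum_eq_single (b.index k₁)]
    · simp [castBallot, hb]
    · intro i _ hi
      rw [castBallot, Function.update_of_ne hi, hb]
    · exact fun h => absurd (Finset.mem_univ _) h
  have hperm := h.perm k₁
  rw [if_pos hk₁] at hperm
  unfold columnGuess
  rw [hsum]
  cases β
  · simp [outputOf, Choices.actualVote, h.vote, hk₁, Nat.mod_eq_of_lt hm]
  · simp [outputOf, Choices.actualVote, h.vote, hperm]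

/-- The attacker always wins if the tests are passed. Otherwise it guesses `false` and wins with
probability `1 / 2`. -/
theorem SetupResult.afterSetup (hN : 3 ≤ P.N) (hc : 2 ≤ P.c) (hcm : P.c ∣ P.m)
    {ch : Choices P} {st : SetupState} {ψ : QState P} (h : SetupResult δ ch st ψ) (ε : ℝ) :
    Ensures (afterSetup (attacker P) ε δ ch st) ψ
      (fun u _ => (u.1 = 0 ∨ u.1 = 1) ∧ u.2.time ≤ timeBound P δ) ∧
    ProbGe (if st.ok then 1 else 1 / 2) (SelfTally.afterSetup (attacker P) ε δ ch st) ψ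
      fun u _ => u.1 = 1 := by
  let k₁ : Fin P.N := ⟨1, by omega⟩
  have hblank : Ensures (measureBlank ch.corrupted st) ψ
      fun b φ => st.ok → φ ≠ 0 → ∀ k i, b.ballot k i = 0 :=
    ensures_measureBlank fun hok i hi k => by
      rw [restState_eq (h.rest hok) hi]
      exact h.zero hok i hi k
  have hend := fun b β => h.ensures_castAndGuess ε b β (k₁ := k₁) rfl
  have hB : (Finset.univ : Finset Bool).Nonempty := Finset.univ_nonempty
  have hS : (Finset.univ : Finset (Equiv.Perm (Fin P.N))).Nonempty := Finset.univ_nonempty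
  let J : ℤ × Memory → QState P → Prop := fun u _ => (u.1 = 0 ∨ u.1 = 1) ∧ u.2.time ≤ timeBound P δ
  have h1 : ∀ b β φ, Ensures (uniform Finset.univ >>= castAndGuess (attacker P) ε δ ch st b β) φ
      fun u _ => u.1 = outputOf (if st.ok then columnGuess ch b β k₁ else 0) β ∧
        u.2.time ≤ timeBound P δ := fun b β φ =>
    (Ensures.uniform hS φ).bind fun π φ' _ => hend b β π φ'
  have h2 : ∀ b β φ, Ensures
      (uniform Finset.univ >>= castAndGuess (attacker P) ε δ ch st b β) φ J := fun b β φ =>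
    (h1 b β φ).mono fun u _ hu => ⟨by rw [hu.1]; unfold outputOf; split_ifs <;> simp, hu.2⟩
  have h3 : ∀ b φ, Ensures (uniform Finset.univ >>= fun β =>
      uniform Finset.univ >>= castAndGuess (attacker P) ε δ ch st b β) φ J := fun b φ =>
    (Ensures.uniform hB φ).bind fun β φ' _ => h2 b β φ'
  refine ⟨hblank.bind fun b φ _ => h3 b φ, ?_⟩
  split_ifs with hok
  · rw [← one_mul (1 : ℝ)]
    refine ProbGe.bind zero_le_one hblank (fun b φ _ => h3 b φ)
      (hblank.probGe (R := fun b _ => ∀ k i, b.ballot k i = 0) fun b φ hb h0 => hb hok h0)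
      fun b φ _ hb => ?_
    rw [← one_mul (1 : ℝ)]
    refine ProbGe.bind zero_le_one (Ensures.uniform hB φ) (fun β φ' _ => h2 b β φ')
      ((Ensures.uniform hB φ).probGe (R := fun _ _ => True) fun _ _ _ _ => trivial)
      fun β φ' _ _ => (h1 b β φ').probGe fun u _ hu _ => ?_
    rw [hu.1, if_pos hok]
    exact h.choices.outputOf_columnGuess hc hcm hb β rfl
  · rw [← one_mul (1 / 2 : ℝ)]
    refine ProbGe.bind (by norm_num) hblank (fun b φ _ => h3 b φ)
      (hblank.probGe (R := fun _ _ => True) fun _ _ _ _ => trivial) fun b φ _ _ => ?_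
    rw [← mul_one (1 / 2 : ℝ)]
    refine ProbGe.bind zero_le_one (Ensures.uniform hB φ) (fun β φ' _ => h2 b β φ')
      (ProbGe.uniform (Q := fun β _ => β = false) hB {false} (Finset.subset_univ _) (by simp)
        (by simp)) fun β φ' _ hβ => (h1 b β φ').probGe fun u _ hu _ => ?_
    rw [hu.1, if_neg hok, hβ]
    rfl

end Casting

/-! ### The advantage of the attacker -/

section Advantage

variable {P : Params}

theorem normSq_zeroState (P : Params) : normSq (zeroState P) = 1 := by
  simp [normSq, zeroState]

/-- A bound for the running time of the attacker, in terms of `2 ^ δ`. -/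
def timePolynomial (P : Params) : Polynomial ℕ :=
  let L : Polynomial ℕ := Polynomial.C (P.N + 1) + Polynomial.C P.N * Polynomial.X
  Polynomial.X + Polynomial.C (3 * P.N + 3) + (prepareProg P).stepBound.comp L +
    Polynomial.C (2 * P.N) *
      ((selectProg P).stepBound.comp L + (announceProg P).stepBound.comp L + 1) +
    Polynomial.C P.N * ((receiveProg P).stepBound.comp L + 2) + 1

theorem timeBound_le (P : Params) (δ : ℕ) : timeBound P δ ≤ (timePolynomial P).eval (2 ^ δ) := by
  have h := (Nat.lt_two_pow_self (n := δ)).le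
  simp only [timePolynomial, Polynomial.eval_add, Polynomial.eval_mul, Polynomial.eval_comp,
    Polynomial.eval_C, Polynomial.eval_X, Polynomial.eval_one, Polynomial.eval_ofNat]
  unfold timeBound startBound roundBound turnBound loopBound
  omega

theorem survivalBound_pos (P : Params) : 0 < survivalBound P := by
  unfold survivalBound
  have := P.N.factorial_pos
  positivity

theorem experiment_attacker (hN : 3 ≤ P.N) (hc : 2 ≤ P.c) (hcm : P.c ∣ P.m) {ε : ℝ}
    (hε : 1 ≤ ε * P.N) (δ : ℕ) : Ensures (experiment (attacker P) ε δ) (zeroState P)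
      fun u _ => (u.1 = 0 ∨ u.1 = 1) ∧ u.2.time ≤ timeBound P δ := by
  rw [experiment_eq]
  exact (setup_attacker hN hc hcm hε δ).1.bind fun u φ h => (h.afterSetup hN hc hcm ε).1

theorem isQPPT_attacker (hN : 3 ≤ P.N) (hc : 2 ≤ P.c) (hcm : P.c ∣ P.m) {ε : ℝ}
    (hε : 1 ≤ ε * P.N) : IsQPPT (attacker P) ε :=
  ⟨timePolynomial P, fun δ u hu _ =>
    ((experiment_attacker hN hc hcm hε δ).post u hu).2.trans (timeBound_le P δ)⟩

theorem probOutput_attacker_neg_one (hN : 3 ≤ P.N) (hc : 2 ≤ P.c) (hcm : P.c ∣ P.m) {ε : ℝ}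
    (hε : 1 ≤ ε * P.N) (δ : ℕ) : probOutput (attacker P) ε δ (-1) = 0 := by
  unfold probOutput
  rw [prob_eq_expect]
  refine (expect_congr (E' := fun _ _ => 0) fun u hu => if_neg ?_).trans (by simp [expect])
  have := ((experiment_attacker hN hc hcm hε δ).post u hu).1
  omega

theorem probNoFalseAttack_attacker (hN : 3 ≤ P.N) (hc : 2 ≤ P.c) (hcm : P.c ∣ P.m) {ε : ℝ}
    (hε : 1 ≤ ε * P.N) (δ : ℕ) : probNoFalseAttack (attacker P) ε δ = 1 := by
  unfold probNoFalseAttack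
  rw [prob_eq_expect, ← normSq_zeroState P, ← (experiment_attacker hN hc hcm hε δ).total]
  refine expect_congr fun u hu => if_pos ?_
  have := ((experiment_attacker hN hc hcm hε δ).post u hu).1
  omega

theorem le_winProb_attacker (hN : 3 ≤ P.N) (hc : 2 ≤ P.c) (hcm : P.c ∣ P.m) {ε : ℝ}
    (hε : 1 ≤ ε * P.N) (δ : ℕ) : 1 / 2 + survivalBound P / 2 ≤ winProb (attacker P) ε δ := by
  obtain ⟨h1, h2⟩ := setup_attacker hN hc hcm hε δ
  unfold winProb probOutput
  rw [probNoFalseAttack_attacker hN hc hcm hε, div_one, prob_eq_expect, experiment_eq,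
    expect_bind]
  unfold ProbGe at h2
  rw [normSq_zeroState, mul_one] at h2
  have h3 := h1.total
  rw [normSq_zeroState] at h3
  -- The attacker wins with probability `1` after a passed test and `1 / 2` after an aborted one.
  calc 1 / 2 + survivalBound P / 2
      ≤ expect (setup (attacker P) ε δ) (zeroState P) fun u φ =>
          1 / 2 * normSq φ + 1 / 2 * if u.2.ok then normSq φ else 0 := by
        rw [expect_add, expect_const_mul, expect_const_mul, h3]
        linarith
    _ ≤ _ := by
        refine expect_mono h1.nonneg fun u hu => ?_
        have h4 := ((h1.post u hu).afterSetup hN hc hcm ε).2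
        unfold ProbGe at h4
        refine le_trans (le_of_eq ?_) h4
        split_ifs <;> ring

theorem le_probCorruptedSurvive_attacker (hN : 3 ≤ P.N) (hc : 2 ≤ P.c) (hcm : P.c ∣ P.m)
    {ε : ℝ} (hε : 1 ≤ ε * P.N) (δ : ℕ) :
    survivalBound P ≤ probCorruptedSurvive (attacker P) ε δ := by
  obtain ⟨h1, h2⟩ := setup_attacker hN hc hcm hε δ
  unfold probCorruptedSurvive
  have h3 := ProbGe.mono (R := fun u ψ => u.2.ok ∧ ∀ j ∈ u.2.rest .ballot, ∀ k : Fin P.N,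
    ∃ v, ∀ x ∈ ψ.support, x (particle P .ballot j k) = v) h1 h2 fun u φ h hok => by
      refine ⟨hok, fun j hj k => ⟨P.toLabel .ballot 0, fun x hx => ?_⟩⟩
      rw [h.rest hok, Finset.mem_range] at hj
      exact h.zero hok j hj k x (Finsupp.mem_support_iff.1 hx)
  unfold ProbGe at h3
  rwa [normSq_zeroState, mul_one, ← prob_eq_expect] at h3

theorem not_negligible_of_le {f : ℕ → ℝ} {r : ℝ} (hr : 0 < r) (h : ∀ n, r ≤ f n) :
    ¬ Negligible f := fun hf => by
  have := hf 0
  simp only [pow_zero, one_mul] at this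
  exact absurd (ge_of_tendsto' this h) (not_le.2 hr)

end Advantage

end

end SelfTally

theorem mainTheorem1 (P : SelfTally.Params) (hN : 3 ≤ P.N) (hc : 2 ≤ P.c) (hcm : P.c ∣ P.m)
    (ε : ℝ) (hε0 : 0 < ε) (hε1 : ε < 1) (hεN : 1 ≤ ε * P.N) :
    ¬ SelfTally.QuantumPrivacy P ε ∧
      ∃ A : SelfTally.Adversary P, SelfTally.IsQPPT A ε ∧
        ∃ α : ℕ → ℝ, (∀ δ, 0 ≤ α δ) ∧ ¬ SelfTally.Negligible α ∧
          ∀ δ, SelfTally.probOutput A ε δ (-1) = 0 ∧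
            α δ ≤ SelfTally.probCorruptedSurvive A ε δ ∧
            1 / 2 + α δ ≤ SelfTally.winProb A ε δ := by
  have hpos : 0 < SelfTally.survivalBound P / 2 := half_pos (SelfTally.survivalBound_pos P)
  have hwin := SelfTally.le_winProb_attacker hN hc hcm hεN
  have htime := SelfTally.isQPPT_attacker hN hc hcm hεN
  refine ⟨fun h => ?_, SelfTally.attacker P, htime, fun _ => SelfTally.survivalBound P / 2,
    fun _ => hpos.le, SelfTally.not_negligible_of_le hpos fun _ => le_rfl, fun δ =>
    ⟨SelfTally.probOutput_attacker_neg_one hN hc hcm hεN δ, ?_, hwin δ⟩⟩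
  · refine SelfTally.not_negligible_of_le hpos (fun δ => ?_) (h _ htime)
    rw [if_neg (by simp [SelfTally.probNoFalseAttack_attacker hN hc hcm hεN])]
    linarith [hwin δ]
  · exact (half_le_self (SelfTally.survivalBound_pos P).le).trans
      (SelfTally.le_probCorruptedSurvive_attacker hN hc hcm hεN δ)
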